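/- **Setting.** Let $V$ be a Euclidean space of dimension $n\ge 1$ and let $\Phi\subset V$ be a (reduced) root system spanning $V$: a finite set of nonzero vectors that spans $V$, with $\Phi\cap\mathbb R\alpha=\{\pm\alpha\}$ and $s_\alpha\Phi=\Phi$ for every $\alpha\in\Phi$. Let $W$ be the finite Coxeter group generated by the reflections $s_\alpha$. Assume that the short roots (the roots of minimal length in their irreducible component) of all irreducible components of $\Phi$ have the same length. Fix a basis $\Delta=\{\alpha_1,\dots,\alpha_n\}$ of simple roots and let $\delta$ be half the sum of the positive roots. Let $\mathcal C_\Phi$ be the set of the subspaces spanned by nonempty sets of roots, and $\mathcal C_{\Phi_{fund}}$ the set of those spanned by nonempty sets of simple roots. A *building set* is a set $\mathcal G\subseteq \mathcal C_\Phi$ that contains all lines $\mathbb R\alpha$, $\alpha\in\Phi$, and is such that every $C\in\mathcal C_\Phi$ is the direct sum of the maximal elements of $\mathcal G$ contained in $C$. Let $\mathcal G$ be a building set with $V\in\mathcal G$ which is invariant under $Aut(\Phi)$, the group of the linear automorphisms of $V$ that map $\Phi$ onto itself. Put $\mathcal G_{fund}=\mathcal G\cap\mathcal C_{\Phi_{fund}}$.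 For a subspace $A$ let $\pi_A$ be the orthogonal projection of $\delta$ to $A$. For $B\subsetneq A$ in $\mathcal G_{fund}$ let $R^A_B$ be the quotient of the largest coefficient of $\pi_A$ by the smallest coefficient of $\pi_B$, where the coefficients of $\pi_A$ (of $\pi_B$) are taken with respect to the simple roots lying in $A$ (in $B$). Let $R^i_j$ be the maximum of all $R^A_B$ with $\dim A=i$, $\dim B=j$, and $R^i_j=1$ if there is no such pair. A list of real numbers $0<\epsilon_1<\dots<\epsilon_n$ is *suitable* if $\epsilon_i>2R^i_{i-1}\epsilon_{i-1}$ for $i=2,\dots,n$. Given a suitable list with $\epsilon_n=a$, consider the half-spaces - $\{x : (x,\delta)\le a\}$; - $\{x : (x,\delta-\pi_A)\le a-\epsilon_{\dim A}\}$ for $A\in\mathcal G_{fund}\setminus\{V\}$; - $\{x : (x,\delta-\sum_{i=1}^k\pi_{A_i})\le a-\sum_{i=1}^k\epsilon_{\dim A_i}\}$ for $B\in\mathcal C_{\Phi_{fund}}\setminus\mathcal G_{fund}$, where $A_1,\dots,A_k$ are the maximal elements of $\mathcal G_{fund}$ contained in $B$. The *permutonestohedron* $P_{\mathcal G}(\Phi)=P_{\mathcal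 G}(\Phi;\epsilon_1,\dots,\epsilon_n)$ is the intersection of the images of all these half-spaces under all elements of $W$. Let $Aut(P_{\mathcal G}(\Phi))$ be the group of the isometries of $V$ that map $P_{\mathcal G}(\Phi)$ onto itself. **Theorem.** There are infinitely many suitable lists $\epsilon_1<\dots<\epsilon_n$ such that $Aut(P_{\mathcal G}(\Phi))=Aut(\Phi)$. More precisely, for every fixed $a$, all suitable lists with $\epsilon_n=a$, except at most finitely many, satisfy $Aut(P_{\mathcal G}(\Phi))=Aut(\Phi)$; if $n\ge 2$, then for every $a>0$ infinitely many suitable lists with $\epsilon_n=a$ satisfy it. -/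

import Mathlib

namespace Permutonestohedron

open scoped InnerProductSpace

noncomputable section

variable {V : Type*} [NormedAddCommGroup V] [InnerProductSpace ℝ V]

/-! ### Root systems, simple roots, reflection group -/

/-- The orthogonal reflection `s_α` in the hyperplane orthogonal to `α`. -/
def refl (α : V) : V ≃ₗᵢ[ℝ] V := (Submodule.span ℝ {α})ᗮ.reflection

/-- A (reduced) root system spanning the Euclidean space `V`: a finite set of nonzero vectors which
spans `V`, is stable under its reflections and meets every line through a root in `{α, -α}`. -/
structure IsRootSystem (Φ : Finset V) : Prop where
  ne_zero : ∀ α ∈ Φ, α ≠ 0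
  span_eq_top : Submodule.span ℝ (Φ : Set V) = ⊤
  reduced : ∀ α ∈ Φ, ∀ c : ℝ, c • α ∈ Φ → c = 1 ∨ c = -1
  refl_mem : ∀ α ∈ Φ, ∀ β ∈ Φ, refl α β ∈ Φ

/-- The Coxeter group `W` of `Φ`, generated by the reflections in the roots. -/
def coxeterGroup (Φ : Finset V) : Subgroup (V ≃ₗᵢ[ℝ] V) :=
  Subgroup.closure {s | ∃ α ∈ Φ, s = refl α}

/-- `Δ` is a basis of simple roots: it consists of roots, and every root has coordinates which are
all nonnegative or all nonpositive. -/
structure IsSimpleBasis (Φ : Finset V) {n : ℕ} (Δ : Module.Basis (Fin n) ℝ V) : Prop where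
  mem : ∀ i, Δ i ∈ Φ
  nonneg_or_nonpos : ∀ β ∈ Φ, (∀ i, 0 ≤ Δ.repr β i) ∨ (∀ i, Δ.repr β i ≤ 0)

/-- `β` lies in the same irreducible component of `Φ` as `α`: the two are linked by a chain of
roots in which consecutive roots are not orthogonal. -/
def SameComponent (Φ : Finset V) (α β : V) : Prop :=
  Relation.ReflTransGen (fun x y : V => x ∈ Φ ∧ y ∈ Φ ∧ ⟪x, y⟫_ℝ ≠ 0) α β

/-- A short root: a root of minimal length in its irreducible component. -/
def IsShort (Φ : Finset V) (α : V) : Prop :=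
  α ∈ Φ ∧ ∀ β, SameComponent Φ α β → ‖α‖ ≤ ‖β‖

/-- The normalization of the root system: all short roots, of all the irreducible components, have
the same length. (It is automatic if there is only one component.) -/
def IsNormalized (Φ : Finset V) : Prop :=
  ∀ α β, IsShort Φ α → IsShort Φ β → ‖α‖ = ‖β‖

/-! ### Building sets -/

/-- `𝒞_Φ`: the subspaces spanned by a nonempty set of roots. -/
def rootSubspaces (Φ : Finset V) : Set (Submodule ℝ V) :=
  {U | ∃ S : Set V, S ⊆ Φ ∧ S.Nonempty ∧ U = Submodule.span ℝ S}

/-- The maximal elements of `𝒢` contained in `C`. -/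
def maxIn (𝒢 : Set (Submodule ℝ V)) (C : Submodule ℝ V) : Set (Submodule ℝ V) :=
  {U | Maximal (fun X => X ∈ 𝒢 ∧ X ≤ C) U}

/-- A building set associated to `Φ`: it consists of subspaces spanned by roots, contains the lines
spanned by the roots, and every `C ∈ 𝒞_Φ` is the direct sum of the maximal elements of `𝒢`
contained in `C`. -/
structure IsBuildingSet (Φ : Finset V) (𝒢 : Set (Submodule ℝ V)) : Prop where
  subset : 𝒢 ⊆ rootSubspaces Φ
  line_mem : ∀ α ∈ Φ, Submodule.span ℝ {α} ∈ 𝒢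
  indep : ∀ C ∈ rootSubspaces Φ, sSupIndep (maxIn 𝒢 C)
  sSup_eq : ∀ C ∈ rootSubspaces Φ, sSup (maxIn 𝒢 C) = C

/-- `𝒢` is invariant under `Aut(Φ)`. -/
def IsAutInvariant (Φ : Finset V) (𝒢 : Set (Submodule ℝ V)) : Prop :=
  ∀ φ : V ≃ₗ[ℝ] V, φ '' (Φ : Set V) = Φ → ∀ U ∈ 𝒢, U.map (φ : V →ₗ[ℝ] V) ∈ 𝒢

variable {n : ℕ}

/-- `𝒞_{Φ,fund}`: the subspaces spanned by a nonempty set of simple roots. -/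
def fundSubspaces (Δ : Module.Basis (Fin n) ℝ V) : Set (Submodule ℝ V) :=
  {U | ∃ I : Set (Fin n), I.Nonempty ∧ U = Submodule.span ℝ (Δ '' I)}

/-- `𝒢_fund`: the elements of `𝒢` that are spanned by simple roots. -/
def fund (Δ : Module.Basis (Fin n) ℝ V) (𝒢 : Set (Submodule ℝ V)) : Set (Submodule ℝ V) :=
  𝒢 ∩ fundSubspaces Δ

/-! ### The vectors `δ`, `π_A`, and suitable lists -/

open Classical in
/-- `δ`: half the sum of the positive roots. -/
def delta (Φ : Finset V) (Δ : Module.Basis (Fin n) ℝ V) : V :=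
  (1 / 2 : ℝ) • ∑ β ∈ Φ.filter (fun β => ∀ i, 0 ≤ Δ.repr β i), β

variable [FiniteDimensional ℝ V]

/-- `π_A`: the orthogonal projection of `δ` to `A`, so that `δ - π_A` is the
orthogonal projection of `δ` to the orthogonal complement of `A`. -/
def piVec (Φ : Finset V) (Δ : Module.Basis (Fin n) ℝ V) (A : Submodule ℝ V) : V :=
  A.starProjection (delta Φ Δ)

/-- The largest coefficient of `π_A` with respect to the simple roots contained in `A`. -/
def maxCoeff (Φ : Finset V) (Δ : Module.Basis (Fin n) ℝ V) (A : Submodule ℝ V) : ℝ :=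
  sSup {c | ∃ i, Δ i ∈ A ∧ c = Δ.repr (piVec Φ Δ A) i}

/-- The smallest coefficient of `π_A` with respect to the simple roots contained in `A`. -/
def minCoeff (Φ : Finset V) (Δ : Module.Basis (Fin n) ℝ V) (A : Submodule ℝ V) : ℝ :=
  sInf {c | ∃ i, Δ i ∈ A ∧ c = Δ.repr (piVec Φ Δ A) i}

/-- `R^i_j`: the maximum of the ratios (largest coefficient of `π_A`) / (smallest coefficient of
`π_B`) over all `B ⊂ A` in `𝒢_fund` with `dim B = j` and `dim A = i`. These ratios are always at
least `1`, so inserting `1` has the only effect of setting `R^i_j = 1` when there is no such pair. -/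
def ratio (Φ : Finset V) (Δ : Module.Basis (Fin n) ℝ V) (𝒢 : Set (Submodule ℝ V)) (i j : ℕ) : ℝ :=
  sSup (insert 1 {r | ∃ A ∈ fund Δ 𝒢, ∃ B ∈ fund Δ 𝒢, B < A ∧
    Module.finrank ℝ A = i ∧ Module.finrank ℝ B = j ∧
    r = maxCoeff Φ Δ A / minCoeff Φ Δ B})

/-- The term `ε_k` (`1 ≤ k ≤ n`) of a list `ε_1, …, ε_n`; zero outside that range. -/
def term (ε : Fin n → ℝ) (k : ℕ) : ℝ :=
  if h : 1 ≤ k ∧ k ≤ n then ε ⟨k - 1, by omega⟩ else 0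

/-- Suitable lists `0 < ε_1 < ε_2 < ⋯ < ε_n`, `ε_i > 2 R^i_{i-1} ε_{i-1}` for `i = 2, …, n`. -/
structure IsSuitable (Φ : Finset V) (Δ : Module.Basis (Fin n) ℝ V) (𝒢 : Set (Submodule ℝ V))
    (ε : Fin n → ℝ) : Prop where
  pos : ∀ i, 0 < ε i
  strictMono : StrictMono ε
  lt : ∀ i : ℕ, 2 ≤ i → i ≤ n → 2 * ratio Φ Δ 𝒢 i (i - 1) * term ε (i - 1) < term ε i

/-! ### The permutonestohedron

For a suitable list all the right-hand sides below are positive, so the half-spaces are the closed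
half-spaces containing the origin that are bounded by the defining hyperplanes. -/

/-- `HS_V`: the half-space `(x, δ) ≤ a`, where `a = ε_n`. -/
def halfSpaceTop (Φ : Finset V) (Δ : Module.Basis (Fin n) ℝ V) (ε : Fin n → ℝ) : Set V :=
  {x | ⟪x, delta Φ Δ⟫_ℝ ≤ term ε n}

/-- `HS_A`, for `A ∈ 𝒢_fund`, `A ≠ V`: the half-space `(x, δ_A) ≤ a - ε_{dim A}`. -/
def halfSpace (Φ : Finset V) (Δ : Module.Basis (Fin n) ℝ V) (ε : Fin n → ℝ)
    (A : Submodule ℝ V) : Set V :=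
  {x | ⟪x, delta Φ Δ - piVec Φ Δ A⟫_ℝ ≤ term ε n - term ε (Module.finrank ℝ A)}

/-- The half-space of `B ∈ 𝒞_{Φ,fund}`, `B ∉ 𝒢_fund`, with `𝒢_fund`-decomposition
`B = A_1 ⊕ ⋯ ⊕ A_k`: `(x, δ - ∑ π_{A_i}) ≤ a - ∑ ε_{dim A_i}`. The sums range over the finite set
of the maximal elements of `𝒢_fund` contained in `B`. -/
def halfSpaceSum (Φ : Finset V) (Δ : Module.Basis (Fin n) ℝ V) (𝒢 : Set (Submodule ℝ V))
    (ε : Fin n → ℝ) (B : Submodule ℝ V) : Set V :=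
  {x | ⟪x, delta Φ Δ - ∑ᶠ A ∈ maxIn (fund Δ 𝒢) B, piVec Φ Δ A⟫_ℝ ≤
    term ε n - ∑ᶠ A ∈ maxIn (fund Δ 𝒢) B, term ε (Module.finrank ℝ A)}

/-- The permutonestohedron `P_𝒢(Φ; ε_1, …, ε_n)`: the intersection of the images of all these
half-spaces under the elements of `W`. -/
def permutonestohedron (Φ : Finset V) (Δ : Module.Basis (Fin n) ℝ V) (𝒢 : Set (Submodule ℝ V))
    (ε : Fin n → ℝ) : Set V :=
  ⋂ σ ∈ coxeterGroup Φ,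
    (σ '' halfSpaceTop Φ Δ ε) ∩
    (⋂ A ∈ fund Δ 𝒢 \ {⊤}, σ '' halfSpace Φ Δ ε A) ∩
    (⋂ B ∈ fundSubspaces Δ \ fund Δ 𝒢, σ '' halfSpaceSum Φ Δ 𝒢 ε B)

/-! ### The two groups, as groups of transformations of `V` -/

end

/-- `Aut(Φ)`: the linear automorphisms of `V` that map `Φ` onto itself. -/
def rootAut {V : Type*} [NormedAddCommGroup V] [InnerProductSpace ℝ V] (Φ : Finset V) :
    Subgroup (Equiv.Perm V) where
  carrier := {g | IsLinearMap ℝ g ∧ g '' (Φ : Set V) = Φ}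
  one_mem' := ⟨⟨fun _ _ => rfl, fun _ _ => rfl⟩, by simp⟩
  mul_mem' := by
    rintro g h ⟨hg, hg'⟩ ⟨hh, hh'⟩
    refine ⟨⟨fun x y => ?_, fun c x => ?_⟩, ?_⟩
    · simp [hh.map_add, hg.map_add]
    · simp [hh.map_smul, hg.map_smul]
    · rw [Equiv.Perm.coe_mul, Set.image_comp, hh', hg']
  inv_mem' := by
    rintro g ⟨hg, hg'⟩
    refine ⟨⟨fun x y => ?_, fun c x => ?_⟩, ?_⟩
    · apply g.injective
      simp [hg.map_add]
    · apply g.injective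
      simp [hg.map_smul]
    · conv_lhs => rw [← hg']
      rw [← Set.image_comp]
      simp

/-- `Aut(P)`: the isometries of `V` that map `P` onto itself. -/
def isometryGroup {V : Type*} [NormedAddCommGroup V] (P : Set V) : Subgroup (Equiv.Perm V) where
  carrier := {g | Isometry g ∧ g '' P = P}
  one_mem' := ⟨isometry_id, by simp⟩
  mul_mem' := by
    rintro g h ⟨hg, hg'⟩ ⟨hh, hh'⟩
    refine ⟨hg.comp hh, ?_⟩
    rw [Equiv.Perm.coe_mul, Set.image_comp, hh', hg']
  inv_mem' := by
    rintro g ⟨hg, hg'⟩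
    refine ⟨hg.right_inv g.apply_symm_apply, ?_⟩
    conv_lhs => rw [← hg']
    rw [← Set.image_comp]
    simp

end Permutonestohedron

/-! Every defining inequality can be written as `⟪x, q⟫ ≤ 1`, where `q` is a Coxeter group image of
a vector `normal J` and `J` is a proper, possibly empty, set of simple roots. The vector `normal J`
is `δ - π_J` divided by `level J`. It is dominant, and it is orthogonal to exactly the simple roots
in `J`. Since an orbit contains only one dominant vector, such a normal determines `J`.

The geometric input is `Setup.exists_point`: for every `i` some point in the open chamber satisfies
the inequalities of `∅` and `{i}` with equality and all the others strictly. It rests on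
`IsSuitable.exists_weights`, the only place where the ratios `R^i_{i-1}` are really needed. Hence
the normals of `∅` and of the singletons define facets. An isometry of the polytope fixes the
origin, so it is linear, and it sends these facet normals to normals.

A symmetry fixing `normal ∅`, that is `δ`, must permute the vectors `normal {i}`: norms, inner
products with `δ` and the minimality of the offset `ε_1` leave no other image. It therefore permutes
the simple roots and preserves `Φ` (`Setup.map_simple`). Conversely, an automorphism of `Φ` is an
isometry because the short roots have equal length, and modulo the Coxeter group it permutes the
simple roots. So it preserves the polytope (`Setup.rootAut_le`).

If the two groups differ, then up to the Coxeter group some symmetry sends `normal ∅` to `normal B`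
with `B` nonempty and proper. For `n ≥ 3` this is impossible (`Setup.no_exceptional`): a well-chosen
such symmetry would send two simple roots to positive multiples of `Δ p - Δ q` and `Δ p - Δ q₂`,
which are proportional or form an acute angle. For `n = 2` the set `B` is a singleton, and equality
of norms expresses `ε_1` through `a` and `B`, which leaves finitely many lists for each `a`. For `n
= 1` every linear isometry is `±1`. Geometric lists supply infinitely many suitable ones. -/

namespace Permutonestohedron

open scoped InnerProductSpace

/-! ### Root systems, dominance and the Coxeter group. -/

section RootSystems

variable {V : Type*} [NormedAddCommGroup V] [InnerProductSpace ℝ V]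

/-! ### Reflections -/

theorem refl_apply (α x : V) : refl α x = x - (2 * ⟪x, α⟫_ℝ / ‖α‖ ^ 2) • α := by
  have h := Submodule.reflection_singleton_apply (𝕜 := ℝ) α x
  rw [refl, Submodule.reflection_orthogonal_apply, h, real_inner_comm]
  simp only [RCLike.ofReal_real_eq_id, id_eq, neg_sub]
  module

theorem refl_self (α : V) : refl α α = -α := by
  rcases eq_or_ne α 0 with rfl | h
  · simp
  · have : ‖α‖ ^ 2 ≠ 0 := by positivity
    rw [refl_apply, real_inner_self_eq_norm_sq, mul_div_assoc, div_self this]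
    module

@[simp] theorem refl_refl (α x : V) : refl α (refl α x) = x := by
  simp [refl]

theorem refl_mul_self (α : V) : refl α * refl α = 1 := by
  ext x; simp [LinearIsometryEquiv.coe_mul]

theorem refl_inv (α : V) : (refl α)⁻¹ = refl α :=
  inv_eq_of_mul_eq_one_left (refl_mul_self α)

theorem inner_refl_left (α x y : V) : ⟪refl α x, y⟫_ℝ = ⟪x, refl α y⟫_ℝ := by
  rw [← LinearIsometryEquiv.inner_map_map (refl α), refl_refl]

theorem refl_eq_self {α x : V} (h : ⟪x, α⟫_ℝ = 0) : refl α x = x := by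
  simp [refl_apply, h]

theorem inner_eq_zero_of_refl_eq_self {α x : V} (h : refl α x = x) :
    ⟪x, α⟫_ℝ = 0 := by
  have h1 : ⟪refl α x, α⟫_ℝ = ⟪x, refl α α⟫_ℝ := inner_refl_left _ _ _
  rw [h, refl_self, inner_neg_right] at h1
  linarith

theorem map_refl (g : V ≃ₗᵢ[ℝ] V) (α x : V) : g (refl α x) = refl (g α) (g x) := by
  simp [refl_apply]

theorem conj_refl (g : V ≃ₗᵢ[ℝ] V) (α : V) : g * refl α * g⁻¹ = refl (g α) := by
  ext x
  simp [LinearIsometryEquiv.coe_mul, map_refl, LinearIsometryEquiv.coe_inv]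

theorem refl_mul_eq (g : V ≃ₗᵢ[ℝ] V) (α : V) : g * refl α = refl (g α) * g := by
  rw [← conj_refl, inv_mul_cancel_right]

/-! ### Positive roots and the vector `δ` -/

variable {n : ℕ} {Φ : Finset V} {Δ : Module.Basis (Fin n) ℝ V}

/-- All the coordinates in the basis are nonnegative. -/
def IsPos (Δ : Module.Basis (Fin n) ℝ V) (v : V) : Prop := ∀ i, 0 ≤ Δ.repr v i

/-- All the inner products with the basis vectors are nonnegative. -/
def Dominant (Δ : Module.Basis (Fin n) ℝ V) (v : V) : Prop := ∀ i, 0 ≤ ⟪v, Δ i⟫_ℝ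

/-- All the inner products with the basis vectors are positive. -/
def Regular (Δ : Module.Basis (Fin n) ℝ V) (v : V) : Prop := ∀ i, 0 < ⟪v, Δ i⟫_ℝ

theorem Regular.dominant {v : V} (h : Regular Δ v) : Dominant Δ v := fun i => (h i).le

theorem inner_eq_sum (Δ : Module.Basis (Fin n) ℝ V) (v y : V) :
    ⟪v, y⟫_ℝ = ∑ i, Δ.repr v i * ⟪Δ i, y⟫_ℝ := by
  calc ⟪v, y⟫_ℝ = ⟪∑ i, Δ.repr v i • Δ i, y⟫_ℝ := by rw [Δ.sum_repr v]
    _ = _ := by simp only [sum_inner, real_inner_smul_left]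

theorem IsPos.inner_nonneg {v y : V} (hv : IsPos Δ v) (hy : Dominant Δ y) : 0 ≤ ⟪v, y⟫_ℝ := by
  rw [inner_eq_sum Δ]
  exact Finset.sum_nonneg fun i _ => mul_nonneg (hv i) (by rw [real_inner_comm]; exact hy i)

theorem IsPos.eq_zero {v y : V} (hv : IsPos Δ v) (hy : Regular Δ y) (h : ⟪v, y⟫_ℝ = 0) :
    v = 0 := by
  rw [inner_eq_sum Δ, Finset.sum_eq_zero_iff_of_nonneg] at h
  · apply Δ.ext_elem
    intro i
    have h1 := h i (Finset.mem_univ i)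
    have h2 := hy i
    rw [real_inner_comm] at h2
    rw [mul_eq_zero] at h1
    rcases h1 with h1 | h1
    · simp [h1]
    · exact absurd h1 h2.ne'
  · intro i _
    have h2 := hy i
    rw [real_inner_comm] at h2
    exact mul_nonneg (hv i) h2.le

theorem IsPos.inner_pos {v y : V} (hv : IsPos Δ v) (hy : Regular Δ y) (h : v ≠ 0) :
    0 < ⟪v, y⟫_ℝ :=
  lt_of_le_of_ne (hv.inner_nonneg hy.dominant) fun h' => h (hv.eq_zero hy h'.symm)

theorem isPos_basis (i : Fin n) : IsPos Δ (Δ i) := by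
  intro j
  simp only [Module.Basis.repr_self, Finsupp.single_apply]
  split_ifs <;> norm_num

theorem norm_simple_pos (i : Fin n) : 0 < ‖Δ i‖ := norm_pos_iff.2 (Δ.ne_zero i)

theorem repr_refl_simple (i : Fin n) (x : V) (j : Fin n) (h : j ≠ i) :
    Δ.repr (refl (Δ i) x) j = Δ.repr x j := by
  simp [refl_apply, h.symm]

theorem repr_refl_simple_self (i : Fin n) (x : V) :
    Δ.repr (refl (Δ i) x) i = Δ.repr x i - 2 * ⟪x, Δ i⟫_ℝ / ‖Δ i‖ ^ 2 := by
  simp [refl_apply]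

theorem IsRootSystem.neg_mem (hΦ : IsRootSystem Φ) {β : V} (h : β ∈ Φ) : -β ∈ Φ := by
  rw [← refl_self]; exact hΦ.refl_mem β h β h

theorem IsSimpleBasis.inner_nonpos (hΦ : IsRootSystem Φ) (hΔ : IsSimpleBasis Φ Δ)
    {i j : Fin n} (hij : i ≠ j) : ⟪Δ i, Δ j⟫_ℝ ≤ 0 := by
  have h := hΔ.nonneg_or_nonpos _ (hΦ.refl_mem _ (hΔ.mem i) _ (hΔ.mem j))
  have h1 : Δ.repr (refl (Δ i) (Δ j)) j = 1 := by
    rw [repr_refl_simple _ _ _ hij.symm]; simp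
  have h2 := repr_refl_simple_self (Δ := Δ) i (Δ j)
  rcases h with h | h
  · have h3 := h i
    rw [h2] at h3
    have hp := norm_simple_pos (Δ := Δ) i
    simp only [Module.Basis.repr_self, Finsupp.single_apply, hij.symm, if_false, zero_sub,
      Left.nonneg_neg_iff] at h3
    rw [div_le_iff₀ (by positivity)] at h3
    rw [real_inner_comm]
    linarith
  · have := h j
    linarith

theorem IsSimpleBasis.isPos_or_neg (hΔ : IsSimpleBasis Φ Δ) {β : V} (h : β ∈ Φ) :
    IsPos Δ β ∨ IsPos Δ (-β) := by
  rcases hΔ.nonneg_or_nonpos β h with h | h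
  · exact Or.inl h
  · exact Or.inr fun i => by simpa using h i

theorem isPos_of_pos (hΔ : IsSimpleBasis Φ Δ) {β : V} (h : β ∈ Φ) {j : Fin n}
    (hj : 0 < Δ.repr β j) : IsPos Δ β := by
  rcases hΔ.nonneg_or_nonpos β h with h | h
  · exact h
  · exact absurd (h j) (not_le.2 hj)

theorem IsPos.exists_ne (hΦ : IsRootSystem Φ) (hΔ : IsSimpleBasis Φ Δ) {β : V} (h : β ∈ Φ)
    (hβ : IsPos Δ β) {i : Fin n} (hi : β ≠ Δ i) : ∃ j, j ≠ i ∧ 0 < Δ.repr β j := by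
  by_contra! hc
  have h1 : β = Δ.repr β i • Δ i := by
    apply Δ.ext_elem
    intro j
    by_cases hj : j = i
    · subst hj; simp
    · have := le_antisymm (hc j hj) (hβ j)
      simp [this, Ne.symm hj]
  have h2 := hΦ.reduced (Δ i) (hΔ.mem i) (Δ.repr β i) (h1 ▸ h)
  rcases h2 with h2 | h2
  · rw [h2, one_smul] at h1; exact hi h1
  · have := hβ i
    linarith

theorem isPos_refl_simple (hΦ : IsRootSystem Φ) (hΔ : IsSimpleBasis Φ Δ) {β : V} (h : β ∈ Φ)
    (hβ : IsPos Δ β) {i : Fin n} (hi : β ≠ Δ i) : IsPos Δ (refl (Δ i) β) := by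
  obtain ⟨j, hj, hj'⟩ := hβ.exists_ne hΦ hΔ h hi
  exact isPos_of_pos hΔ (hΦ.refl_mem _ (hΔ.mem i) _ h)
    (j := j) (by rwa [repr_refl_simple _ _ _ hj])

open Classical in
/-- The positive roots. -/
noncomputable def posRoots (Φ : Finset V) (Δ : Module.Basis (Fin n) ℝ V) : Finset V :=
  Φ.filter (fun β => ∀ i, 0 ≤ Δ.repr β i)

theorem mem_posRoots {β : V} : β ∈ posRoots Φ Δ ↔ β ∈ Φ ∧ IsPos Δ β := by
  classical
  rw [posRoots, Finset.mem_filter]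
  rfl

theorem delta_eq : delta Φ Δ = (1 / 2 : ℝ) • ∑ β ∈ posRoots Φ Δ, β := rfl

/-- A simple reflection permutes the positive roots other than its own root, which it negates. -/
theorem refl_delta (hΦ : IsRootSystem Φ) (hΔ : IsSimpleBasis Φ Δ) (i : Fin n) :
    refl (Δ i) (delta Φ Δ) = delta Φ Δ - Δ i := by
  classical
  have hmem : Δ i ∈ posRoots Φ Δ := mem_posRoots.2 ⟨hΔ.mem i, isPos_basis i⟩
  have h1 : ∑ β ∈ (posRoots Φ Δ).erase (Δ i), refl (Δ i) β
      = ∑ β ∈ (posRoots Φ Δ).erase (Δ i), β := by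
    have key : ∀ β ∈ (posRoots Φ Δ).erase (Δ i),
        refl (Δ i) β ∈ (posRoots Φ Δ).erase (Δ i) := by
      intro β hβ
      rw [Finset.mem_erase, mem_posRoots] at hβ ⊢
      refine ⟨fun h => ?_, hΦ.refl_mem _ (hΔ.mem i) _ hβ.2.1,
        isPos_refl_simple hΦ hΔ hβ.2.1 hβ.2.2 hβ.1⟩
      have h2 : β = -Δ i := by
        rw [← refl_refl (Δ i) β, h, refl_self]
      have h3 := hβ.2.2 i
      rw [h2] at h3
      simp at h3
      linarith
    exact Finset.sum_nbij' (refl (Δ i)) (refl (Δ i)) key key (fun _ _ => refl_refl _ _)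
      (fun _ _ => refl_refl _ _) (fun _ _ => rfl)
  rw [delta_eq, ← Finset.add_sum_erase _ _ hmem, map_smul, map_add, map_sum, h1, refl_self]
  module

theorem inner_delta_simple (hΦ : IsRootSystem Φ) (hΔ : IsSimpleBasis Φ Δ) (i : Fin n) :
    ⟪delta Φ Δ, Δ i⟫_ℝ = ‖Δ i‖ ^ 2 / 2 := by
  have h := refl_delta hΦ hΔ i
  have h1 : ⟪refl (Δ i) (delta Φ Δ), Δ i⟫_ℝ = ⟪delta Φ Δ, refl (Δ i) (Δ i)⟫_ℝ :=
    inner_refl_left _ _ _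
  rw [h, refl_self, inner_sub_left, inner_neg_right, real_inner_self_eq_norm_sq] at h1
  linarith

theorem regular_delta (hΦ : IsRootSystem Φ) (hΔ : IsSimpleBasis Φ Δ) :
    Regular Δ (delta Φ Δ) := fun i => by
  rw [inner_delta_simple hΦ hΔ]
  have := norm_simple_pos (Δ := Δ) i
  positivity

/-! ### The Coxeter group -/

theorem refl_mem_coxeterGroup {α : V} (h : α ∈ Φ) : refl α ∈ coxeterGroup Φ :=
  Subgroup.subset_closure ⟨α, h, rfl⟩

theorem map_mem_of_mem_coxeterGroup (hΦ : IsRootSystem Φ) {σ : V ≃ₗᵢ[ℝ] V}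
    (hσ : σ ∈ coxeterGroup Φ) : ∀ β ∈ Φ, σ β ∈ Φ := by
  induction hσ using Subgroup.closure_induction with
  | mem x hx => obtain ⟨α, hα, rfl⟩ := hx; exact hΦ.refl_mem α hα
  | one => intro β h; exact h
  | mul x y _ _ hx hy => intro β h; exact hx _ (hy _ h)
  | inv x _ hx =>
    intro β hβ
    have hinj : Set.InjOn x (Φ : Set V) := x.injective.injOn
    have hsurj := Finset.surj_on_of_inj_on_of_card_le (s := Φ) (t := Φ) (fun a _ => x a) hx
      (fun a b _ _ h => x.injective h) le_rfl β hβ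
    obtain ⟨γ, hγ, rfl⟩ := hsurj
    simpa [LinearIsometryEquiv.coe_inv] using hγ

theorem finite_coxeterGroup (hΦ : IsRootSystem Φ) : (coxeterGroup Φ : Set (V ≃ₗᵢ[ℝ] V)).Finite := by
  have : Finite (coxeterGroup Φ) := by
    let f : coxeterGroup Φ → (Φ → Φ) := fun σ β =>
      ⟨σ.1 β.1, map_mem_of_mem_coxeterGroup hΦ σ.2 _ β.2⟩
    apply Finite.of_injective f
    intro σ τ h
    apply Subtype.ext
    ext x
    have hx : x ∈ Submodule.span ℝ (Φ : Set V) := hΦ.span_eq_top ▸ Submodule.mem_top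
    have := LinearMap.eqOn_span (f := (σ.1.toLinearEquiv : V →ₗ[ℝ] V))
      (g := (τ.1.toLinearEquiv : V →ₗ[ℝ] V)) (s := (Φ : Set V)) (fun β hβ => by
        have := congrFun h ⟨β, hβ⟩
        simpa [f] using this) hx
    simpa using this
  exact Set.toFinite _

/-- In the finite orbit take the element with the largest pairing with `δ`. Applying `refl (Δ i)`
changes that pairing by minus the pairing with `Δ i`, which must then be nonnegative. -/
theorem exists_dominant (hΦ : IsRootSystem Φ) (hΔ : IsSimpleBasis Φ Δ) (x : V) :
    ∃ σ ∈ coxeterGroup Φ, Dominant Δ (σ x) := by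
  obtain ⟨σ, hσ, hmax⟩ := Set.exists_max_image _ (fun σ : V ≃ₗᵢ[ℝ] V => ⟪σ x, delta Φ Δ⟫_ℝ)
    (finite_coxeterGroup hΦ) ⟨1, one_mem _⟩
  refine ⟨σ, hσ, fun i => ?_⟩
  have h := hmax (refl (Δ i) * σ) (mul_mem (refl_mem_coxeterGroup (hΔ.mem i)) hσ)
  simp only [LinearIsometryEquiv.coe_mul, Function.comp_apply] at h
  rw [inner_refl_left, refl_delta hΦ hΔ, inner_sub_right] at h
  linarith

/-- The product of the simple reflections of a word. -/
noncomputable def wordProd (Δ : Module.Basis (Fin n) ℝ V) (l : List (Fin n)) : V ≃ₗᵢ[ℝ] V :=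
  (l.map fun i => refl (Δ i)).prod

theorem wordProd_cons (i : Fin n) (l : List (Fin n)) :
    wordProd Δ (i :: l) = refl (Δ i) * wordProd Δ l := by simp [wordProd]

theorem wordProd_append (l m : List (Fin n)) :
    wordProd Δ (l ++ m) = wordProd Δ l * wordProd Δ m := by simp [wordProd]

theorem wordProd_reverse (l : List (Fin n)) : wordProd Δ l.reverse = (wordProd Δ l)⁻¹ := by
  induction l with
  | nil => simp [wordProd]
  | cons i l ih =>
    rw [List.reverse_cons, wordProd_append, ih, wordProd_cons i l, mul_inv_rev, refl_inv]
    simp [wordProd]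

theorem wordProd_mem (hΔ : IsSimpleBasis Φ Δ) (l : List (Fin n)) :
    wordProd Δ l ∈ coxeterGroup Φ := by
  induction l with
  | nil => exact one_mem _
  | cons i l ih =>
    rw [wordProd_cons]
    exact mul_mem (refl_mem_coxeterGroup (hΔ.mem i)) ih

/-- Every positive root is the image of a simple root under a product of simple reflections. -/
theorem exists_word_simple (hΦ : IsRootSystem Φ) (hΔ : IsSimpleBasis Φ Δ) {β : V} (h : β ∈ Φ)
    (hβ : IsPos Δ β) : ∃ l i, β = wordProd Δ l (Δ i) := by
  have hfin : {γ : V | γ ∈ Φ ∧ IsPos Δ γ ∧ ∃ l, β = wordProd Δ l γ}.Finite :=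
    Φ.finite_toSet.subset fun γ hγ => hγ.1
  -- Descent on the pairing with `δ`: a positive root has positive inner product with some simple
  -- root, and unless the two coincide, that reflection gives a positive root with smaller pairing.
  obtain ⟨γ, ⟨hγ, hγ', l, hl⟩, hmin⟩ := Set.exists_min_image _ (fun γ : V => ⟪γ, delta Φ Δ⟫_ℝ)
    hfin ⟨β, h, hβ, [], by simp [wordProd]⟩
  have h0 : 0 < ⟪γ, γ⟫_ℝ := by
    have := hΦ.ne_zero γ hγ
    exact real_inner_self_pos.2 this
  obtain ⟨i, hi⟩ : ∃ i, 0 < ⟪Δ i, γ⟫_ℝ := by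
    by_contra! hc
    rw [inner_eq_sum Δ] at h0
    exact absurd h0 (not_lt.2 (Finset.sum_nonpos fun i _ =>
      mul_nonpos_of_nonneg_of_nonpos (hγ' i) (hc i)))
  by_cases hγi : γ = Δ i
  · exact ⟨l, i, hγi ▸ hl⟩
  · exfalso
    have h1 := hmin (refl (Δ i) γ) ⟨hΦ.refl_mem _ (hΔ.mem i) _ hγ,
      isPos_refl_simple hΦ hΔ hγ hγ' hγi, l ++ [i], by
        rw [wordProd_append]; simp [wordProd, hl]⟩
    have hp := norm_simple_pos (Δ := Δ) i
    have hd := (regular_delta hΦ hΔ) i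
    rw [refl_apply, inner_sub_left, inner_smul_left, real_inner_comm (delta Φ Δ) (Δ i)] at h1
    rw [real_inner_comm] at hi
    have : 0 < 2 * ⟪γ, Δ i⟫_ℝ / ‖Δ i‖ ^ 2 * ⟪delta Φ Δ, Δ i⟫_ℝ := by positivity
    simp only [conj_trivial] at h1
    linarith

theorem exists_simple (hΦ : IsRootSystem Φ) (hΔ : IsSimpleBasis Φ Δ) {β : V} (h : β ∈ Φ) :
    ∃ l i, β = wordProd Δ l (Δ i) := by
  rcases hΔ.isPos_or_neg h with h1 | h1
  · exact exists_word_simple hΦ hΔ h h1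
  · obtain ⟨l, i, hl⟩ := exists_word_simple hΦ hΔ (hΦ.neg_mem h) h1
    refine ⟨l ++ [i], i, ?_⟩
    rw [wordProd_append]
    simp [wordProd, refl_self]
    rw [← wordProd, ← hl, neg_neg]

theorem exists_word (hΦ : IsRootSystem Φ) (hΔ : IsSimpleBasis Φ Δ) {σ : V ≃ₗᵢ[ℝ] V}
    (hσ : σ ∈ coxeterGroup Φ) : ∃ l, σ = wordProd Δ l := by
  induction hσ using Subgroup.closure_induction with
  | mem x hx =>
    obtain ⟨α, hα, rfl⟩ := hx
    obtain ⟨l, i, rfl⟩ := exists_simple hΦ hΔ hα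
    refine ⟨l ++ [i] ++ l.reverse, ?_⟩
    rw [wordProd_append, wordProd_append, wordProd_reverse, ← conj_refl]
    simp [wordProd]
  | one => exact ⟨[], by simp [wordProd]⟩
  | mul x y _ _ hx hy =>
    obtain ⟨l, rfl⟩ := hx
    obtain ⟨m, rfl⟩ := hy
    exact ⟨l ++ m, (wordProd_append l m).symm⟩
  | inv x _ hx =>
    obtain ⟨l, rfl⟩ := hx
    exact ⟨l.reverse, (wordProd_reverse l).symm⟩

/-- The deletion property. -/
theorem exists_delete (hΦ : IsRootSystem Φ) (hΔ : IsSimpleBasis Φ Δ) (i : Fin n)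
    (l : List (Fin n)) (h : ¬ IsPos Δ (wordProd Δ l (Δ i))) :
    ∃ l' : List (Fin n), l'.length + 1 = l.length ∧ wordProd Δ l * refl (Δ i) = wordProd Δ l' := by
  induction l with
  | nil => exact absurd (isPos_basis i) (by simpa [wordProd] using h)
  | cons j t ih =>
    by_cases ht : IsPos Δ (wordProd Δ t (Δ i))
    · have hmem := map_mem_of_mem_coxeterGroup hΦ (wordProd_mem hΔ t) _ (hΔ.mem i)
      -- The reflection in `Δ j` makes the positive root `wordProd Δ t (Δ i)` negative, and the only
      -- positive root with this property is `Δ j`.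
      have hj : wordProd Δ t (Δ i) = Δ j := by
        by_contra hne
        apply h
        rw [wordProd_cons]
        exact isPos_refl_simple hΦ hΔ hmem ht hne
      refine ⟨t, by simp, ?_⟩
      rw [wordProd_cons, mul_assoc, refl_mul_eq, hj, ← mul_assoc, refl_mul_self, one_mul]
    · obtain ⟨l', hl', h'⟩ := ih ht
      exact ⟨j :: l', by simp [hl'], by rw [wordProd_cons, mul_assoc, h', wordProd_cons]⟩

/-- Induction on the length of the word, removing its last letter `i`. If the rest `t` keeps `Δ i`
positive, the difference grows by a nonnegative multiple of a positive root. If not, the deletion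
property gives a shorter word for the same element. -/
theorem isPos_sub_wordProd (hΦ : IsRootSystem Φ) (hΔ : IsSimpleBasis Φ Δ) {v : V}
    (hv : Dominant Δ v) (k : ℕ) : ∀ l : List (Fin n), l.length = k →
    IsPos Δ (v - wordProd Δ l v) := by
  induction k using Nat.strong_induction_on with
  | _ k ih =>
    intro l hl
    rcases List.eq_nil_or_concat' l with rfl | ⟨t, i, rfl⟩
    · intro j; simp [wordProd]
    · rw [List.length_append, List.length_singleton] at hl
      by_cases ht : IsPos Δ (wordProd Δ t (Δ i))
      · have h1 := ih t.length (by omega) t rfl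
        have hp := norm_simple_pos (Δ := Δ) i
        have h2 : v - wordProd Δ (t ++ [i]) v = (v - wordProd Δ t v) +
            (2 * ⟪v, Δ i⟫_ℝ / ‖Δ i‖ ^ 2) • wordProd Δ t (Δ i) := by
          rw [wordProd_append]
          simp only [wordProd, List.map_cons, List.map_nil, List.prod_singleton,
            LinearIsometryEquiv.coe_mul, Function.comp_apply, refl_apply, map_sub, map_smul]
          module
        rw [h2]
        intro j
        have h3 : 0 ≤ 2 * ⟪v, Δ i⟫_ℝ / ‖Δ i‖ ^ 2 := by
          have := hv i
          positivity
        simpa using add_nonneg (h1 j) (mul_nonneg h3 (ht j))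
      · obtain ⟨l', hl', h'⟩ := exists_delete hΦ hΔ i t ht
        have : wordProd Δ (t ++ [i]) = wordProd Δ l' := by
          rw [wordProd_append, ← h']; simp [wordProd]
        rw [this]
        exact ih l'.length (by omega) l' rfl

theorem isPos_sub_map (hΦ : IsRootSystem Φ) (hΔ : IsSimpleBasis Φ Δ) {v : V}
    (hv : Dominant Δ v) {σ : V ≃ₗᵢ[ℝ] V} (hσ : σ ∈ coxeterGroup Φ) : IsPos Δ (v - σ v) := by
  obtain ⟨l, rfl⟩ := exists_word hΦ hΔ hσ
  exact isPos_sub_wordProd hΦ hΔ hv _ l rfl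

theorem inner_map_le (hΦ : IsRootSystem Φ) (hΔ : IsSimpleBasis Φ Δ) {v y : V}
    (hv : Dominant Δ v) (hy : Dominant Δ y) {σ : V ≃ₗᵢ[ℝ] V} (hσ : σ ∈ coxeterGroup Φ) :
    ⟪σ v, y⟫_ℝ ≤ ⟪v, y⟫_ℝ := by
  have := (isPos_sub_map hΦ hΔ hv hσ).inner_nonneg hy
  rw [inner_sub_left] at this
  linarith

theorem map_eq_of_inner_eq (hΦ : IsRootSystem Φ) (hΔ : IsSimpleBasis Φ Δ) {v y : V}
    (hv : Dominant Δ v) (hy : Regular Δ y) {σ : V ≃ₗᵢ[ℝ] V} (hσ : σ ∈ coxeterGroup Φ)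
    (h : ⟪σ v, y⟫_ℝ = ⟪v, y⟫_ℝ) : σ v = v := by
  have := (isPos_sub_map hΦ hΔ hv hσ).eq_zero hy (by rw [inner_sub_left, h, sub_self])
  exact (sub_eq_zero.1 this).symm

/-- Applied to `σ` and to its inverse, `inner_map_le` shows that `v` and `σ v` pair equally with
`δ`. This is the equality case, so each orbit has only one dominant vector. -/
theorem map_eq_of_dominant (hΦ : IsRootSystem Φ) (hΔ : IsSimpleBasis Φ Δ) {v : V}
    (hv : Dominant Δ v) {σ : V ≃ₗᵢ[ℝ] V} (hσ : σ ∈ coxeterGroup Φ) (h : Dominant Δ (σ v)) :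
    σ v = v := by
  refine map_eq_of_inner_eq hΦ hΔ hv (regular_delta hΦ hΔ) hσ
    (le_antisymm (inner_map_le hΦ hΔ hv (regular_delta hΦ hΔ).dominant hσ) ?_)
  have := inner_map_le hΦ hΔ h (regular_delta hΦ hΔ).dominant (inv_mem hσ)
  simpa [LinearIsometryEquiv.coe_inv] using this

theorem eq_zero_of_inner_simple {x : V} (h : ∀ i, ⟪x, Δ i⟫_ℝ = 0) : x = 0 := by
  have : ⟪x, x⟫_ℝ = 0 := by
    rw [inner_eq_sum Δ]
    exact Finset.sum_eq_zero fun i _ => by rw [real_inner_comm, h i, mul_zero]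
  exact inner_self_eq_zero.1 this

theorem eq_of_inner_simple (Δ : Module.Basis (Fin n) ℝ V) {x y : V}
    (h : ∀ i, ⟪x, Δ i⟫_ℝ = ⟪y, Δ i⟫_ℝ) : x = y := by
  rw [← sub_eq_zero]
  exact eq_zero_of_inner_simple (Δ := Δ) fun i => by rw [inner_sub_left, h i, sub_self]

end RootSystems

/-! ### Automorphisms of the root system. -/

section Automorphisms

variable {V : Type*} [NormedAddCommGroup V] [InnerProductSpace ℝ V]
variable {n : ℕ} {Φ : Finset V} {Δ : Module.Basis (Fin n) ℝ V}

/-! ### Automorphisms of the root system are isometries -/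

/-- This is the invariance of the Cartan numbers. Both `refl (g α)` and the conjugate of `refl α` by
`g` negate `g α` and preserve the roots, so their composite is the shear `y ↦ y + f y • g α` with `f
(g α) = 0`. Its iterates move `g x` along an arithmetic progression inside the finite set `Φ`, which
forces `f (g x) = 0`. -/
theorem inner_map_map_mul (hΦ : IsRootSystem Φ) (g : V ≃ₗ[ℝ] V) (hg : ∀ α ∈ Φ, g α ∈ Φ)
    (hg' : ∀ α ∈ Φ, g.symm α ∈ Φ) {x α : V} (hx : x ∈ Φ) (hα : α ∈ Φ) :
    ⟪g x, g α⟫_ℝ * ‖α‖ ^ 2 = ⟪x, α⟫_ℝ * ‖g α‖ ^ 2 := by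
  have hα0 : 0 < ‖α‖ := norm_pos_iff.2 (hΦ.ne_zero α hα)
  have hγ0 : 0 < ‖g α‖ := norm_pos_iff.2 (hΦ.ne_zero _ (hg α hα))
  set f : V → ℝ := fun y => 2 * ⟪y, g α⟫_ℝ / ‖g α‖ ^ 2 - 2 * ⟪g.symm y, α⟫_ℝ / ‖α‖ ^ 2 with hf
  have hfγ : f (g α) = 0 := by
    simp only [hf, LinearEquiv.symm_apply_apply, real_inner_self_eq_norm_sq]
    field_simp
    ring
  have hfadd : ∀ (y : V) (c : ℝ), f (y + c • g α) = f y := by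
    intro y c
    have : f (y + c • g α) = f y + c * f (g α) := by
      simp only [hf, inner_add_left, real_inner_smul_left, map_add, map_smul]
      ring
    rw [this, hfγ, mul_zero, add_zero]
  have hstep : ∀ y ∈ Φ, y + f y • g α ∈ Φ := by
    intro y hy
    have h1 : g (refl α (g.symm (refl (g α) y))) ∈ Φ :=
      hg _ (hΦ.refl_mem _ hα _ (hg' _ (hΦ.refl_mem _ (hg _ hα) _ hy)))
    convert h1 using 1
    simp only [hf, refl_apply, map_sub, map_smul, LinearEquiv.apply_symm_apply,
      LinearEquiv.symm_apply_apply, real_inner_self_eq_norm_sq]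
    have : 2 * ‖α‖ ^ 2 / ‖α‖ ^ 2 = 2 := by field_simp
    rw [this]
    module
  have hall : ∀ k : ℕ, g x + ((k : ℝ) * f (g x)) • g α ∈ Φ := by
    intro k
    induction k with
    | zero => simpa using hg x hx
    | succ k ih =>
      have := hstep _ ih
      rw [hfadd, add_assoc, ← add_smul] at this
      convert this using 3
      push_cast
      ring
  have hzero : f (g x) = 0 := by
    by_contra hne
    refine Set.not_injOn_infinite_finite_image (s := Set.univ) Set.infinite_univ
      (f := fun k : ℕ => g x + ((k : ℝ) * f (g x)) • g α) (Φ.finite_toSet.subset ?_) ?_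
    · rintro _ ⟨k, -, rfl⟩; exact hall k
    · intro k _ l _ h
      have h1 : ((k : ℝ) * f (g x)) • g α = ((l : ℝ) * f (g x)) • g α := add_left_cancel h
      have h2 := smul_left_injective ℝ (norm_pos_iff.1 hγ0) h1
      exact_mod_cast mul_right_cancel₀ hne h2
  simp only [hf, LinearEquiv.symm_apply_apply] at hzero
  field_simp at hzero
  linarith

theorem sameComponent_map (hΦ : IsRootSystem Φ) (g : V ≃ₗ[ℝ] V) (hg : ∀ α ∈ Φ, g α ∈ Φ)
    (hg' : ∀ α ∈ Φ, g.symm α ∈ Φ) {α β : V} (h : SameComponent Φ α β) :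
    SameComponent Φ (g α) (g β) := by
  refine Relation.ReflTransGen.lift g ?_ _ _ h
  rintro a b ⟨ha, hb, hab⟩
  refine ⟨hg a ha, hg b hb, fun h0 => hab ?_⟩
  have := inner_map_map_mul hΦ g hg hg' ha hb
  rw [h0, zero_mul, eq_comm, mul_eq_zero] at this
  have hb0 : 0 < ‖g b‖ := norm_pos_iff.2 (hΦ.ne_zero _ (hg b hb))
  exact this.resolve_right (by positivity)

/-- For two nonorthogonal roots, comparing `inner_map_map_mul` with its mirror image shows that `g`
scales both lengths by the same factor. The factor is thus constant along chains. -/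
theorem norm_map_mul_of_sameComponent (hΦ : IsRootSystem Φ) (g : V ≃ₗ[ℝ] V)
    (hg : ∀ α ∈ Φ, g α ∈ Φ) (hg' : ∀ α ∈ Φ, g.symm α ∈ Φ) {α β : V}
    (h : SameComponent Φ α β) : ‖g α‖ * ‖β‖ = ‖α‖ * ‖g β‖ := by
  induction h with
  | refl => ring
  | @tail b c hab hbc ih =>
    obtain ⟨hb, hc, hbc⟩ := hbc
    have h1 := inner_map_map_mul hΦ g hg hg' hb hc
    have h2 := inner_map_map_mul hΦ g hg hg' hc hb
    rw [real_inner_comm, real_inner_comm b c] at h2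
    have hb0 : 0 < ‖b‖ := norm_pos_iff.2 (hΦ.ne_zero _ hb)
    have hgc : 0 < ‖g c‖ := norm_pos_iff.2 (hΦ.ne_zero _ (hg c hc))
    have h3 : (‖g b‖ * ‖c‖) ^ 2 = (‖b‖ * ‖g c‖) ^ 2 := by
      apply mul_left_cancel₀ hbc
      linear_combination ‖b‖ ^ 2 * h1 - ‖c‖ ^ 2 * h2
    have h4 : ‖g b‖ * ‖c‖ = ‖b‖ * ‖g c‖ := by
      rwa [sq_eq_sq₀ (by positivity) (by positivity)] at h3
    apply mul_left_cancel₀ hb0.ne'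
    linear_combination ‖c‖ * ih + ‖α‖ * h4

/-- A short root of the component of `β` goes to a short root of the image component. The
normalization makes their lengths equal, so the scaling factor of the component is `1`. -/
theorem norm_map_root (hΦ : IsRootSystem Φ) (hnorm : IsNormalized Φ) (g : V ≃ₗ[ℝ] V)
    (hg : ∀ α ∈ Φ, g α ∈ Φ) (hg' : ∀ α ∈ Φ, g.symm α ∈ Φ) {β : V} (hβ : β ∈ Φ) :
    ‖g β‖ = ‖β‖ := by
  obtain ⟨α, ⟨hα, hβα⟩, hmin⟩ := Set.exists_min_image {γ | γ ∈ Φ ∧ SameComponent Φ β γ} norm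
    (Φ.finite_toSet.subset fun γ hγ => hγ.1) ⟨β, hβ, Relation.ReflTransGen.refl⟩
  have hα0 : 0 < ‖α‖ := norm_pos_iff.2 (hΦ.ne_zero _ hα)
  have hmem : ∀ {x y : V}, x ∈ Φ → SameComponent Φ x y → y ∈ Φ := by
    intro x y hx h
    induction h with
    | refl => exact hx
    | tail _ h _ => exact h.2.1
  have hshort : IsShort Φ α :=
    ⟨hα, fun γ hγ => hmin γ ⟨hmem hα hγ, hβα.trans hγ⟩⟩
  have hshort' : IsShort Φ (g α) := by
    refine ⟨hg α hα, fun γ hγ => ?_⟩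
    have h1 : SameComponent Φ α (g.symm γ) := by
      simpa using sameComponent_map hΦ g.symm hg' (by simpa using hg) hγ
    have h2 := norm_map_mul_of_sameComponent hΦ g hg hg' h1
    rw [g.apply_symm_apply] at h2
    have h3 := hshort.2 _ h1
    have h4 : ‖g α‖ * ‖α‖ ≤ ‖γ‖ * ‖α‖ := by
      calc ‖g α‖ * ‖α‖ ≤ ‖g α‖ * ‖g.symm γ‖ := by gcongr
        _ = ‖γ‖ * ‖α‖ := by rw [h2, mul_comm]
    exact le_of_mul_le_mul_right h4 hα0
  have h5 := norm_map_mul_of_sameComponent hΦ g hg hg' hβα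
  rw [hnorm _ _ hshort' hshort] at h5
  exact mul_right_cancel₀ hα0.ne' h5

theorem inner_map_map_of_root (hΦ : IsRootSystem Φ) (hnorm : IsNormalized Φ)
    (hΔ : IsSimpleBasis Φ Δ) (g : V ≃ₗ[ℝ] V)
    (hg : ∀ α ∈ Φ, g α ∈ Φ) (hg' : ∀ α ∈ Φ, g.symm α ∈ Φ) (x y : V) :
    ⟪g x, g y⟫_ℝ = ⟪x, y⟫_ℝ := by
  have h : ∀ i j, ⟪g (Δ i), g (Δ j)⟫_ℝ = ⟪Δ i, Δ j⟫_ℝ := by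
    intro i j
    have h1 := inner_map_map_mul hΦ g hg hg' (hΔ.mem i) (hΔ.mem j)
    rw [norm_map_root hΦ hnorm g hg hg' (hΔ.mem j)] at h1
    have := norm_simple_pos (Δ := Δ) j
    exact mul_right_cancel₀ (by positivity) h1
  rw [← Δ.sum_repr x, ← Δ.sum_repr y]
  simp only [map_sum, map_smul, sum_inner, inner_sum, real_inner_smul_left,
    real_inner_smul_right, h]

/-- An automorphism of the root system, as a linear isometry. -/
theorem exists_isometry_of_mem_rootAut (hΦ : IsRootSystem Φ) (hnorm : IsNormalized Φ)
    (hΔ : IsSimpleBasis Φ Δ) {g : Equiv.Perm V} (hg : g ∈ rootAut Φ) :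
    ∃ f : V ≃ₗᵢ[ℝ] V, (∀ x, f x = g x) ∧ f '' (Φ : Set V) = Φ := by
  obtain ⟨hlin, him⟩ := hg
  let e : V ≃ₗ[ℝ] V := { g with map_add' := hlin.map_add, map_smul' := hlin.map_smul }
  have he : ∀ x, e x = g x := fun x => rfl
  have h1 : ∀ α ∈ Φ, e α ∈ Φ := fun α hα => by
    have : g α ∈ g '' (Φ : Set V) := ⟨α, hα, rfl⟩
    rw [him] at this
    exact this
  have h2 : ∀ α ∈ Φ, e.symm α ∈ Φ := fun α hα => by
    have : α ∈ g '' (Φ : Set V) := by rw [him]; exact hα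
    obtain ⟨β, hβ, rfl⟩ := this
    rw [← he, e.symm_apply_apply]
    exact hβ
  refine ⟨⟨e, fun x => ?_⟩, fun x => rfl, him⟩
  have := inner_map_map_of_root hΦ hnorm hΔ e h1 h2 x x
  rw [real_inner_self_eq_norm_sq, real_inner_self_eq_norm_sq] at this
  rwa [sq_eq_sq₀ (norm_nonneg _) (norm_nonneg _)] at this

/-! ### Automorphisms of the root system preserving the simple roots -/

/-- The positive root `k (Δ i)` has positive inner product with some `Δ j`. If the two differed,
reflecting `Δ j` in `k (Δ i)` would give the image under `k` of a positive root, although one of its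
coordinates away from `j` is negative. -/
theorem map_simple_of_preserves (hΦ : IsRootSystem Φ) (hΔ : IsSimpleBasis Φ Δ)
    (k : V ≃ₗᵢ[ℝ] V) (hk : ∀ β, β ∈ posRoots Φ Δ ↔ k β ∈ posRoots Φ Δ) (i : Fin n) :
    ∃ j, k (Δ i) = Δ j := by
  have hγ := (hk _).1 (mem_posRoots.2 ⟨hΔ.mem i, isPos_basis i⟩)
  rw [mem_posRoots] at hγ
  obtain ⟨j, hj⟩ : ∃ j, 0 < ⟪Δ j, k (Δ i)⟫_ℝ := by
    by_contra! hc
    have h0 : 0 < ⟪k (Δ i), k (Δ i)⟫_ℝ := real_inner_self_pos.2 (hΦ.ne_zero _ hγ.1)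
    rw [inner_eq_sum Δ] at h0
    exact absurd h0 (not_lt.2 (Finset.sum_nonpos fun i _ =>
      mul_nonpos_of_nonneg_of_nonpos (hγ.2 i) (hc i)))
  refine ⟨j, ?_⟩
  by_contra hne
  -- the image of `Δ j` under the reflection is again positive
  have hsymm : k (k.symm (Δ j)) = Δ j := k.apply_symm_apply _
  have h1 : k.symm (Δ j) ∈ posRoots Φ Δ := by
    rw [hk, hsymm]
    exact mem_posRoots.2 ⟨hΔ.mem j, isPos_basis j⟩
  rw [mem_posRoots] at h1
  have h2 : k.symm (Δ j) ≠ Δ i := fun h => hne (by rw [← h, hsymm])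
  have h3 : refl (Δ i) (k.symm (Δ j)) ∈ posRoots Φ Δ :=
    mem_posRoots.2 ⟨hΦ.refl_mem _ (hΔ.mem i) _ h1.1, isPos_refl_simple hΦ hΔ h1.1 h1.2 h2⟩
  rw [hk, map_refl, hsymm, mem_posRoots] at h3
  obtain ⟨m, hm, hm'⟩ := hγ.2.exists_ne hΦ hΔ hγ.1 hne
  have h4 := h3.2 m
  have h5 : 0 < ‖k (Δ i)‖ := norm_pos_iff.2 (hΦ.ne_zero _ hγ.1)
  rw [refl_apply] at h4
  simp only [map_sub, map_smul, Finsupp.sub_apply, Finsupp.smul_apply, Module.Basis.repr_self,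
    Finsupp.single_apply, hm.symm, if_false, smul_eq_mul, zero_sub] at h4
  have : 0 < 2 * ⟪Δ j, k (Δ i)⟫_ℝ / ‖k (Δ i)‖ ^ 2 * Δ.repr (k (Δ i)) m := by positivity
  linarith

/-- Up to the Coxeter group, an isometry preserving the roots permutes the simple roots. -/
theorem exists_perm_of_image_eq (hΦ : IsRootSystem Φ) (hΔ : IsSimpleBasis Φ Δ)
    (f : V ≃ₗᵢ[ℝ] V) (hf : f '' (Φ : Set V) = Φ) :
    ∃ σ ∈ coxeterGroup Φ, ∃ π : Equiv.Perm (Fin n), ∀ i, σ (f (Δ i)) = Δ (π i) := by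
  obtain ⟨σ, hσ, hdom⟩ := exists_dominant hΦ hΔ (f (delta Φ Δ))
  set k : V ≃ₗᵢ[ℝ] V := σ * f with hk
  have hkapp : ∀ x, k x = σ (f x) := fun x => rfl
  have hkΦ : ∀ β, β ∈ Φ ↔ k β ∈ Φ := by
    intro β
    constructor
    · intro h
      refine map_mem_of_mem_coxeterGroup hΦ hσ _ ?_
      have : f β ∈ f '' (Φ : Set V) := ⟨β, h, rfl⟩
      rwa [hf] at this
    · intro h
      have h1 := map_mem_of_mem_coxeterGroup hΦ (inv_mem hσ) _ h
      simp only [LinearIsometryEquiv.coe_inv, hkapp, LinearIsometryEquiv.symm_apply_apply] at h1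
      have h2 : f β ∈ f '' (Φ : Set V) := by rw [hf]; exact h1
      obtain ⟨γ, hγ, h3⟩ := h2
      rwa [← f.injective h3]
  -- A root is positive exactly when it pairs positively with `δ`, and `k` carries this pairing to
  -- the one with the dominant vector `k δ`.
  have hpos : ∀ β ∈ Φ, IsPos Δ (k β) → IsPos Δ β := by
    intro β hβ h
    have h1 : 0 ≤ ⟪k β, k (delta Φ Δ)⟫_ℝ := h.inner_nonneg hdom
    rw [LinearIsometryEquiv.inner_map_map] at h1
    rcases hΔ.isPos_or_neg hβ with h2 | h2
    · exact h2
    · have h3 := h2.inner_pos (regular_delta hΦ hΔ) (neg_ne_zero.2 (hΦ.ne_zero β hβ))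
      rw [inner_neg_left] at h3
      linarith
  have hpos' : ∀ β, β ∈ posRoots Φ Δ ↔ k β ∈ posRoots Φ Δ := by
    intro β
    rw [mem_posRoots, mem_posRoots]
    constructor
    · rintro ⟨h1, h2⟩
      refine ⟨(hkΦ β).1 h1, ?_⟩
      rcases hΔ.isPos_or_neg ((hkΦ β).1 h1) with h3 | h3
      · exact h3
      · rw [← map_neg] at h3
        have h4 := hpos _ (hΦ.neg_mem h1) h3
        have h5 := h2.inner_pos (regular_delta hΦ hΔ) (hΦ.ne_zero β h1)
        have h6 := h4.inner_pos (regular_delta hΦ hΔ) (neg_ne_zero.2 (hΦ.ne_zero β h1))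
        rw [inner_neg_left] at h6
        linarith
    · rintro ⟨h1, h2⟩
      exact ⟨(hkΦ β).2 h1, hpos β ((hkΦ β).2 h1) h2⟩
  choose π hπ using map_simple_of_preserves hΦ hΔ k hpos'
  have hinj : Function.Injective π := by
    intro i j h
    apply Δ.injective
    apply k.injective
    rw [hπ, hπ, h]
  exact ⟨σ, hσ, Equiv.ofBijective π (Finite.injective_iff_bijective.1 hinj), hπ⟩

/-- An isometry permuting the simple roots preserves the roots. -/
theorem image_eq_of_perm (hΦ : IsRootSystem Φ) (hΔ : IsSimpleBasis Φ Δ)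
    (g : V ≃ₗᵢ[ℝ] V) (π : Fin n → Fin n) (hg : ∀ i, g (Δ i) = Δ (π i)) :
    g '' (Φ : Set V) = Φ := by
  have hword : ∀ (l : List (Fin n)) x, g (wordProd Δ l x) = wordProd Δ (l.map π) (g x) := by
    intro l
    induction l with
    | nil => intro x; simp [wordProd]
    | cons i l ih =>
      intro x
      rw [List.map_cons, wordProd_cons, wordProd_cons]
      simp only [LinearIsometryEquiv.coe_mul, Function.comp_apply, map_refl, ih, hg]
  have hsub : ∀ β ∈ Φ, g β ∈ Φ := by
    intro β hβ
    obtain ⟨l, i, rfl⟩ := exists_simple hΦ hΔ hβ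
    rw [hword, hg]
    exact map_mem_of_mem_coxeterGroup hΦ (wordProd_mem hΔ _) _ (hΔ.mem _)
  apply subset_antisymm
  · rintro _ ⟨β, hβ, rfl⟩
    exact hsub β hβ
  · intro β hβ
    obtain ⟨γ, hγ, h⟩ := Finset.surj_on_of_inj_on_of_card_le (s := Φ) (t := Φ)
      (fun a _ => g a) hsub (fun a b _ _ h => g.injective h) le_rfl β hβ
    exact ⟨γ, hγ, h.symm⟩

/-- The vector `δ` is determined by its pairings `‖Δ i‖ ^ 2 / 2`, which an isometry permuting the
simple roots respects. -/
theorem map_delta_of_perm (hΦ : IsRootSystem Φ) (hΔ : IsSimpleBasis Φ Δ)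
    (g : V ≃ₗᵢ[ℝ] V) (π : Equiv.Perm (Fin n)) (hg : ∀ i, g (Δ i) = Δ (π i)) :
    g (delta Φ Δ) = delta Φ Δ := by
  apply eq_of_inner_simple Δ
  intro i
  obtain ⟨j, rfl⟩ := π.surjective i
  rw [← hg, LinearIsometryEquiv.inner_map_map, inner_delta_simple hΦ hΔ, hg,
    inner_delta_simple hΦ hΔ, ← hg, LinearIsometryEquiv.norm_map]

end Automorphisms

/-! ### Spans of simple roots, the projections of `δ`, and building sets. -/

section FundamentalSubspaces

set_option linter.unusedSectionVars false

variable {V : Type*} [NormedAddCommGroup V] [InnerProductSpace ℝ V]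
variable {n : ℕ} {Φ : Finset V} {Δ : Module.Basis (Fin n) ℝ V} {𝒢 : Set (Submodule ℝ V)}

/-! ### Subspaces spanned by simple roots -/

/-- The subspace spanned by the simple roots with index in `J`. -/
def simpleSpan (Δ : Module.Basis (Fin n) ℝ V) (J : Finset (Fin n)) : Submodule ℝ V :=
  Submodule.span ℝ (Δ '' (J : Set (Fin n)))

theorem mem_simpleSpan {J : Finset (Fin n)} {v : V} :
    v ∈ simpleSpan Δ J ↔ ∀ i, i ∉ J → Δ.repr v i = 0 := by
  rw [simpleSpan, Module.Basis.mem_span_image]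
  constructor
  · intro h i hi
    by_contra hne
    exact hi (by simpa using h (Finsupp.mem_support_iff.2 hne))
  · intro h i hi
    by_contra hne
    exact (Finsupp.mem_support_iff.1 hi) (h i (by simpa using hne))

theorem simple_mem_simpleSpan {J : Finset (Fin n)} {i : Fin n} :
    Δ i ∈ simpleSpan Δ J ↔ i ∈ J := by
  rw [mem_simpleSpan]
  constructor
  · intro h
    by_contra hi
    simpa using h i hi
  · intro h k hk
    have : i ≠ k := fun e => hk (e ▸ h)
    simp [this]

theorem simpleSpan_le_iff {J K : Finset (Fin n)} : simpleSpan Δ J ≤ simpleSpan Δ K ↔ J ⊆ K := by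
  constructor
  · intro h i hi
    exact simple_mem_simpleSpan.1 (h (simple_mem_simpleSpan.2 hi))
  · intro h
    exact Submodule.span_mono (Set.image_mono (by exact_mod_cast h))

theorem simpleSpan_injective : Function.Injective (simpleSpan Δ) := fun _ _ h =>
  subset_antisymm (simpleSpan_le_iff.1 h.le) (simpleSpan_le_iff.1 h.ge)

theorem simpleSpan_lt_iff {J K : Finset (Fin n)} : simpleSpan Δ J < simpleSpan Δ K ↔ J ⊂ K := by
  rw [lt_iff_le_not_ge, simpleSpan_le_iff, simpleSpan_le_iff]; rfl

theorem simpleSpan_univ : simpleSpan Δ Finset.univ = ⊤ := by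
  simp [simpleSpan, Δ.span_eq]

theorem simpleSpan_singleton (i : Fin n) : simpleSpan Δ {i} = Submodule.span ℝ {Δ i} := by
  simp [simpleSpan]

theorem simpleSpan_union (J K : Finset (Fin n)) :
    simpleSpan Δ (J ∪ K) = simpleSpan Δ J ⊔ simpleSpan Δ K := by
  simp [simpleSpan, Set.image_union, Submodule.span_union]

theorem finrank_simpleSpan (J : Finset (Fin n)) :
    Module.finrank ℝ (simpleSpan Δ J) = J.card := by
  have h : LinearIndependent ℝ (fun i : J => Δ i) :=
    Δ.linearIndependent.comp _ Subtype.val_injective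
  have h1 := finrank_span_eq_card h
  have h2 : Set.range (fun i : J => Δ i) = Δ '' (J : Set (Fin n)) := by
    ext x; simp
  rw [h2, Fintype.card_coe] at h1
  exact h1

theorem mem_fundSubspaces {U : Submodule ℝ V} :
    U ∈ fundSubspaces Δ ↔ ∃ J : Finset (Fin n), J.Nonempty ∧ U = simpleSpan Δ J := by
  classical
  constructor
  · rintro ⟨I, hI, rfl⟩
    exact ⟨I.toFinset, by simpa using hI, by simp [simpleSpan]⟩
  · rintro ⟨J, hJ, rfl⟩
    exact ⟨J, by simpa using hJ, rfl⟩

theorem simpleSpan_mem_rootSubspaces (hΔ : IsSimpleBasis Φ Δ) {J : Finset (Fin n)}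
    (hJ : J.Nonempty) : simpleSpan Δ J ∈ rootSubspaces Φ := by
  refine ⟨Δ '' (J : Set (Fin n)), ?_, ?_, rfl⟩
  · rintro _ ⟨i, -, rfl⟩
    exact hΔ.mem i
  · obtain ⟨i, hi⟩ := hJ
    exact ⟨Δ i, i, hi, rfl⟩

/-! ### Coefficients of the projections of `δ` -/

/-- A vector of an obtuse cone dual has nonnegative coefficients. -/
theorem repr_nonneg_of_inner_nonneg (hΦ : IsRootSystem Φ) (hΔ : IsSimpleBasis Φ Δ)
    {J : Finset (Fin n)} {v : V} (hv : v ∈ simpleSpan Δ J) (h : ∀ j ∈ J, 0 ≤ ⟪v, Δ j⟫_ℝ)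
    (k : Fin n) : 0 ≤ Δ.repr v k := by
  -- Here `m` is the negative part of `v`. Then `⟪v, m⟫ ≥ 0` by hypothesis, while `⟪v + m, m⟫ ≤ 0`
  -- because positive and negative part have disjoint supports and the simple roots form obtuse
  -- angles. Hence `‖m‖ ^ 2 ≤ 0`.
  set m : V := ∑ i, max (-Δ.repr v i) 0 • Δ i with hm
  have hvm : v + m = ∑ i, max (Δ.repr v i) 0 • Δ i := by
    calc v + m = ∑ i, Δ.repr v i • Δ i + m := by rw [Δ.sum_repr]
      _ = _ := by
        rw [hm, ← Finset.sum_add_distrib]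
        refine Finset.sum_congr rfl fun i _ => ?_
        rw [← add_smul]
        congr 1
        rcases le_total 0 (Δ.repr v i) with h0 | h0
        · rw [max_eq_left h0, max_eq_right (by linarith)]; ring
        · rw [max_eq_right h0, max_eq_left (by linarith)]; ring
  have h1 : 0 ≤ ⟪v, m⟫_ℝ := by
    rw [hm, inner_sum]
    refine Finset.sum_nonneg fun i _ => ?_
    rw [real_inner_smul_right]
    by_cases hi : i ∈ J
    · exact mul_nonneg (le_max_right _ _) (h i hi)
    · rw [mem_simpleSpan.1 hv i hi]; simp
  have h2 : ⟪v + m, m⟫_ℝ ≤ 0 := by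
    rw [hvm, hm, sum_inner]
    refine Finset.sum_nonpos fun i _ => ?_
    rw [inner_sum]
    refine Finset.sum_nonpos fun j _ => ?_
    rw [real_inner_smul_left, real_inner_smul_right]
    by_cases hij : i = j
    · subst hij
      rcases le_total 0 (Δ.repr v i) with h0 | h0
      · rw [max_eq_right (a := -Δ.repr v i) (by linarith)]; simp
      · rw [max_eq_right h0]; simp
    · exact mul_nonpos_of_nonneg_of_nonpos (le_max_right _ _)
        (mul_nonpos_of_nonneg_of_nonpos (le_max_right _ _) (hΔ.inner_nonpos hΦ hij))
  rw [inner_add_left] at h2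
  have h3 : m = 0 := by
    have h4 : 0 ≤ ⟪m, m⟫_ℝ := real_inner_self_nonneg
    exact (inner_self_eq_zero (𝕜 := ℝ)).1 (by linarith)
  have h5 : Δ.repr m k = max (-Δ.repr v k) 0 := by
    rw [hm]
    simp [Finsupp.single_apply]
  rw [h3] at h5
  have := le_max_left (-Δ.repr v k) 0
  rw [← h5] at this
  simpa using this

theorem repr_pos_of_inner_pos (hΦ : IsRootSystem Φ) (hΔ : IsSimpleBasis Φ Δ)
    {J : Finset (Fin n)} {v : V} (hv : v ∈ simpleSpan Δ J) (h : ∀ j ∈ J, 0 < ⟪v, Δ j⟫_ℝ)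
    {k : Fin n} (hk : k ∈ J) : 0 < Δ.repr v k := by
  have h0 := repr_nonneg_of_inner_nonneg hΦ hΔ hv fun j hj => (h j hj).le
  refine lt_of_le_of_ne (h0 k) fun he => ?_
  have h1 := h k hk
  rw [inner_eq_sum Δ] at h1
  refine absurd h1 (not_lt.2 (Finset.sum_nonpos fun i _ => ?_))
  by_cases hik : i = k
  · subst hik; rw [← he, zero_mul]
  · exact mul_nonpos_of_nonneg_of_nonpos (h0 i) (hΔ.inner_nonpos hΦ hik)

theorem eq_of_mem_simpleSpan {J : Finset (Fin n)} {v w : V} (hv : v ∈ simpleSpan Δ J)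
    (hw : w ∈ simpleSpan Δ J) (h : ∀ j ∈ J, ⟪v, Δ j⟫_ℝ = ⟪w, Δ j⟫_ℝ) : v = w := by
  rw [← sub_eq_zero]
  have h1 : ⟪v - w, v - w⟫_ℝ = 0 := by
    rw [inner_eq_sum Δ]
    refine Finset.sum_eq_zero fun i _ => ?_
    by_cases hi : i ∈ J
    · rw [real_inner_comm, inner_sub_left, h i hi, sub_self, mul_zero]
    · rw [mem_simpleSpan.1 (sub_mem hv hw) i hi, zero_mul]
  exact inner_self_eq_zero.1 h1

variable [FiniteDimensional ℝ V]

/-- The projection of `δ` to the span of the simple roots with index in `J`. -/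
noncomputable def simplePi (Φ : Finset V) (Δ : Module.Basis (Fin n) ℝ V) (J : Finset (Fin n)) : V :=
  piVec Φ Δ (simpleSpan Δ J)

theorem simplePi_mem (J : Finset (Fin n)) : simplePi Φ Δ J ∈ simpleSpan Δ J :=
  Submodule.starProjection_apply_mem _ _

theorem inner_simplePi (hΦ : IsRootSystem Φ) (hΔ : IsSimpleBasis Φ Δ) {J : Finset (Fin n)}
    {j : Fin n} (hj : j ∈ J) : ⟪simplePi Φ Δ J, Δ j⟫_ℝ = ‖Δ j‖ ^ 2 / 2 := by
  have h := Submodule.starProjection_inner_eq_zero (K := simpleSpan Δ J) (delta Φ Δ) (Δ j)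
    (simple_mem_simpleSpan.2 hj)
  rw [inner_sub_left, inner_delta_simple hΦ hΔ, sub_eq_zero] at h
  exact h.symm

theorem eq_simplePi (hΦ : IsRootSystem Φ) (hΔ : IsSimpleBasis Φ Δ) {J : Finset (Fin n)} {v : V}
    (hv : v ∈ simpleSpan Δ J) (h : ∀ j ∈ J, ⟪v, Δ j⟫_ℝ = ‖Δ j‖ ^ 2 / 2) :
    v = simplePi Φ Δ J :=
  eq_of_mem_simpleSpan hv (simplePi_mem J) fun j hj => by rw [h j hj, inner_simplePi hΦ hΔ hj]

/-- The coefficients of the projection of `δ`. -/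
noncomputable def coef (Φ : Finset V) (Δ : Module.Basis (Fin n) ℝ V) (J : Finset (Fin n))
    (k : Fin n) : ℝ := Δ.repr (simplePi Φ Δ J) k

theorem coef_eq_zero {J : Finset (Fin n)} {k : Fin n} (hk : k ∉ J) : coef Φ Δ J k = 0 :=
  mem_simpleSpan.1 (simplePi_mem J) k hk

theorem coef_pos (hΦ : IsRootSystem Φ) (hΔ : IsSimpleBasis Φ Δ) {J : Finset (Fin n)} {k : Fin n}
    (hk : k ∈ J) : 0 < coef Φ Δ J k :=
  repr_pos_of_inner_pos hΦ hΔ (simplePi_mem J) (fun j hj => by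
    rw [inner_simplePi hΦ hΔ hj]
    have := norm_simple_pos (Δ := Δ) j
    positivity) hk

theorem coef_nonneg (hΦ : IsRootSystem Φ) (hΔ : IsSimpleBasis Φ Δ) (J : Finset (Fin n))
    (k : Fin n) : 0 ≤ coef Φ Δ J k := by
  by_cases hk : k ∈ J
  · exact (coef_pos hΦ hΔ hk).le
  · rw [coef_eq_zero hk]

theorem simplePi_eq_sum (J : Finset (Fin n)) :
    simplePi Φ Δ J = ∑ k ∈ J, coef Φ Δ J k • Δ k := by
  refine (Δ.sum_repr (simplePi Φ Δ J)).symm.trans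
    (Finset.sum_subset (Finset.subset_univ J) fun k _ hk => ?_).symm
  rw [← coef, coef_eq_zero hk, zero_smul]

theorem simplePi_empty : simplePi Φ Δ ∅ = 0 := by simp [simplePi_eq_sum]

theorem simplePi_univ : simplePi Φ Δ Finset.univ = delta Φ Δ :=
  Submodule.starProjection_eq_self_iff.2 (by rw [simpleSpan_univ]; exact Submodule.mem_top)

theorem simplePi_singleton (hΦ : IsRootSystem Φ) (hΔ : IsSimpleBasis Φ Δ) (i : Fin n) :
    simplePi Φ Δ {i} = (1 / 2 : ℝ) • Δ i := by
  refine (eq_simplePi hΦ hΔ (Submodule.smul_mem _ _ (simple_mem_simpleSpan.2 (by simp))) ?_).symm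
  intro j hj
  rw [Finset.mem_singleton] at hj
  subst hj
  rw [real_inner_smul_left, real_inner_self_eq_norm_sq]
  ring

theorem coef_singleton (hΦ : IsRootSystem Φ) (hΔ : IsSimpleBasis Φ Δ) (i : Fin n) :
    coef Φ Δ {i} i = 1 / 2 := by
  rw [coef, simplePi_singleton hΦ hΔ]; simp

theorem inner_simplePi_eq_sum (J : Finset (Fin n)) (u : V) :
    ⟪u, simplePi Φ Δ J⟫_ℝ = ∑ k ∈ J, coef Φ Δ J k * ⟪u, Δ k⟫_ℝ := by
  rw [simplePi_eq_sum, inner_sum]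
  simp [real_inner_smul_right]

theorem simplePi_add_of_orthogonal (hΦ : IsRootSystem Φ) (hΔ : IsSimpleBasis Φ Δ)
    {s : Finset (Finset (Fin n))}
    (h : ∀ K ∈ s, ∀ L ∈ s, K ≠ L → ∀ k ∈ K, ∀ l ∈ L, ⟪Δ k, Δ l⟫_ℝ = 0)
    {J : Finset (Fin n)} (hs : ∀ K ∈ s, K ⊆ J) (hJ : ∀ j ∈ J, ∃ K ∈ s, j ∈ K) :
    ∑ K ∈ s, simplePi Φ Δ K = simplePi Φ Δ J := by
  refine eq_simplePi hΦ hΔ (Submodule.sum_mem _ fun K hK =>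
    simpleSpan_le_iff.2 (hs K hK) (simplePi_mem K)) ?_
  intro j hj
  obtain ⟨K, hK, hjK⟩ := hJ j hj
  rw [sum_inner, Finset.sum_eq_single_of_mem K hK, inner_simplePi hΦ hΔ hjK]
  intro L hL hLK
  rw [simplePi_eq_sum, sum_inner]
  refine Finset.sum_eq_zero fun l hl => ?_
  rw [real_inner_smul_left, h L hL K hK hLK l hl j hjK, mul_zero]

/-- If the simple roots in `A \ B` are orthogonal to those in `B`, then the coefficients for `A` and
`B` agree on `B`. -/
theorem coef_eq_of_orthogonal (hΦ : IsRootSystem Φ) (hΔ : IsSimpleBasis Φ Δ)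
    {A B : Finset (Fin n)} (hBA : B ⊆ A)
    (h : ∀ i ∈ B, ∀ j ∈ A, j ∉ B → ⟪Δ i, Δ j⟫_ℝ = 0) {k : Fin n} (hk : k ∈ B) :
    coef Φ Δ A k = coef Φ Δ B k := by
  classical
  have h1 : simplePi Φ Δ B + simplePi Φ Δ (A \ B) = simplePi Φ Δ A := by
    refine eq_simplePi hΦ hΔ (add_mem (simpleSpan_le_iff.2 hBA (simplePi_mem B))
      (simpleSpan_le_iff.2 Finset.sdiff_subset (simplePi_mem _))) fun j hj => ?_
    rw [inner_add_left]
    by_cases hjB : j ∈ B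
    · rw [inner_simplePi hΦ hΔ hjB, add_eq_left, simplePi_eq_sum, sum_inner]
      refine Finset.sum_eq_zero fun l hl => ?_
      rw [Finset.mem_sdiff] at hl
      rw [real_inner_smul_left, real_inner_comm, h j hjB l hl.1 hl.2, mul_zero]
    · rw [inner_simplePi hΦ hΔ (Finset.mem_sdiff.2 ⟨hj, hjB⟩), add_eq_right, simplePi_eq_sum,
        sum_inner]
      refine Finset.sum_eq_zero fun l hl => ?_
      rw [real_inner_smul_left, h l hl j hj hjB, mul_zero]
  rw [coef, ← h1, map_add, Finsupp.add_apply]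
  rw [← coef, ← coef, coef_eq_zero (J := A \ B) (by simp [hk]), add_zero]

/-! ### Building sets -/

/-- The subspace spanned by the simple roots with index in `J` is a member of `𝒢_fund`. -/
def InFund (Δ : Module.Basis (Fin n) ℝ V) (𝒢 : Set (Submodule ℝ V)) (J : Finset (Fin n)) : Prop :=
  J.Nonempty ∧ simpleSpan Δ J ∈ 𝒢

theorem mem_fund {U : Submodule ℝ V} :
    U ∈ fund Δ 𝒢 ↔ ∃ J, InFund Δ 𝒢 J ∧ U = simpleSpan Δ J := by
  rw [fund, Set.mem_inter_iff, mem_fundSubspaces]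
  constructor
  · rintro ⟨h, J, hJ, rfl⟩
    exact ⟨J, ⟨hJ, h⟩, rfl⟩
  · rintro ⟨J, hJ, rfl⟩
    exact ⟨hJ.2, J, hJ.1, rfl⟩

theorem simpleSpan_mem_fund {J : Finset (Fin n)} :
    simpleSpan Δ J ∈ fund Δ 𝒢 ↔ InFund Δ 𝒢 J := by
  rw [mem_fund]
  constructor
  · rintro ⟨K, hK, h⟩
    rwa [simpleSpan_injective h]
  · exact fun h => ⟨J, h, rfl⟩

theorem exists_le_mem_maxIn {U C : Submodule ℝ V} (hU : U ∈ 𝒢) (h : U ≤ C) :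
    ∃ M ∈ maxIn 𝒢 C, U ≤ M := by
  obtain ⟨M, hM, hmax⟩ := exists_maximal_ge_of_wellFoundedGT (fun X => X ∈ 𝒢 ∧ X ≤ C) U ⟨hU, h⟩
  exact ⟨M, hmax, hM⟩

theorem eq_of_mem_maxIn (h𝒢 : IsBuildingSet Φ 𝒢) {C M N : Submodule ℝ V}
    (hC : C ∈ rootSubspaces Φ) (hM : M ∈ maxIn 𝒢 C) (hN : N ∈ maxIn 𝒢 C) {x : V} (hx : x ≠ 0)
    (hxM : x ∈ M) (hxN : x ∈ N) : M = N := by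
  by_contra hne
  have h := (h𝒢.indep C hC).pairwiseDisjoint hM hN hne
  exact hx (Submodule.disjoint_def.1 h x hxM hxN)

/-- The maximal members of `X ⊔ Y` containing `X` and `Y` share a nonzero vector, so they coincide
by independence. That one member is then the whole sum. -/
theorem sup_mem_of_mem (h𝒢 : IsBuildingSet Φ 𝒢) {X Y : Submodule ℝ V} (hX : X ∈ 𝒢) (hY : Y ∈ 𝒢)
    (hC : X ⊔ Y ∈ rootSubspaces Φ) {x : V} (hx : x ≠ 0) (hxX : x ∈ X) (hxY : x ∈ Y) :
    X ⊔ Y ∈ 𝒢 := by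
  obtain ⟨M, hM, hXM⟩ := exists_le_mem_maxIn hX (le_sup_left (b := Y))
  obtain ⟨N, hN, hYN⟩ := exists_le_mem_maxIn hY (le_sup_right (a := X))
  have h := eq_of_mem_maxIn h𝒢 hC hM hN hx (hXM hxX) (hYN hxY)
  subst h
  have h1 : X ⊔ Y = M := le_antisymm (sup_le hXM hYN) hM.1.2
  rw [h1]
  exact hM.1.1

theorem inFund_singleton (hΔ : IsSimpleBasis Φ Δ) (h𝒢 : IsBuildingSet Φ 𝒢) (i : Fin n) :
    InFund Δ 𝒢 {i} :=
  ⟨Finset.singleton_nonempty i, by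
    rw [simpleSpan_singleton]; exact h𝒢.line_mem _ (hΔ.mem i)⟩

theorem InFund.union (hΔ : IsSimpleBasis Φ Δ) (h𝒢 : IsBuildingSet Φ 𝒢) {J K : Finset (Fin n)}
    (hJ : InFund Δ 𝒢 J) (hK : InFund Δ 𝒢 K) {i : Fin n} (hiJ : i ∈ J) (hiK : i ∈ K) :
    InFund Δ 𝒢 (J ∪ K) := by
  refine ⟨⟨i, Finset.mem_union_left _ hiJ⟩, ?_⟩
  have h1 : simpleSpan Δ (J ∪ K) ∈ rootSubspaces Φ :=
    simpleSpan_mem_rootSubspaces hΔ ⟨i, Finset.mem_union_left _ hiJ⟩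
  rw [simpleSpan_union] at h1 ⊢
  exact sup_mem_of_mem h𝒢 hJ.2 hK.2 h1 (Δ.ne_zero i) (simple_mem_simpleSpan.2 hiJ)
    (simple_mem_simpleSpan.2 hiK)

/-- The plane `C` contains a third root `refl (Δ i) (Δ j)`, which is a combination of the other two
with nonzero coefficients. Were the three roots in three distinct maximal members, independence
would fail. So two of them share a member, and that member is all of `C`. -/
theorem inFund_pair (hΦ : IsRootSystem Φ) (hΔ : IsSimpleBasis Φ Δ) (h𝒢 : IsBuildingSet Φ 𝒢)
    {i j : Fin n} (hij : ⟪Δ i, Δ j⟫_ℝ ≠ 0) : InFund Δ 𝒢 {i, j} := by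
  set C := simpleSpan Δ {i, j} with hC
  have hi : Δ i ∈ C := simple_mem_simpleSpan.2 (by simp)
  have hj : Δ j ∈ C := simple_mem_simpleSpan.2 (by simp)
  have hCr : C ∈ rootSubspaces Φ := simpleSpan_mem_rootSubspaces hΔ (by simp)
  obtain ⟨c, hc0, hc⟩ : ∃ c : ℝ, c ≠ 0 ∧ refl (Δ i) (Δ j) = Δ j - c • Δ i := by
    refine ⟨_, ?_, refl_apply _ _⟩
    have := norm_simple_pos (Δ := Δ) i
    rw [real_inner_comm]
    positivity
  set s := refl (Δ i) (Δ j) with hs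
  have hsΦ : s ∈ Φ := hΦ.refl_mem _ (hΔ.mem i) _ (hΔ.mem j)
  have hsC : s ∈ C := hc ▸ sub_mem hj (Submodule.smul_mem _ _ hi)
  have key : ∀ x ∈ Φ, x ∈ C → ∃ M ∈ maxIn 𝒢 C, x ∈ M := by
    intro x hx hxC
    obtain ⟨M, hM, hxM⟩ := exists_le_mem_maxIn (h𝒢.line_mem x hx)
      ((Submodule.span_singleton_le_iff_mem x C).2 hxC)
    exact ⟨M, hM, hxM (Submodule.mem_span_singleton_self x)⟩
  have fin : ∀ M ∈ maxIn 𝒢 C, Δ i ∈ M → Δ j ∈ M → InFund Δ 𝒢 {i, j} := by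
    intro M hM h1 h2
    have : C = M := by
      refine le_antisymm ?_ hM.1.2
      rw [hC, simpleSpan, Submodule.span_le]
      rintro _ ⟨k, hk, rfl⟩
      simp only [Finset.coe_insert, Finset.coe_singleton, Set.mem_insert_iff,
        Set.mem_singleton_iff] at hk
      rcases hk with rfl | rfl
      · exact h1
      · exact h2
    exact ⟨by simp, by rw [← hC, this]; exact hM.1.1⟩
  obtain ⟨M₁, hM₁, h₁⟩ := key _ (hΔ.mem i) hi
  obtain ⟨M₂, hM₂, h₂⟩ := key _ (hΔ.mem j) hj
  obtain ⟨M₃, hM₃, h₃⟩ := key _ hsΦ hsC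
  by_cases h12 : M₁ = M₂
  · subst h12; exact fin _ hM₁ h₁ h₂
  by_cases h13 : M₁ = M₃
  · subst h13
    refine fin _ hM₁ h₁ ?_
    have : Δ j = s + c • Δ i := by rw [hc]; abel
    rw [this]
    exact add_mem h₃ (Submodule.smul_mem _ _ h₁)
  by_cases h23 : M₂ = M₃
  · subst h23
    refine fin _ hM₂ ?_ h₂
    have : Δ i = c⁻¹ • (Δ j - s) := by rw [hc]; simp [smul_smul, hc0]
    rw [this]
    exact Submodule.smul_mem _ _ (sub_mem h₂ h₃)
  · exfalso
    have h := h𝒢.indep C hCr hM₃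
    have h4 : M₁ ≤ sSup (maxIn 𝒢 C \ {M₃}) := le_sSup ⟨hM₁, h13⟩
    have h5 : M₂ ≤ sSup (maxIn 𝒢 C \ {M₃}) := le_sSup ⟨hM₂, h23⟩
    refine hΦ.ne_zero s hsΦ (Submodule.disjoint_def.1 h s h₃ ?_)
    rw [hc]
    exact sub_mem (h5 h₂) (Submodule.smul_mem _ _ (h4 h₁))

theorem InFund.insert (hΦ : IsRootSystem Φ) (hΔ : IsSimpleBasis Φ Δ) (h𝒢 : IsBuildingSet Φ 𝒢)
    {B : Finset (Fin n)} (hB : InFund Δ 𝒢 B) {i j : Fin n} (hi : i ∈ B)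
    (hij : ⟪Δ i, Δ j⟫_ℝ ≠ 0) : InFund Δ 𝒢 (insert j B) := by
  have h := hB.union hΔ h𝒢 (inFund_pair hΦ hΔ h𝒢 hij) hi (by simp)
  convert h using 1
  ext k
  simp only [Finset.mem_insert, Finset.mem_union, Finset.mem_singleton]
  constructor
  · rintro (h | h) <;> simp [h]
  · rintro (h | rfl | h)
    · exact Or.inr h
    · exact Or.inr hi
    · exact Or.inl h

open Classical in
/-- The maximal members of `𝒢_fund` contained in `J`. -/
noncomputable def maxSub (Δ : Module.Basis (Fin n) ℝ V) (𝒢 : Set (Submodule ℝ V))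
    (J : Finset (Fin n)) : Finset (Finset (Fin n)) :=
  Finset.univ.filter fun K => Maximal (fun L => InFund Δ 𝒢 L ∧ L ⊆ J) K

theorem mem_maxSub {J K : Finset (Fin n)} :
    K ∈ maxSub Δ 𝒢 J ↔ Maximal (fun L => InFund Δ 𝒢 L ∧ L ⊆ J) K := by
  simp [maxSub]

theorem exists_mem_maxSub {J L : Finset (Fin n)} (hL : InFund Δ 𝒢 L) (h : L ⊆ J) :
    ∃ K ∈ maxSub Δ 𝒢 J, L ⊆ K := by
  obtain ⟨K, hK, hmax⟩ := exists_maximal_ge_of_wellFoundedGT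
    (fun L => InFund Δ 𝒢 L ∧ L ⊆ J) L ⟨hL, h⟩
  exact ⟨K, mem_maxSub.2 hmax, hK⟩

theorem exists_mem_maxSub_mem (hΔ : IsSimpleBasis Φ Δ) (h𝒢 : IsBuildingSet Φ 𝒢)
    {J : Finset (Fin n)} {j : Fin n} (hj : j ∈ J) : ∃ K ∈ maxSub Δ 𝒢 J, j ∈ K := by
  obtain ⟨K, hK, h⟩ := exists_mem_maxSub (inFund_singleton hΔ h𝒢 j) (J := J) (by simpa using hj)
  exact ⟨K, hK, by simpa using h⟩

theorem eq_of_mem_maxSub (hΔ : IsSimpleBasis Φ Δ) (h𝒢 : IsBuildingSet Φ 𝒢)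
    {J K L : Finset (Fin n)} (hK : K ∈ maxSub Δ 𝒢 J) (hL : L ∈ maxSub Δ 𝒢 J) {i : Fin n}
    (hiK : i ∈ K) (hiL : i ∈ L) : K = L := by
  rw [mem_maxSub] at hK hL
  have h : InFund Δ 𝒢 (K ∪ L) ∧ K ∪ L ⊆ J :=
    ⟨hK.1.1.union hΔ h𝒢 hL.1.1 hiK hiL, Finset.union_subset hK.1.2 hL.1.2⟩
  have h1 := hK.eq_of_le h Finset.subset_union_left
  have h2 := hL.eq_of_le h Finset.subset_union_right
  exact h1.trans h2.symm

/-- Two nonorthogonal simple roots in different maximal members would allow one of these members to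
be enlarged. -/
theorem inner_eq_zero_of_mem_maxSub (hΦ : IsRootSystem Φ) (hΔ : IsSimpleBasis Φ Δ)
    (h𝒢 : IsBuildingSet Φ 𝒢) {J K L : Finset (Fin n)} (hK : K ∈ maxSub Δ 𝒢 J)
    (hL : L ∈ maxSub Δ 𝒢 J) (hKL : K ≠ L) {k l : Fin n} (hk : k ∈ K) (hl : l ∈ L) :
    ⟪Δ k, Δ l⟫_ℝ = 0 := by
  by_contra hne
  have hK' := mem_maxSub.1 hK
  have hL' := mem_maxSub.1 hL
  have h1 : InFund Δ 𝒢 (insert l K) := hK'.1.1.insert hΦ hΔ h𝒢 hk hne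
  have h2 := hK'.eq_of_le ⟨h1, Finset.insert_subset (hL'.1.2 hl) hK'.1.2⟩
    (Finset.subset_insert l K)
  refine hKL (eq_of_mem_maxSub hΔ h𝒢 hK hL ?_ hl)
  rw [h2]
  exact Finset.mem_insert_self l K

/-- This gives the half-spaces of `𝒢_fund` and those of sums a common form, with normal `δ - π_J`.
-/
theorem sum_simplePi_maxSub (hΦ : IsRootSystem Φ) (hΔ : IsSimpleBasis Φ Δ)
    (h𝒢 : IsBuildingSet Φ 𝒢) (J : Finset (Fin n)) :
    ∑ K ∈ maxSub Δ 𝒢 J, simplePi Φ Δ K = simplePi Φ Δ J :=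
  simplePi_add_of_orthogonal hΦ hΔ
    (fun _ hK _ hL hKL _ hk _ hl => inner_eq_zero_of_mem_maxSub hΦ hΔ h𝒢 hK hL hKL hk hl)
    (fun _ hK => (mem_maxSub.1 hK).1.2) (fun _ hj => exists_mem_maxSub_mem hΔ h𝒢 hj)

theorem maxSub_of_inFund {J : Finset (Fin n)} (hJ : InFund Δ 𝒢 J) : maxSub Δ 𝒢 J = {J} := by
  ext K
  rw [mem_maxSub, Finset.mem_singleton]
  constructor
  · intro h
    exact h.eq_of_le ⟨hJ, subset_rfl⟩ h.1.2
  · rintro rfl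
    exact ⟨⟨hJ, subset_rfl⟩, fun L hL _ => hL.2⟩

theorem maxSub_empty : maxSub Δ 𝒢 ∅ = ∅ := by
  ext K
  rw [mem_maxSub]
  simp only [Finset.notMem_empty, iff_false]
  intro h
  have := h.1.1.1
  rw [Finset.subset_empty.1 h.1.2] at this
  exact Finset.not_nonempty_empty this

theorem maxIn_fund (J : Finset (Fin n)) :
    maxIn (fund Δ 𝒢) (simpleSpan Δ J) = simpleSpan Δ '' (maxSub Δ 𝒢 J : Set (Finset (Fin n))) := by
  ext U
  simp only [maxIn, Set.mem_ofPred_eq, Set.mem_image, Finset.mem_coe, mem_maxSub]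
  constructor
  · intro h
    obtain ⟨K, hK, rfl⟩ := mem_fund.1 h.1.1
    refine ⟨K, ⟨⟨hK, simpleSpan_le_iff.1 h.1.2⟩, fun L hL hKL => ?_⟩, rfl⟩
    exact simpleSpan_le_iff.1 (h.2 ⟨simpleSpan_mem_fund.2 hL.1, simpleSpan_le_iff.2 hL.2⟩
      (simpleSpan_le_iff.2 hKL))
  · rintro ⟨K, hK, rfl⟩
    refine ⟨⟨simpleSpan_mem_fund.2 hK.1.1, simpleSpan_le_iff.2 hK.1.2⟩, ?_⟩
    rintro U ⟨hU, hUJ⟩ hKU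
    obtain ⟨L, hL, rfl⟩ := mem_fund.1 hU
    exact simpleSpan_le_iff.2 (hK.2 ⟨hL, simpleSpan_le_iff.1 hUJ⟩ (simpleSpan_le_iff.1 hKU))

theorem finsum_maxIn_fund {M : Type*} [AddCommMonoid M] (J : Finset (Fin n))
    (f : Submodule ℝ V → M) :
    ∑ᶠ A ∈ maxIn (fund Δ 𝒢) (simpleSpan Δ J), f A = ∑ K ∈ maxSub Δ 𝒢 J, f (simpleSpan Δ K) := by
  rw [maxIn_fund, finsum_mem_image simpleSpan_injective.injOn, finsum_mem_coe_finset]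

end FundamentalSubspaces

/-! ### Inequalities for suitable lists, and points with prescribed tight inequalities. -/

section SuitableLists

set_option linter.unusedSectionVars false

variable {V : Type*} [NormedAddCommGroup V] [InnerProductSpace ℝ V] [FiniteDimensional ℝ V]
variable {n : ℕ} {Φ : Finset V} {Δ : Module.Basis (Fin n) ℝ V} {𝒢 : Set (Submodule ℝ V)}
variable {ε : Fin n → ℝ}

/-! ### Inequalities between the terms of a suitable list -/

theorem finite_ratio_set {i j : ℕ} : (insert 1 {r : ℝ | ∃ A ∈ fund Δ 𝒢, ∃ B ∈ fund Δ 𝒢, B < A ∧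
    Module.finrank ℝ A = i ∧ Module.finrank ℝ B = j ∧
    r = maxCoeff Φ Δ A / minCoeff Φ Δ B}).Finite := by
  refine Set.Finite.insert _ (Set.Finite.subset (Set.finite_range
    fun p : Finset (Fin n) × Finset (Fin n) =>
      maxCoeff Φ Δ (simpleSpan Δ p.1) / minCoeff Φ Δ (simpleSpan Δ p.2)) ?_)
  rintro r ⟨A, hA, B, hB, -, -, -, rfl⟩
  obtain ⟨J, -, rfl⟩ := mem_fund.1 hA
  obtain ⟨K, -, rfl⟩ := mem_fund.1 hB
  exact ⟨(J, K), rfl⟩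

theorem one_le_ratio (i j : ℕ) : 1 ≤ ratio Φ Δ 𝒢 i j :=
  le_csSup finite_ratio_set.bddAbove (Set.mem_insert _ _)

theorem coeff_set_eq (J : Finset (Fin n)) :
    {c | ∃ i, Δ i ∈ simpleSpan Δ J ∧ c = Δ.repr (piVec Φ Δ (simpleSpan Δ J)) i} =
      coef Φ Δ J '' (J : Set (Fin n)) := by
  ext c
  simp only [simple_mem_simpleSpan, Set.mem_image, Finset.mem_coe]
  exact exists_congr fun i => and_congr_right fun _ => eq_comm

theorem coef_le_maxCoeff {J : Finset (Fin n)} {k : Fin n} (hk : k ∈ J) :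
    coef Φ Δ J k ≤ maxCoeff Φ Δ (simpleSpan Δ J) := by
  rw [maxCoeff, coeff_set_eq]
  exact le_csSup (J.finite_toSet.image _).bddAbove ⟨k, hk, rfl⟩

theorem minCoeff_le_coef {J : Finset (Fin n)} {k : Fin n} (hk : k ∈ J) :
    minCoeff Φ Δ (simpleSpan Δ J) ≤ coef Φ Δ J k := by
  rw [minCoeff, coeff_set_eq]
  exact csInf_le (J.finite_toSet.image _).bddBelow ⟨k, hk, rfl⟩

theorem minCoeff_pos (hΦ : IsRootSystem Φ) (hΔ : IsSimpleBasis Φ Δ) {J : Finset (Fin n)}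
    (hJ : J.Nonempty) : 0 < minCoeff Φ Δ (simpleSpan Δ J) := by
  rw [minCoeff, coeff_set_eq]
  have h : (coef Φ Δ J '' (J : Set (Fin n))).Nonempty := hJ.to_set.image _
  obtain ⟨k, hk, h⟩ := h.csInf_mem (J.finite_toSet.image _)
  rw [← h]
  exact coef_pos hΦ hΔ hk

theorem term_eq {k : ℕ} (h : 1 ≤ k ∧ k ≤ n) : term ε k = ε ⟨k - 1, by omega⟩ := dif_pos h

theorem IsSuitable.term_pos (hε : IsSuitable Φ Δ 𝒢 ε) {k : ℕ} (h1 : 1 ≤ k) (h2 : k ≤ n) :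
    0 < term ε k := by
  rw [term_eq ⟨h1, h2⟩]; exact hε.pos _

theorem IsSuitable.two_mul_term_lt (hε : IsSuitable Φ Δ 𝒢 ε) {k : ℕ} (h1 : 1 ≤ k)
    (h2 : k + 1 ≤ n) : 2 * term ε k < term ε (k + 1) := by
  have h := hε.lt (k + 1) (by omega) h2
  rw [Nat.add_sub_cancel] at h
  have h3 := one_le_ratio (Φ := Φ) (Δ := Δ) (𝒢 := 𝒢) (k + 1) k
  have h4 := hε.term_pos h1 (by omega)
  nlinarith

theorem IsSuitable.two_pow_mul_term_lt (hε : IsSuitable Φ Δ 𝒢 ε) {k : ℕ} (h1 : 1 ≤ k) (m : ℕ)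
    (h2 : k + (m + 1) ≤ n) : 2 ^ (m + 1) * term ε k < term ε (k + (m + 1)) := by
  induction m with
  | zero => simpa using hε.two_mul_term_lt h1 h2
  | succ m ih =>
    have h := ih (by omega)
    have h' := hε.two_mul_term_lt (k := k + (m + 1)) (by omega) (by omega)
    rw [pow_succ]
    rw [show k + (m + 1 + 1) = k + (m + 1) + 1 by ring]
    linarith

theorem InFund.one_le_card {J : Finset (Fin n)} (hJ : InFund Δ 𝒢 J) : 1 ≤ J.card :=
  Finset.card_pos.2 hJ.1

theorem card_le (J : Finset (Fin n)) : J.card ≤ n := by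
  simpa using Finset.card_le_univ J

/-- The inequalities multiply along chains from `B` to `A`, so it suffices to treat a pair with no
member strictly between. If the dimensions differ by one, the bound is the suitability condition. If
they differ by more, the roots of `A` outside `B` are orthogonal to `B`, so the coefficients agree
on `B` and the repeated doubling of the terms suffices. -/
theorem IsSuitable.coef_mul_lt (hΦ : IsRootSystem Φ) (hΔ : IsSimpleBasis Φ Δ)
    (h𝒢 : IsBuildingSet Φ 𝒢) (hε : IsSuitable Φ Δ 𝒢 ε) (m : ℕ) :
    ∀ {A B : Finset (Fin n)}, InFund Δ 𝒢 A → InFund Δ 𝒢 B → B ⊂ A → A.card = B.card + (m + 1) →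
    ∀ k ∈ B, 2 ^ (m + 1) * (coef Φ Δ A k * term ε B.card) < coef Φ Δ B k * term ε A.card := by
  induction m using Nat.strong_induction_on with
  | _ m ih =>
    intro A B hA hB hBA hcard k hk
    have hEB := hε.term_pos hB.one_le_card (card_le B)
    have hEA := hε.term_pos hA.one_le_card (card_le A)
    have hkA : k ∈ A := hBA.1 hk
    have hcB := coef_pos hΦ hΔ hk
    have hcA := coef_pos hΦ hΔ hkA
    by_cases hC : ∃ C, InFund Δ 𝒢 C ∧ B ⊂ C ∧ C ⊂ A
    · obtain ⟨C, hC, hBC, hCA⟩ := hC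
      have h1 := Finset.card_lt_card hBC
      have h2 := Finset.card_lt_card hCA
      obtain ⟨p, hp⟩ : ∃ p, C.card = B.card + (p + 1) := ⟨C.card - B.card - 1, by omega⟩
      obtain ⟨q, hq⟩ : ∃ q, A.card = C.card + (q + 1) := ⟨A.card - C.card - 1, by omega⟩
      have h3 := ih p (by omega) hC hB hBC hp k hk
      have h4 := ih q (by omega) hA hC hCA hq k (hBC.1 hk)
      have hEC := hε.term_pos hC.one_le_card (card_le C)
      have hcC := coef_pos hΦ hΔ (hBC.1 hk)
      have h5 : m + 1 = (p + 1) + (q + 1) := by omega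
      rw [h5, pow_add]
      have h6 := mul_lt_mul'' h3 h4 (by positivity) (by positivity)
      have h7 : 0 < coef Φ Δ C k * term ε C.card := by positivity
      refine lt_of_mul_lt_mul_right ?_ h7.le
      calc _ = 2 ^ (p + 1) * (coef Φ Δ C k * term ε B.card) *
            (2 ^ (q + 1) * (coef Φ Δ A k * term ε C.card)) := by ring
        _ < _ := h6
        _ = _ := by ring
    · by_cases hm : m = 0
      · subst hm
        have h := hε.lt A.card (by have := hB.one_le_card; omega) (card_le A)
        have h1 : A.card - 1 = B.card := by omega
        rw [h1] at h
        have h2 : maxCoeff Φ Δ (simpleSpan Δ A) / minCoeff Φ Δ (simpleSpan Δ B) ≤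
            ratio Φ Δ 𝒢 A.card B.card := by
          refine le_csSup finite_ratio_set.bddAbove (Set.mem_insert_of_mem _ ?_)
          exact ⟨_, simpleSpan_mem_fund.2 hA, _, simpleSpan_mem_fund.2 hB,
            simpleSpan_lt_iff.2 hBA, finrank_simpleSpan A, finrank_simpleSpan B, rfl⟩
        have hmin := minCoeff_pos hΦ hΔ hB.1
        rw [div_le_iff₀ hmin] at h2
        have h3 := coef_le_maxCoeff (Φ := Φ) (Δ := Δ) hkA
        have h4 := minCoeff_le_coef (Φ := Φ) (Δ := Δ) hk
        have h5 := one_le_ratio (Φ := Φ) (Δ := Δ) (𝒢 := 𝒢) A.card B.card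
        set R := ratio Φ Δ 𝒢 A.card B.card
        have h6 : coef Φ Δ A k ≤ R * coef Φ Δ B k :=
          h3.trans (h2.trans (by gcongr))
        calc _ = 2 * coef Φ Δ A k * term ε B.card := by ring
          _ ≤ 2 * (R * coef Φ Δ B k) * term ε B.card := by gcongr
          _ = coef Φ Δ B k * (2 * R * term ε B.card) := by ring
          _ < _ := by gcongr
      -- A root of `A` outside `B` that is not orthogonal to `B` would produce the intermediate
      -- member `insert j B`, which is not `A` because the cardinalities differ by at least two.
      · have horth : ∀ i ∈ B, ∀ j ∈ A, j ∉ B → ⟪Δ i, Δ j⟫_ℝ = 0 := by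
          intro i hi j hj hjB
          by_contra hne
          refine hC ⟨insert j B, hB.insert hΦ hΔ h𝒢 hi hne, Finset.ssubset_insert hjB, ?_⟩
          have hsub : insert j B ⊆ A := Finset.insert_subset hj hBA.1
          refine Finset.ssubset_iff_subset_ne.2 ⟨hsub, fun he => ?_⟩
          rw [← he, Finset.card_insert_of_notMem hjB] at hcard
          omega
        rw [coef_eq_of_orthogonal hΦ hΔ hBA.1 horth hk]
        have h := hε.two_pow_mul_term_lt hB.one_le_card m (hcard ▸ card_le A)
        rw [← hcard] at h
        calc _ = coef Φ Δ B k * (2 ^ (m + 1) * term ε B.card) := by ring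
          _ < _ := by gcongr

/-! ### Existence of weights with prescribed tight inequalities -/

theorem sum_two_pow_le {ι : Type*} (s : Finset ι) (c : ι → ℕ) (hc : ∀ i ∈ s, 1 ≤ c i) :
    ∑ i ∈ s, (2 : ℝ) ^ c i ≤ 2 ^ (∑ i ∈ s, c i) := by
  classical
  rcases s.eq_empty_or_nonempty with rfl | hs
  · simp
  induction hs using Finset.Nonempty.cons_induction with
  | singleton a => simp
  | cons a s ha hs ih =>
    rw [Finset.sum_cons, Finset.sum_cons, pow_add]
    have h1 := ih fun i hi => hc i (Finset.mem_cons_of_mem hi)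
    have h2 : 1 ≤ c a := hc a (Finset.mem_cons_self a s)
    have h3 : 1 ≤ ∑ i ∈ s, c i := by
      obtain ⟨b, hb⟩ := hs
      exact (hc b (Finset.mem_cons_of_mem hb)).trans
        (Finset.single_le_sum (f := c) (fun _ _ => Nat.zero_le _) hb)
    have h4 : (2 : ℝ) ≤ 2 ^ c a := by
      simpa using pow_le_pow_right₀ (a := (2 : ℝ)) (by norm_num) h2
    have h5 : (2 : ℝ) ≤ 2 ^ (∑ i ∈ s, c i) := by
      simpa using pow_le_pow_right₀ (a := (2 : ℝ)) (by norm_num) h3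
    nlinarith

theorem sum_eq_sum_maxSub (hΔ : IsSimpleBasis Φ Δ) (h𝒢 : IsBuildingSet Φ 𝒢)
    (J : Finset (Fin n)) {M : Type*} [AddCommMonoid M] (f : Fin n → M) :
    ∑ k ∈ J, f k = ∑ K ∈ maxSub Δ 𝒢 J, ∑ k ∈ K, f k := by
  classical
  have h : J = (maxSub Δ 𝒢 J).biUnion id := by
    ext k
    rw [Finset.mem_biUnion]
    constructor
    · exact fun hk => exists_mem_maxSub_mem hΔ h𝒢 hk
    · rintro ⟨K, hK, hk⟩
      exact (mem_maxSub.1 hK).1.2 hk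
  conv_lhs => rw [h]
  rw [Finset.sum_biUnion]
  · rfl
  · intro K hK L hL hKL
    rw [Function.onFun, Finset.disjoint_left]
    exact fun k hk hl => hKL (eq_of_mem_maxSub hΔ h𝒢 hK hL hk hl)

theorem card_eq_sum_maxSub (hΔ : IsSimpleBasis Φ Δ) (h𝒢 : IsBuildingSet Φ 𝒢)
    (J : Finset (Fin n)) : J.card = ∑ K ∈ maxSub Δ 𝒢 J, K.card := by
  have := sum_eq_sum_maxSub hΔ h𝒢 J (fun _ => 1)
  simpa using this

/-- The weights `x k` will be the inner products of a point with the simple roots. The construction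
is recursive: remove `j` from `A`, solve for the maximal members of what remains so that each of
them is tight, and let `x j` make `A` tight. By `coef_mul_lt` the part away from `j` uses at most
half of `term ε A.card`, which leaves `x j` so large that every proper member containing `j` is
strict. The root `i` is removed only when it is alone, so that `{i}` stays tight. -/
theorem IsSuitable.exists_weights_aux (hΦ : IsRootSystem Φ) (hΔ : IsSimpleBasis Φ Δ)
    (h𝒢 : IsBuildingSet Φ 𝒢) (hε : IsSuitable Φ Δ 𝒢 ε) (i : Fin n) (m : ℕ) :
    ∀ A : Finset (Fin n), A.card = m → InFund Δ 𝒢 A → ∀ j ∈ A, (j = i → A = {i}) →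
    ∃ x : Fin n → ℝ, (∀ k ∈ A, 0 < x k) ∧ (i ∈ A → x i = 2 * term ε 1) ∧
      ∑ k ∈ A, coef Φ Δ A k * x k = term ε A.card ∧
      (∀ B, InFund Δ 𝒢 B → B ⊆ A → term ε B.card ≤ ∑ k ∈ B, coef Φ Δ B k * x k) ∧
      ∀ B, InFund Δ 𝒢 B → B ⊂ A → j ∈ B → term ε B.card < ∑ k ∈ B, coef Φ Δ B k * x k := by
  classical
  induction m using Nat.strong_induction_on with
  | _ m ih =>
    intro A hAm hA j hj hji
    set T := maxSub Δ 𝒢 (A.erase j) with hT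
    have hTK : ∀ K ∈ T, InFund Δ 𝒢 K ∧ K ⊂ A := by
      intro K hK
      have h := (mem_maxSub.1 hK).1
      exact ⟨h.1, lt_of_le_of_lt h.2 (Finset.erase_ssubset hj)⟩
    have hex : ∀ K ∈ T, ∃ x : Fin n → ℝ, (∀ k ∈ K, 0 < x k) ∧ (i ∈ K → x i = 2 * term ε 1) ∧
        ∑ k ∈ K, coef Φ Δ K k * x k = term ε K.card ∧
        (∀ B, InFund Δ 𝒢 B → B ⊆ K → term ε B.card ≤ ∑ k ∈ B, coef Φ Δ B k * x k) := by
      intro K hK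
      obtain ⟨hK1, hK2⟩ := hTK K hK
      -- The root removed from `K` at the next stage is different from `i` whenever possible.
      obtain ⟨l, hl, hli⟩ : ∃ l ∈ K, (l = i → K = {i}) := by
        by_cases h : K = {i}
        · exact ⟨i, by simp [h], fun _ => h⟩
        · by_contra! hc
          exact h (Finset.eq_singleton_iff_nonempty_unique_mem.2 ⟨hK1.1, fun l hl => (hc l hl).1⟩)
      obtain ⟨x, h1, h2, h3, h4, -⟩ := ih K.card (hAm ▸ Finset.card_lt_card hK2) K rfl hK1 l hl hli
      exact ⟨x, h1, h2, h3, h4⟩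
    choose! X hX1 hX2 hX3 hX4 using hex
    have hκ : ∀ k : Fin n, ∃ K, k ∈ A.erase j → K ∈ T ∧ k ∈ K := by
      intro k
      by_cases hk : k ∈ A.erase j
      · obtain ⟨K, hK, h⟩ := exists_mem_maxSub_mem hΔ h𝒢 hk
        exact ⟨K, fun _ => ⟨hK, h⟩⟩
      · exact ⟨∅, fun h => absurd h hk⟩
    choose κ hκ using hκ
    have hsub : ∀ K ∈ T, K ⊆ A.erase j := fun K hK => (mem_maxSub.1 hK).1.2
    have hκK : ∀ K ∈ T, ∀ k ∈ K, κ k = K := fun K hK k hk =>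
      eq_of_mem_maxSub hΔ h𝒢 (hκ k (hsub K hK hk)).1 hK (hκ k (hsub K hK hk)).2 hk
    set S := ∑ k ∈ A.erase j, coef Φ Δ A k * X (κ k) k with hS
    -- On each maximal member of `A.erase j` the recursive solution is kept, and the value at `j`
    -- solves the equation of `A`.
    set x : Fin n → ℝ := fun k => if k = j then (term ε A.card - S) / coef Φ Δ A j
      else X (κ k) k with hx
    have hxj : x j = (term ε A.card - S) / coef Φ Δ A j := by simp [hx]
    have hxK : ∀ K ∈ T, ∀ k ∈ K, x k = X K k := by
      intro K hK k hk
      have hkj : k ≠ j := (Finset.mem_erase.1 (hsub K hK hk)).1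
      simp only [hx, if_neg hkj, hκK K hK k hk]
    have hEA := hε.term_pos hA.one_le_card (card_le A)
    have hcj := coef_pos hΦ hΔ hj
    -- the part of the sum away from `j` is at most half of the total
    have hShalf : 2 * S ≤ term ε A.card ∧ 0 ≤ S := by
      have h1 : S = ∑ K ∈ T, ∑ k ∈ K, coef Φ Δ A k * X K k := by
        rw [hS, sum_eq_sum_maxSub hΔ h𝒢]
        refine Finset.sum_congr rfl fun K hK => Finset.sum_congr rfl fun k hk => ?_
        rw [hκK K hK k hk]
      have h2 : ∀ K ∈ T, 2 ^ A.card * ∑ k ∈ K, coef Φ Δ A k * X K k ≤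
          2 ^ K.card * term ε A.card := by
        intro K hK
        obtain ⟨hK1, hK2⟩ := hTK K hK
        have hlt := Finset.card_lt_card hK2
        obtain ⟨p, hp⟩ : ∃ p, A.card = K.card + (p + 1) := ⟨A.card - K.card - 1, by omega⟩
        have hEK := hε.term_pos hK1.one_le_card (card_le K)
        have h3 : (2 ^ (p + 1) * ∑ k ∈ K, coef Φ Δ A k * X K k) * term ε K.card ≤
            term ε A.card * term ε K.card := by
          calc _ = ∑ k ∈ K, (2 ^ (p + 1) * (coef Φ Δ A k * term ε K.card)) * X K k := by
                rw [Finset.mul_sum, Finset.sum_mul]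
                exact Finset.sum_congr rfl fun k _ => by ring
            _ ≤ ∑ k ∈ K, (coef Φ Δ K k * term ε A.card) * X K k :=
                Finset.sum_le_sum fun k hk => mul_le_mul_of_nonneg_right
                  (hε.coef_mul_lt hΦ hΔ h𝒢 p hA hK1 hK2 hp k hk).le (hX1 K hK k hk).le
            _ = term ε A.card * ∑ k ∈ K, coef Φ Δ K k * X K k := by
                rw [Finset.mul_sum]
                exact Finset.sum_congr rfl fun k _ => by ring
            _ = _ := by rw [hX3 K hK]
        have h4 := le_of_mul_le_mul_right h3 hEK
        calc _ = 2 ^ K.card * (2 ^ (p + 1) * ∑ k ∈ K, coef Φ Δ A k * X K k) := by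
              rw [hp, pow_add]; ring
          _ ≤ _ := by gcongr
      have h3 : 2 ^ A.card * S ≤ 2 ^ (A.card - 1) * term ε A.card := by
        calc _ = ∑ K ∈ T, 2 ^ A.card * ∑ k ∈ K, coef Φ Δ A k * X K k := by
              rw [h1, Finset.mul_sum]
          _ ≤ ∑ K ∈ T, 2 ^ K.card * term ε A.card := Finset.sum_le_sum h2
          _ = (∑ K ∈ T, 2 ^ K.card) * term ε A.card := by rw [Finset.sum_mul]
          _ ≤ 2 ^ (∑ K ∈ T, K.card) * term ε A.card := by
              gcongr
              exact sum_two_pow_le T _ fun K hK => (hTK K hK).1.one_le_card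
          _ = _ := by rw [← card_eq_sum_maxSub hΔ h𝒢, Finset.card_erase_of_mem hj]
      constructor
      · obtain ⟨q, hq⟩ : ∃ q, A.card = q + 1 := ⟨A.card - 1, by have := hA.one_le_card; omega⟩
        have h4 : (2 : ℝ) ^ A.card = 2 ^ (A.card - 1) * 2 := by
          rw [hq, pow_succ, Nat.add_sub_cancel]
        rw [h4, mul_assoc] at h3
        exact le_of_mul_le_mul_left h3 (by positivity)
      · rw [h1]
        exact Finset.sum_nonneg fun K hK => Finset.sum_nonneg fun k hk =>
          mul_nonneg (coef_nonneg hΦ hΔ _ _) (hX1 K hK k hk).le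
    have hxpos : ∀ k ∈ A, 0 < x k := by
      intro k hk
      by_cases hkj : k = j
      · subst hkj
        rw [hxj]
        have := hShalf.1
        exact div_pos (by linarith) hcj
      · obtain ⟨hK, hkK⟩ := hκ k (Finset.mem_erase.2 ⟨hkj, hk⟩)
        rw [hxK _ hK k hkK]
        exact hX1 _ hK k hkK
    have hsum : ∑ k ∈ A, coef Φ Δ A k * x k = term ε A.card := by
      rw [← Finset.add_sum_erase _ _ hj, hxj, mul_div_cancel₀ _ hcj.ne']
      have : ∑ k ∈ A.erase j, coef Φ Δ A k * x k = S := by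
        refine Finset.sum_congr rfl fun k hk => ?_
        obtain ⟨hK, hkK⟩ := hκ k hk
        rw [hxK _ hK k hkK]
      rw [this]
      ring
    have hstrict : ∀ B, InFund Δ 𝒢 B → B ⊂ A → j ∈ B →
        term ε B.card < ∑ k ∈ B, coef Φ Δ B k * x k := by
      intro B hB hBA hjB
      have hlt := Finset.card_lt_card hBA
      obtain ⟨p, hp⟩ : ∃ p, A.card = B.card + (p + 1) := ⟨A.card - B.card - 1, by omega⟩
      have h1 := hε.coef_mul_lt hΦ hΔ h𝒢 p hA hB hBA hp j hjB
      have hEB := hε.term_pos hB.one_le_card (card_le B)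
      have hcB := coef_pos hΦ hΔ hjB
      have h2 : (2 : ℝ) ≤ 2 ^ (p + 1) := by
        simpa using pow_le_pow_right₀ (a := (2 : ℝ)) (by norm_num) (show 1 ≤ p + 1 by omega)
      have h3 : 2 * (coef Φ Δ A j * term ε B.card) < coef Φ Δ B j * term ε A.card :=
        lt_of_le_of_lt (by gcongr) h1
      have h4 : coef Φ Δ A j * x j = term ε A.card - S := by
        rw [hxj, mul_div_cancel₀ _ hcj.ne']
      have h5 : coef Φ Δ A j * term ε B.card < coef Φ Δ A j * (coef Φ Δ B j * x j) := by
        have h6 : coef Φ Δ B j * (2 * S) ≤ coef Φ Δ B j * term ε A.card := by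
          have := hShalf.1
          gcongr
        calc coef Φ Δ A j * term ε B.card < coef Φ Δ B j * (term ε A.card - S) := by linarith
          _ = _ := by rw [← h4]; ring
      have h7 := lt_of_mul_lt_mul_left h5 hcj.le
      refine h7.trans_le ?_
      exact Finset.single_le_sum (f := fun k => coef Φ Δ B k * x k)
        (fun k hk => mul_nonneg (coef_nonneg hΦ hΔ _ _) (hxpos k (hBA.1 hk)).le) hjB
    refine ⟨x, hxpos, ?_, hsum, ?_, hstrict⟩
    · intro hi
      by_cases hij : i = j
      · have hAi := hji hij.symm
        rw [hAi] at hsum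
        simp only [Finset.sum_singleton, coef_singleton hΦ hΔ, Finset.card_singleton] at hsum
        linarith
      · obtain ⟨hK, hkK⟩ := hκ i (Finset.mem_erase.2 ⟨hij, hi⟩)
        rw [hxK _ hK i hkK]
        exact hX2 _ hK hkK
    · intro B hB hBA
      by_cases hjB : j ∈ B
      · rcases hBA.eq_or_ssubset with rfl | h
        · exact hsum.ge
        · exact (hstrict B hB h hjB).le
      · obtain ⟨K, hK, hBK⟩ := exists_mem_maxSub hB (J := A.erase j) fun k hk =>
          Finset.mem_erase.2 ⟨fun h => hjB (h ▸ hk), hBA hk⟩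
        have h1 : ∑ k ∈ B, coef Φ Δ B k * x k = ∑ k ∈ B, coef Φ Δ B k * X K k :=
          Finset.sum_congr rfl fun k hk => by rw [hxK K hK k (hBK hk)]
        rw [h1]
        exact hX4 K hK B hB hBK

/-- Average the solutions of `exists_weights_aux` for the full set over all `j ≠ i`. A proper member
other than `{i}` contains some `j ≠ i`, and the solution for that `j` makes its inequality strict,
while the others keep it weakly. -/
theorem IsSuitable.exists_weights (hn : 2 ≤ n) (hΦ : IsRootSystem Φ) (hΔ : IsSimpleBasis Φ Δ)
    (h𝒢 : IsBuildingSet Φ 𝒢) (htop : ⊤ ∈ 𝒢) (hε : IsSuitable Φ Δ 𝒢 ε) (i : Fin n) :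
    ∃ x : Fin n → ℝ, (∀ k, 0 < x k) ∧ x i = 2 * term ε 1 ∧
      ∑ k, coef Φ Δ Finset.univ k * x k = term ε n ∧
      ∀ B, InFund Δ 𝒢 B → B ≠ Finset.univ → B ≠ {i} →
        term ε B.card < ∑ k ∈ B, coef Φ Δ B k * x k := by
  classical
  have hA : InFund Δ 𝒢 Finset.univ := ⟨⟨i, Finset.mem_univ i⟩, by rwa [simpleSpan_univ]⟩
  have h := fun j => hε.exists_weights_aux hΦ hΔ h𝒢 i _ Finset.univ rfl hA j (Finset.mem_univ j)
  have h' : ∀ j, ∃ x : Fin n → ℝ, j ≠ i → (∀ k, 0 < x k) ∧ x i = 2 * term ε 1 ∧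
      ∑ k, coef Φ Δ Finset.univ k * x k = term ε n ∧
      (∀ B, InFund Δ 𝒢 B → term ε B.card ≤ ∑ k ∈ B, coef Φ Δ B k * x k) ∧
      ∀ B, InFund Δ 𝒢 B → B ≠ Finset.univ → j ∈ B →
        term ε B.card < ∑ k ∈ B, coef Φ Δ B k * x k := by
    intro j
    by_cases hj : j = i
    · exact ⟨0, fun h => absurd hj h⟩
    · obtain ⟨x, h1, h2, h3, h4, h5⟩ := h j fun e => absurd e hj
      exact ⟨x, fun _ => ⟨fun k => h1 k (Finset.mem_univ k), h2 (Finset.mem_univ i),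
        by simpa using h3, fun B hB => h4 B hB (Finset.subset_univ B),
        fun B hB hne hjB => h5 B hB (Finset.ssubset_univ_iff.2 hne) hjB⟩⟩
  choose X hX using h'
  set s := Finset.univ.erase i with hs
  have hsj : ∀ j ∈ s, j ≠ i := fun j hj => (Finset.mem_erase.1 hj).1
  have hcard : s.card = n - 1 := by simp [hs]
  have hsne : s.Nonempty := Finset.card_pos.1 (by omega)
  have hcpos : (0 : ℝ) < s.card := by exact_mod_cast Finset.card_pos.2 hsne
  have hlin : ∀ (B : Finset (Fin n)), ∑ k ∈ B, coef Φ Δ B k * ((∑ j ∈ s, X j k) / s.card) =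
      (∑ j ∈ s, ∑ k ∈ B, coef Φ Δ B k * X j k) / s.card := by
    intro B
    rw [Finset.sum_comm, Finset.sum_div]
    refine Finset.sum_congr rfl fun k _ => ?_
    rw [← Finset.mul_sum, mul_div_assoc]
  refine ⟨fun k => (∑ j ∈ s, X j k) / s.card, fun k => ?_, ?_, ?_, ?_⟩
  · exact div_pos (Finset.sum_pos (fun j hj => (hX j (hsj j hj)).1 k) hsne) hcpos
  · beta_reduce
    rw [Finset.sum_congr rfl fun j hj => (hX j (hsj j hj)).2.1, Finset.sum_const, nsmul_eq_mul,
      mul_div_cancel_left₀ _ hcpos.ne']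
  · rw [hlin, Finset.sum_congr rfl fun j hj => (hX j (hsj j hj)).2.2.1, Finset.sum_const,
      nsmul_eq_mul, mul_div_cancel_left₀ _ hcpos.ne']
  · intro B hB hBu hBi
    rw [hlin, lt_div_iff₀ hcpos, mul_comm, ← nsmul_eq_mul, ← Finset.sum_const]
    obtain ⟨j, hj, hji⟩ : ∃ j ∈ B, j ≠ i := by
      by_contra! hc
      exact hBi (Finset.eq_singleton_iff_nonempty_unique_mem.2 ⟨hB.1, hc⟩)
    refine Finset.sum_lt_sum (fun j hj => (hX j (hsj j hj)).2.2.2.1 B hB) ⟨j, ?_, ?_⟩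
    · exact Finset.mem_erase.2 ⟨hji, Finset.mem_univ j⟩
    · exact (hX j hji).2.2.2.2 B hB hBu hj

end SuitableLists

/-! ### The normals of the permutonestohedron, and linearity of its symmetries. -/

section Polytope

set_option linter.unusedSectionVars false

variable {V : Type*} [NormedAddCommGroup V] [InnerProductSpace ℝ V] [FiniteDimensional ℝ V]
variable {n : ℕ} {Φ : Finset V} {Δ : Module.Basis (Fin n) ℝ V} {𝒢 : Set (Submodule ℝ V)}
variable {ε : Fin n → ℝ}

/-- The standing assumptions of the construction of the permutonestohedron. -/
structure Setup (Φ : Finset V) (Δ : Module.Basis (Fin n) ℝ V) (𝒢 : Set (Submodule ℝ V))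
    (ε : Fin n → ℝ) : Prop where
  pos : 1 ≤ n
  root : IsRootSystem Φ
  simple : IsSimpleBasis Φ Δ
  building : IsBuildingSet Φ 𝒢
  top_mem : ⊤ ∈ 𝒢
  suitable : IsSuitable Φ Δ 𝒢 ε

/-! ### The normal vectors of the half-spaces -/

/-- The projection of `δ` to the orthogonal complement of the span of the simple roots in `J`. -/
noncomputable def coPi (Φ : Finset V) (Δ : Module.Basis (Fin n) ℝ V) (J : Finset (Fin n)) : V :=
  delta Φ Δ - simplePi Φ Δ J

theorem coPi_empty : coPi Φ Δ ∅ = delta Φ Δ := by rw [coPi, simplePi_empty, sub_zero]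

theorem inner_coPi_of_mem (hΦ : IsRootSystem Φ) (hΔ : IsSimpleBasis Φ Δ) {J : Finset (Fin n)}
    {j : Fin n} (hj : j ∈ J) : ⟪coPi Φ Δ J, Δ j⟫_ℝ = 0 := by
  rw [coPi, inner_sub_left, inner_delta_simple hΦ hΔ, inner_simplePi hΦ hΔ hj, sub_self]

theorem inner_coPi_of_notMem (hΦ : IsRootSystem Φ) (hΔ : IsSimpleBasis Φ Δ) {J : Finset (Fin n)}
    {j : Fin n} (hj : j ∉ J) : 0 < ⟪coPi Φ Δ J, Δ j⟫_ℝ := by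
  rw [coPi, inner_sub_left, sub_pos]
  refine lt_of_le_of_lt ?_ (regular_delta hΦ hΔ j)
  rw [real_inner_comm, inner_simplePi_eq_sum]
  refine Finset.sum_nonpos fun k hk => mul_nonpos_of_nonneg_of_nonpos (coef_nonneg hΦ hΔ _ _)
    (hΔ.inner_nonpos hΦ fun h => hj (h ▸ hk))

theorem dominant_coPi (hΦ : IsRootSystem Φ) (hΔ : IsSimpleBasis Φ Δ) (J : Finset (Fin n)) :
    Dominant Δ (coPi Φ Δ J) := fun j => by
  by_cases hj : j ∈ J
  · rw [inner_coPi_of_mem hΦ hΔ hj]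
  · exact (inner_coPi_of_notMem hΦ hΔ hj).le

theorem Dominant.isPos (hΦ : IsRootSystem Φ) (hΔ : IsSimpleBasis Φ Δ) {v : V}
    (h : Dominant Δ v) : IsPos Δ v :=
  repr_nonneg_of_inner_nonneg hΦ hΔ (J := Finset.univ) (by rw [simpleSpan_univ]; trivial)
    fun j _ => h j

theorem coPi_ne_zero (hΦ : IsRootSystem Φ) (hΔ : IsSimpleBasis Φ Δ) {J : Finset (Fin n)}
    (hJ : J ≠ Finset.univ) : coPi Φ Δ J ≠ 0 := by
  obtain ⟨j, hj⟩ : ∃ j, j ∉ J := by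
    by_contra! hc
    exact hJ (Finset.eq_univ_iff_forall.2 hc)
  intro h
  have := inner_coPi_of_notMem hΦ hΔ hj
  rw [h, inner_zero_left] at this
  exact lt_irrefl _ this

theorem inner_coPi_delta (hΦ : IsRootSystem Φ) (hΔ : IsSimpleBasis Φ Δ) (J : Finset (Fin n)) :
    ⟪coPi Φ Δ J, delta Φ Δ⟫_ℝ = ‖coPi Φ Δ J‖ ^ 2 := by
  have h : ⟪coPi Φ Δ J, simplePi Φ Δ J⟫_ℝ = 0 := by
    rw [inner_simplePi_eq_sum]
    exact Finset.sum_eq_zero fun k hk => by rw [inner_coPi_of_mem hΦ hΔ hk, mul_zero]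
  have h1 : delta Φ Δ = coPi Φ Δ J + simplePi Φ Δ J := by rw [coPi]; abel
  conv_lhs => rw [h1]
  rw [inner_add_right, h, add_zero, real_inner_self_eq_norm_sq]

theorem repr_coPi (J : Finset (Fin n)) (k : Fin n) :
    Δ.repr (coPi Φ Δ J) k = coef Φ Δ Finset.univ k - coef Φ Δ J k := by
  rw [coPi, map_sub, Finsupp.sub_apply, ← simplePi_univ, ← coef, ← coef]

/-- The sum of the terms of the list attached to the maximal members of `𝒢_fund` in `J`. -/
noncomputable def offset (Δ : Module.Basis (Fin n) ℝ V) (𝒢 : Set (Submodule ℝ V))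
    (ε : Fin n → ℝ) (J : Finset (Fin n)) : ℝ := ∑ K ∈ maxSub Δ 𝒢 J, term ε K.card

/-- The right-hand side of the inequality attached to `J`. -/
noncomputable def level (Δ : Module.Basis (Fin n) ℝ V) (𝒢 : Set (Submodule ℝ V))
    (ε : Fin n → ℝ) (J : Finset (Fin n)) : ℝ := term ε n - offset Δ 𝒢 ε J

theorem offset_empty : offset Δ 𝒢 ε ∅ = 0 := by rw [offset, maxSub_empty, Finset.sum_empty]

theorem offset_of_inFund {J : Finset (Fin n)} (hJ : InFund Δ 𝒢 J) :
    offset Δ 𝒢 ε J = term ε J.card := by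
  rw [offset, maxSub_of_inFund hJ, Finset.sum_singleton]

theorem Setup.offset_singleton (S : Setup Φ Δ 𝒢 ε) (i : Fin n) :
    offset Δ 𝒢 ε {i} = term ε 1 := by
  rw [offset_of_inFund (inFund_singleton S.simple S.building i), Finset.card_singleton]

theorem level_empty : level Δ 𝒢 ε ∅ = term ε n := by rw [level, offset_empty, sub_zero]

theorem Setup.level_singleton (S : Setup Φ Δ 𝒢 ε) (i : Fin n) :
    level Δ 𝒢 ε {i} = term ε n - term ε 1 := by rw [level, S.offset_singleton]

theorem Setup.term_one_le (S : Setup Φ Δ 𝒢 ε) {k : ℕ} (h1 : 1 ≤ k) (h2 : k ≤ n) :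
    term ε 1 ≤ term ε k := by
  rw [term_eq ⟨le_rfl, S.pos⟩, term_eq ⟨h1, h2⟩]
  exact S.suitable.strictMono.monotone (by simp)

theorem Setup.term_one_lt (S : Setup Φ Δ 𝒢 ε) {k : ℕ} (h1 : 1 < k) (h2 : k ≤ n) :
    term ε 1 < term ε k := by
  rw [term_eq ⟨le_rfl, S.pos⟩, term_eq ⟨h1.le, h2⟩]
  exact S.suitable.strictMono (by simp only [Fin.mk_lt_mk]; omega)

theorem Setup.term_pos (S : Setup Φ Δ 𝒢 ε) : 0 < term ε n := S.suitable.term_pos S.pos le_rfl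

theorem Setup.term_one_pos (S : Setup Φ Δ 𝒢 ε) : 0 < term ε 1 := S.suitable.term_pos le_rfl S.pos

/-- Only singletons have the smallest offset. -/
theorem Setup.offset_le (S : Setup Φ Δ 𝒢 ε) {J : Finset (Fin n)} (hJ : J.Nonempty)
    (h : offset Δ 𝒢 ε J ≤ term ε 1) : ∃ j, J = {j} := by
  obtain ⟨j, hj⟩ := hJ
  obtain ⟨K, hK, hjK⟩ := exists_mem_maxSub_mem S.simple S.building hj
  have hKI := (mem_maxSub.1 hK).1.1
  have hpos : ∀ L ∈ maxSub Δ 𝒢 J, 0 < term ε L.card := fun L hL =>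
    S.suitable.term_pos (mem_maxSub.1 hL).1.1.one_le_card (card_le L)
  have hone : maxSub Δ 𝒢 J = {K} := by
    refine Finset.eq_singleton_iff_unique_mem.2 ⟨hK, fun L hL => ?_⟩
    by_contra hLK
    have h1 : term ε L.card + term ε K.card ≤ offset Δ 𝒢 ε J := by
      rw [← Finset.sum_pair (f := fun M : Finset (Fin n) => term ε M.card) hLK]
      refine Finset.sum_le_sum_of_subset_of_nonneg ?_ fun M hM _ => (hpos M hM).le
      intro M hM
      rcases Finset.mem_insert.1 hM with rfl | hM
      · exact hL
      · rw [Finset.mem_singleton.1 hM]; exact hK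
    have h2 := S.term_one_le hKI.one_le_card (card_le K)
    have h3 := hpos L hL
    linarith
  have hcard := card_eq_sum_maxSub S.simple S.building J
  rw [hone, Finset.sum_singleton] at hcard
  rw [offset, hone, Finset.sum_singleton] at h
  have hK1 : K.card = 1 := by
    by_contra hne
    have := S.term_one_lt (k := K.card) (by have := hKI.one_le_card; omega) (card_le K)
    linarith
  exact Finset.card_eq_one.1 (hcard.trans hK1)

theorem exists_inner_eq (Δ : Module.Basis (Fin n) ℝ V) (x : Fin n → ℝ) :
    ∃ u : V, ∀ k, ⟪u, Δ k⟫_ℝ = x k := by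
  let f : V →ₗ[ℝ] (Fin n → ℝ) := LinearMap.pi fun k => (innerₗ V) (Δ k)
  have hf : ∀ u k, f u k = ⟪Δ k, u⟫_ℝ := fun u k => rfl
  have hinj : Function.Injective f := by
    intro u w h
    apply eq_of_inner_simple Δ
    intro i
    rw [real_inner_comm, real_inner_comm (Δ i), ← hf, ← hf, h]
  have hdim : Module.finrank ℝ V = Module.finrank ℝ (Fin n → ℝ) := by
    rw [Module.finrank_eq_card_basis Δ]; simp
  obtain ⟨u, hu⟩ := (LinearMap.injective_iff_surjective_of_finrank_eq_finrank hdim).1 hinj x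
  exact ⟨u, fun k => by rw [real_inner_comm, ← hf, hu]⟩

/-- A point on the facets attached to `∅` and `{i}`, and on no other facet. -/
theorem Setup.exists_point (S : Setup Φ Δ 𝒢 ε) (hn : 2 ≤ n) (i : Fin n) :
    ∃ u : V, Regular Δ u ∧ ⟪u, delta Φ Δ⟫_ℝ = term ε n ∧ ⟪u, coPi Φ Δ {i}⟫_ℝ = level Δ 𝒢 ε {i} ∧
      ∀ J : Finset (Fin n), J ≠ Finset.univ → J ≠ ∅ → J ≠ {i} →
        ⟪u, coPi Φ Δ J⟫_ℝ < level Δ 𝒢 ε J := by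
  obtain ⟨x, hx0, hxi, hxn, hxB⟩ :=
    S.suitable.exists_weights hn S.root S.simple S.building S.top_mem i
  obtain ⟨u, hu⟩ := exists_inner_eq Δ x
  have hpi : ∀ J, ⟪u, simplePi Φ Δ J⟫_ℝ = ∑ k ∈ J, coef Φ Δ J k * x k := fun J => by
    rw [inner_simplePi_eq_sum]
    exact Finset.sum_congr rfl fun k _ => by rw [hu]
  have hδ : ⟪u, delta Φ Δ⟫_ℝ = term ε n := by rw [← simplePi_univ, hpi, hxn]
  have hi : ⟪u, simplePi Φ Δ {i}⟫_ℝ = term ε 1 := by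
    rw [hpi, Finset.sum_singleton, coef_singleton S.root S.simple, hxi]; ring
  refine ⟨u, fun k => by rw [hu]; exact hx0 k, hδ, ?_, ?_⟩
  · rw [coPi, inner_sub_right, hδ, hi, S.level_singleton]
  · intro J hJu hJ hJi
    -- Splitting `π_J` over the maximal members of `J` reduces the claim to these members. All of
    -- them are strict except `{i}`, so equality could hold only for `J = {i}`.
    rw [coPi, inner_sub_right, hδ, level, sub_lt_sub_iff_left,
      ← sum_simplePi_maxSub S.root S.simple S.building, inner_sum, offset]
    have hle : ∀ K ∈ maxSub Δ 𝒢 J, K ≠ {i} → term ε K.card < ⟪u, simplePi Φ Δ K⟫_ℝ := by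
      intro K hK hKi
      have hK' := (mem_maxSub.1 hK).1
      rw [hpi]
      refine hxB K hK'.1 (fun h => hJu ?_) hKi
      rw [h] at hK'
      exact Finset.univ_subset_iff.1 hK'.2
    refine Finset.sum_lt_sum (fun K hK => ?_) ?_
    · by_cases hKi : K = {i}
      · rw [hKi, hi, Finset.card_singleton]
      · exact (hle K hK hKi).le
    · by_contra! hc
      have hall : ∀ K ∈ maxSub Δ 𝒢 J, K = {i} := by
        intro K hK
        by_contra hne
        exact absurd (hle K hK hne) (not_lt.2 (hc K hK))
      refine hJi (Finset.eq_singleton_iff_nonempty_unique_mem.2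
        ⟨Finset.nonempty_iff_ne_empty.2 hJ, fun k hk => ?_⟩)
      obtain ⟨K, hK, hkK⟩ := exists_mem_maxSub_mem S.simple S.building hk
      rw [hall K hK] at hkK
      exact Finset.mem_singleton.1 hkK

/-- The point of `exists_point` is regular, so it pairs positively with the nonzero dominant vector
`coPi J`, and this pairing is at most the level. For `n = 1` the only proper set is empty. -/
theorem Setup.level_pos (S : Setup Φ Δ 𝒢 ε) {J : Finset (Fin n)} (hJ : J ≠ Finset.univ) :
    0 < level Δ 𝒢 ε J := by
  by_cases hJe : J = ∅
  · rw [hJe, level_empty]; exact S.term_pos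
  have hn : 2 ≤ n := by
    by_contra hlt
    have h1 := Finset.card_pos.2 (Finset.nonempty_iff_ne_empty.2 hJe)
    have h2 := Finset.card_lt_univ_of_notMem (s := J)
      (x := (Classical.not_forall.1 fun h => hJ (Finset.eq_univ_iff_forall.2 h)).choose)
      (Classical.not_forall.1 fun h => hJ (Finset.eq_univ_iff_forall.2 h)).choose_spec
    rw [Fintype.card_fin] at h2
    omega
  obtain ⟨u, hu, -, hui, huJ⟩ := S.exists_point hn ⟨0, S.pos⟩
  have h1 : 0 < ⟪coPi Φ Δ J, u⟫_ℝ :=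
    ((dominant_coPi S.root S.simple J).isPos S.root S.simple).inner_pos
    hu (coPi_ne_zero S.root S.simple hJ)
  rw [real_inner_comm] at h1
  by_cases hJi : J = {⟨0, S.pos⟩}
  · rw [hJi] at h1 ⊢
    rwa [hui] at h1
  · exact h1.trans (huJ J hJ hJe hJi)

/-- The normal vector attached to `J`, scaled so that the inequality reads `⟪x, q⟫ ≤ 1`. -/
noncomputable def normal (Φ : Finset V) (Δ : Module.Basis (Fin n) ℝ V) (𝒢 : Set (Submodule ℝ V))
    (ε : Fin n → ℝ) (J : Finset (Fin n)) : V := (level Δ 𝒢 ε J)⁻¹ • coPi Φ Δ J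

/-- The scaled normal vectors of all the half-spaces. -/
def normals (Φ : Finset V) (Δ : Module.Basis (Fin n) ℝ V) (𝒢 : Set (Submodule ℝ V))
    (ε : Fin n → ℝ) : Set V :=
  {q | ∃ σ ∈ coxeterGroup Φ, ∃ J : Finset (Fin n), J ≠ Finset.univ ∧ q = σ (normal Φ Δ 𝒢 ε J)}

theorem normal_mem_normals {J : Finset (Fin n)} (hJ : J ≠ Finset.univ) :
    normal Φ Δ 𝒢 ε J ∈ normals Φ Δ 𝒢 ε := ⟨1, one_mem _, J, hJ, rfl⟩

theorem Setup.empty_ne_univ (S : Setup Φ Δ 𝒢 ε) : (∅ : Finset (Fin n)) ≠ Finset.univ := by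
  intro h
  have := Finset.mem_univ (⟨0, S.pos⟩ : Fin n)
  rw [← h] at this
  simp at this

theorem singleton_ne_univ (hn : 2 ≤ n) (i : Fin n) : ({i} : Finset (Fin n)) ≠ Finset.univ := by
  intro h
  have := congrArg Finset.card h
  simp at this
  omega

theorem Setup.finite_normals (S : Setup Φ Δ 𝒢 ε) : (normals Φ Δ 𝒢 ε).Finite := by
  refine Set.Finite.subset (((finite_coxeterGroup S.root).prod
    (Set.finite_univ (α := Finset (Fin n)))).image fun p => p.1 (normal Φ Δ 𝒢 ε p.2)) ?_
  rintro _ ⟨σ, hσ, J, -, rfl⟩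
  exact ⟨(σ, J), ⟨hσ, Set.mem_univ _⟩, rfl⟩

theorem mem_image_halfSpace {σ : V ≃ₗᵢ[ℝ] V} {d x : V} {c : ℝ} :
    x ∈ σ '' {y : V | ⟪y, d⟫_ℝ ≤ c} ↔ ⟪x, σ d⟫_ℝ ≤ c := by
  constructor
  · rintro ⟨y, hy, rfl⟩
    rwa [LinearIsometryEquiv.inner_map_map]
  · intro h
    refine ⟨σ.symm x, ?_, σ.apply_symm_apply x⟩
    rw [Set.mem_ofPred_eq, ← LinearIsometryEquiv.inner_map_map σ, σ.apply_symm_apply]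
    exact h

theorem Setup.mem_permutonestohedron_iff (S : Setup Φ Δ 𝒢 ε) {x : V} :
    x ∈ permutonestohedron Φ Δ 𝒢 ε ↔ ∀ σ ∈ coxeterGroup Φ, ∀ J : Finset (Fin n),
      J ≠ Finset.univ → ⟪x, σ (coPi Φ Δ J)⟫_ℝ ≤ level Δ 𝒢 ε J := by
  have hsum : ∀ J : Finset (Fin n), halfSpaceSum Φ Δ 𝒢 ε (simpleSpan Δ J) =
      {x | ⟪x, coPi Φ Δ J⟫_ℝ ≤ level Δ 𝒢 ε J} := by
    intro J
    rw [halfSpaceSum, finsum_maxIn_fund, finsum_maxIn_fund]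
    simp only [finrank_simpleSpan]
    rw [coPi, ← sum_simplePi_maxSub S.root S.simple S.building, level, offset]
    rfl
  have hfund : ∀ J : Finset (Fin n), InFund Δ 𝒢 J → halfSpace Φ Δ ε (simpleSpan Δ J) =
      {x | ⟪x, coPi Φ Δ J⟫_ℝ ≤ level Δ 𝒢 ε J} := by
    intro J hJ
    rw [halfSpace, finrank_simpleSpan, level, offset_of_inFund hJ]
    rfl
  have htop : halfSpaceTop Φ Δ ε = {x | ⟪x, coPi Φ Δ ∅⟫_ℝ ≤ level Δ 𝒢 ε ∅} := by
    rw [halfSpaceTop, coPi_empty, level_empty]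
  simp only [permutonestohedron, Set.mem_iInter, Set.mem_inter_iff]
  refine forall₂_congr fun σ hσ => ?_
  constructor
  · rintro ⟨⟨h1, h2⟩, h3⟩ J hJ
    by_cases hJe : J = ∅
    · rw [htop, mem_image_halfSpace] at h1
      rw [hJe]; exact h1
    have hne := Finset.nonempty_iff_ne_empty.2 hJe
    by_cases hJI : InFund Δ 𝒢 J
    · have h4 := h2 (simpleSpan Δ J) ⟨simpleSpan_mem_fund.2 hJI, fun h => hJ
        (simpleSpan_injective (Δ := Δ) (by rw [simpleSpan_univ]; exact h))⟩
      rwa [hfund J hJI, mem_image_halfSpace] at h4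
    · have h4 := h3 (simpleSpan Δ J) ⟨mem_fundSubspaces.2 ⟨J, hne, rfl⟩,
        fun h => hJI (simpleSpan_mem_fund.1 h)⟩
      rwa [hsum J, mem_image_halfSpace] at h4
  · intro h
    refine ⟨⟨?_, ?_⟩, ?_⟩
    · rw [htop, mem_image_halfSpace]
      exact h ∅ S.empty_ne_univ
    · rintro A ⟨hA, hA'⟩
      obtain ⟨J, hJ, rfl⟩ := mem_fund.1 hA
      rw [hfund J hJ, mem_image_halfSpace]
      refine h J fun he => hA' ?_
      rw [he, simpleSpan_univ]; rfl
    · rintro B ⟨hB, hB'⟩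
      obtain ⟨J, hJ, rfl⟩ := mem_fundSubspaces.1 hB
      rw [hsum J, mem_image_halfSpace]
      refine h J fun he => hB' ?_
      rw [he] at hJ ⊢
      exact simpleSpan_mem_fund.2 ⟨hJ, by rw [simpleSpan_univ]; exact S.top_mem⟩

theorem Setup.mem_iff_normals (S : Setup Φ Δ 𝒢 ε) {x : V} :
    x ∈ permutonestohedron Φ Δ 𝒢 ε ↔ ∀ q ∈ normals Φ Δ 𝒢 ε, ⟪x, q⟫_ℝ ≤ 1 := by
  rw [S.mem_permutonestohedron_iff]
  have key : ∀ (σ : V ≃ₗᵢ[ℝ] V) (J : Finset (Fin n)), J ≠ Finset.univ →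
      (⟪x, σ (normal Φ Δ 𝒢 ε J)⟫_ℝ ≤ 1 ↔ ⟪x, σ (coPi Φ Δ J)⟫_ℝ ≤ level Δ 𝒢 ε J) := by
    intro σ J hJ
    rw [normal, map_smul, real_inner_smul_right, inv_mul_le_iff₀ (S.level_pos hJ), mul_one]
  constructor
  · rintro h _ ⟨σ, hσ, J, hJ, rfl⟩
    exact (key σ J hJ).2 (h σ hσ J hJ)
  · intro h σ hσ J hJ
    exact (key σ J hJ).1 (h _ ⟨σ, hσ, J, hJ, rfl⟩)

/-! ### Symmetries of the permutonestohedron are linear -/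

theorem Setup.map_mem_of_coxeterGroup (S : Setup Φ Δ 𝒢 ε) {σ : V ≃ₗᵢ[ℝ] V}
    (hσ : σ ∈ coxeterGroup Φ) {x : V} (hx : x ∈ permutonestohedron Φ Δ 𝒢 ε) :
    σ x ∈ permutonestohedron Φ Δ 𝒢 ε := by
  rw [S.mem_permutonestohedron_iff] at hx ⊢
  intro τ hτ J hJ
  have h := hx (σ⁻¹ * τ) (mul_mem (inv_mem hσ) hτ) J hJ
  rw [← LinearIsometryEquiv.inner_map_map σ] at h
  simpa [LinearIsometryEquiv.coe_mul, LinearIsometryEquiv.coe_inv] using h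

theorem Setup.zero_mem (S : Setup Φ Δ 𝒢 ε) : (0 : V) ∈ permutonestohedron Φ Δ 𝒢 ε := by
  rw [S.mem_iff_normals]
  intro q _
  simp

/-- Move `x` into the dominant chamber. Its coordinates become nonnegative, and the inequality of
`δ` bounds each of them. -/
theorem Setup.norm_le (S : Setup Φ Δ 𝒢 ε) {x : V} (hx : x ∈ permutonestohedron Φ Δ 𝒢 ε) :
    ‖x‖ ≤ ∑ i, 2 * term ε n / ‖Δ i‖ ^ 2 * ‖Δ i‖ := by
  obtain ⟨σ, hσ, hdom⟩ := exists_dominant S.root S.simple x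
  rw [← LinearIsometryEquiv.norm_map σ]
  have hmem := S.map_mem_of_coxeterGroup hσ hx
  set y := σ x
  have hpos := hdom.isPos S.root S.simple
  have h1 := S.mem_permutonestohedron_iff.1 hmem 1 (one_mem _) ∅ S.empty_ne_univ
  rw [coPi_empty, level_empty, LinearIsometryEquiv.coe_one, id, inner_eq_sum Δ] at h1
  have h2 : ∀ i, Δ.repr y i ≤ 2 * term ε n / ‖Δ i‖ ^ 2 := by
    intro i
    have hp := norm_simple_pos (Δ := Δ) i
    have h3 := Finset.single_le_sum (f := fun i => Δ.repr y i * ⟪Δ i, delta Φ Δ⟫_ℝ)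
      (fun j _ => mul_nonneg (hpos j) (by
        rw [real_inner_comm]; exact (regular_delta S.root S.simple j).le)) (Finset.mem_univ i)
    have h4 : Δ.repr y i * (‖Δ i‖ ^ 2 / 2) ≤ term ε n := by
      rw [← inner_delta_simple S.root S.simple, real_inner_comm]
      exact h3.trans h1
    rw [le_div_iff₀ (by positivity)]
    linarith
  calc ‖y‖ = ‖∑ i, Δ.repr y i • Δ i‖ := by rw [Δ.sum_repr]
    _ ≤ ∑ i, ‖Δ.repr y i • Δ i‖ := norm_sum_le _ _
    _ ≤ _ := by
      refine Finset.sum_le_sum fun i _ => ?_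
      rw [norm_smul, Real.norm_of_nonneg (hpos i)]
      have := h2 i
      gcongr

/-- Bring `-y` and `b` to the same chamber, where dominant vectors pair nonnegatively. -/
theorem exists_inner_map_nonpos (hΦ : IsRootSystem Φ) (hΔ : IsSimpleBasis Φ Δ) (y b : V) :
    ∃ σ ∈ coxeterGroup Φ, ⟪σ y, b⟫_ℝ ≤ 0 := by
  obtain ⟨σ, hσ, h1⟩ := exists_dominant hΦ hΔ (-y)
  obtain ⟨τ, hτ, h2⟩ := exists_dominant hΦ hΔ b
  refine ⟨τ⁻¹ * σ, mul_mem (inv_mem hτ) hσ, ?_⟩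
  have h3 := (h1.isPos hΦ hΔ).inner_nonneg h2
  rw [← LinearIsometryEquiv.inner_map_map τ]
  simp only [LinearIsometryEquiv.coe_mul, LinearIsometryEquiv.coe_inv, Function.comp_apply,
    LinearIsometryEquiv.apply_symm_apply]
  rw [map_neg, inner_neg_left] at h3
  linarith

/-- If `b = g 0` were nonzero, take `y` in the polytope with norm close to the supremum and move it
by the Coxeter group until `⟪y, b⟫ ≤ 0`. Its distance from `b`, which is the norm of its preimage
under `g`, would exceed the supremum. -/
theorem Setup.map_zero (S : Setup Φ Δ 𝒢 ε) {g : Equiv.Perm V}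
    (hg : g ∈ isometryGroup (permutonestohedron Φ Δ 𝒢 ε)) : g 0 = 0 := by
  obtain ⟨hiso, him⟩ := hg
  by_contra hne
  set b := g 0 with hb
  set T : Set ℝ := (fun y => ‖y‖ ^ 2) '' permutonestohedron Φ Δ 𝒢 ε with hT
  have hbdd : BddAbove T := by
    refine ⟨(∑ i, 2 * term ε n / ‖Δ i‖ ^ 2 * ‖Δ i‖) ^ 2, ?_⟩
    rintro _ ⟨y, hy, rfl⟩
    exact pow_le_pow_left₀ (norm_nonneg y) (S.norm_le hy) 2
  have hb0 : 0 < ‖b‖ := norm_pos_iff.2 hne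
  obtain ⟨_, ⟨y, hy, rfl⟩, hlt⟩ := exists_lt_of_lt_csSup (s := T) ⟨_, 0, S.zero_mem, rfl⟩
    (show sSup T - ‖b‖ ^ 2 < sSup T by
      have : 0 < ‖b‖ ^ 2 := by positivity
      linarith)
  obtain ⟨σ, hσ, hle⟩ := exists_inner_map_nonpos S.root S.simple y b
  have hmem := S.map_mem_of_coxeterGroup hσ hy
  rw [← him] at hmem
  obtain ⟨z, hz, hzy⟩ := hmem
  have h1 : ‖z‖ ^ 2 = ‖σ y - b‖ ^ 2 := by
    have := hiso.dist_eq z 0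
    rw [hzy, ← hb, dist_eq_norm, dist_zero_right] at this
    rw [this]
  rw [norm_sub_sq_real, LinearIsometryEquiv.norm_map] at h1
  have h2 : ‖z‖ ^ 2 ≤ sSup T := le_csSup hbdd ⟨z, hz, rfl⟩
  simp only at hlt
  linarith

/-- A linear isometry mapping `P` onto itself. -/
def Preserves (P : Set V) (f : V ≃ₗᵢ[ℝ] V) : Prop := ∀ x, x ∈ P ↔ f x ∈ P

theorem Preserves.mul {P : Set V} {f g : V ≃ₗᵢ[ℝ] V} (hf : Preserves P f) (hg : Preserves P g) :
    Preserves P (f * g) := fun x => (hg x).trans (hf (g x))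

theorem Preserves.inv {P : Set V} {f : V ≃ₗᵢ[ℝ] V} (hf : Preserves P f) : Preserves P f⁻¹ :=
  fun x => by
    rw [hf (f⁻¹ x)]
    simp [LinearIsometryEquiv.coe_inv]

theorem Setup.preserves_of_coxeterGroup (S : Setup Φ Δ 𝒢 ε) {σ : V ≃ₗᵢ[ℝ] V}
    (hσ : σ ∈ coxeterGroup Φ) : Preserves (permutonestohedron Φ Δ 𝒢 ε) σ := fun x =>
  ⟨S.map_mem_of_coxeterGroup hσ, fun h => by
    simpa [LinearIsometryEquiv.coe_inv] using S.map_mem_of_coxeterGroup (inv_mem hσ) h⟩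

theorem Setup.exists_linearIsometry (S : Setup Φ Δ 𝒢 ε) {g : Equiv.Perm V}
    (hg : g ∈ isometryGroup (permutonestohedron Φ Δ 𝒢 ε)) :
    ∃ f : V ≃ₗᵢ[ℝ] V, (∀ x, f x = g x) ∧ Preserves (permutonestohedron Φ Δ 𝒢 ε) f := by
  let e : V ≃ᵢ V := ⟨g, hg.1⟩
  refine ⟨e.toRealLinearIsometryEquivOfMapZero (S.map_zero hg), fun x => rfl, fun x => ?_⟩
  change _ ↔ g x ∈ _
  constructor
  · intro hx
    rw [← hg.2]
    exact ⟨x, hx, rfl⟩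
  · intro hx
    rw [← hg.2] at hx
    obtain ⟨y, hy, h⟩ := hx
    rwa [← g.injective h]

theorem mem_isometryGroup_of_preserves {P : Set V} {f : V ≃ₗᵢ[ℝ] V} (hf : Preserves P f)
    {g : Equiv.Perm V} (hfg : ∀ x, f x = g x) : g ∈ isometryGroup P := by
  have h : (g : V → V) = f := funext fun x => (hfg x).symm
  refine ⟨h ▸ f.isometry, ?_⟩
  rw [h]
  ext x
  constructor
  · rintro ⟨y, hy, rfl⟩
    exact (hf y).1 hy
  · intro hx
    refine ⟨f.symm x, (hf _).2 ?_, f.apply_symm_apply x⟩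
    rwa [f.apply_symm_apply]

end Polytope

/-! ### Symmetries coming from root automorphisms, and the action on facet normals. -/

section Symmetries

set_option linter.unusedSectionVars false

variable {V : Type*} [NormedAddCommGroup V] [InnerProductSpace ℝ V] [FiniteDimensional ℝ V]
variable {n : ℕ} {Φ : Finset V} {Δ : Module.Basis (Fin n) ℝ V} {𝒢 : Set (Submodule ℝ V)}
variable {ε : Fin n → ℝ}

/-! ### Automorphisms of the root system are symmetries of the permutonestohedron -/

theorem simpleSpan_map {k : V ≃ₗᵢ[ℝ] V} {π : Equiv.Perm (Fin n)} (hk : ∀ i, k (Δ i) = Δ (π i))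
    (J : Finset (Fin n)) :
    (simpleSpan Δ J).map (k.toLinearEquiv : V →ₗ[ℝ] V) = simpleSpan Δ (J.map π.toEmbedding) := by
  rw [simpleSpan, Submodule.map_span, simpleSpan, Finset.coe_map, ← Set.image_comp,
    ← Set.image_comp]
  congr 1
  refine Set.image_congr fun i _ => ?_
  simpa using hk i

theorem InFund.map (hΦ : IsRootSystem Φ) (hΔ : IsSimpleBasis Φ Δ) (hinv : IsAutInvariant Φ 𝒢)
    {k : V ≃ₗᵢ[ℝ] V} {π : Equiv.Perm (Fin n)} (hk : ∀ i, k (Δ i) = Δ (π i))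
    {J : Finset (Fin n)} (hJ : InFund Δ 𝒢 J) : InFund Δ 𝒢 (J.map π.toEmbedding) := by
  refine ⟨hJ.1.map, ?_⟩
  rw [← simpleSpan_map hk]
  exact hinv k.toLinearEquiv (image_eq_of_perm hΦ hΔ k π hk) _ hJ.2

theorem symm_apply_simple {k : V ≃ₗᵢ[ℝ] V} {π : Equiv.Perm (Fin n)}
    (hk : ∀ i, k (Δ i) = Δ (π i)) (i : Fin n) : k.symm (Δ i) = Δ (π.symm i) := by
  rw [LinearIsometryEquiv.symm_apply_eq, hk, Equiv.apply_symm_apply]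

theorem offset_map (hΦ : IsRootSystem Φ) (hΔ : IsSimpleBasis Φ Δ) (hinv : IsAutInvariant Φ 𝒢)
    {k : V ≃ₗᵢ[ℝ] V} {π : Equiv.Perm (Fin n)} (hk : ∀ i, k (Δ i) = Δ (π i))
    (J : Finset (Fin n)) : offset Δ 𝒢 ε (J.map π.toEmbedding) = offset Δ 𝒢 ε J := by
  have hsymm : ∀ L : Finset (Fin n), (L.map π.symm.toEmbedding).map π.toEmbedding = L := by
    intro L
    ext i
    simp
  have hI : ∀ L : Finset (Fin n), InFund Δ 𝒢 (L.map π.toEmbedding) ↔ InFund Δ 𝒢 L := by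
    intro L
    refine ⟨fun h => ?_, fun h => h.map hΦ hΔ hinv hk⟩
    have := h.map hΦ hΔ hinv (symm_apply_simple hk)
    convert this using 1
    ext i
    simp
  symm
  refine Finset.sum_equiv (Equiv.finsetCongr π) (fun K => ?_) fun K _ => ?_
  · rw [mem_maxSub, mem_maxSub, Equiv.finsetCongr_apply]
    constructor
    · intro h
      refine ⟨⟨(hI K).2 h.1.1, Finset.map_subset_map.2 h.1.2⟩, fun L hL hKL => ?_⟩
      have hL1 := hsymm L
      set M := L.map π.symm.toEmbedding
      rw [← hL1] at hL hKL ⊢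
      exact Finset.map_subset_map.2 (h.2 ⟨(hI M).1 hL.1, Finset.map_subset_map.1 hL.2⟩
        (Finset.map_subset_map.1 hKL))
    · intro h
      refine ⟨⟨(hI K).1 h.1.1, Finset.map_subset_map.1 h.1.2⟩, fun L hL hKL => ?_⟩
      exact Finset.map_subset_map.1 (h.2 ⟨(hI L).2 hL.1, Finset.map_subset_map.2 hL.2⟩
        (Finset.map_subset_map.2 hKL))
  · rw [Equiv.finsetCongr_apply, Finset.card_map]

theorem map_coPi (hΦ : IsRootSystem Φ) (hΔ : IsSimpleBasis Φ Δ)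
    {k : V ≃ₗᵢ[ℝ] V} {π : Equiv.Perm (Fin n)} (hk : ∀ i, k (Δ i) = Δ (π i))
    (J : Finset (Fin n)) : k (coPi Φ Δ J) = coPi Φ Δ (J.map π.toEmbedding) := by
  rw [coPi, map_sub, map_delta_of_perm hΦ hΔ k π hk, coPi]
  congr 1
  refine eq_simplePi hΦ hΔ ?_ fun j hj => ?_
  · rw [← simpleSpan_map hk]
    exact Submodule.mem_map_of_mem (simplePi_mem J)
  · obtain ⟨i, hi, rfl⟩ := Finset.mem_map.1 hj
    change ⟪_, Δ (π i)⟫_ℝ = ‖Δ (π i)‖ ^ 2 / 2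
    rw [← hk, LinearIsometryEquiv.inner_map_map, LinearIsometryEquiv.norm_map,
      inner_simplePi hΦ hΔ hi]

/-- Some `τ` in the Coxeter group makes `τ * (f⁻¹ * σ)` a permutation `π` of the simple roots. Then
the inequality of `σ` and `J` at `f x` is the inequality of `τ⁻¹` and `π J` at `x`, and the two
levels agree by invariance of `𝒢`. -/
theorem Setup.map_mem_of_image_eq (S : Setup Φ Δ 𝒢 ε) (hinv : IsAutInvariant Φ 𝒢)
    {f : V ≃ₗᵢ[ℝ] V} (hf : f '' (Φ : Set V) = Φ) {x : V}
    (hx : x ∈ permutonestohedron Φ Δ 𝒢 ε) : f x ∈ permutonestohedron Φ Δ 𝒢 ε := by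
  rw [S.mem_permutonestohedron_iff] at hx ⊢
  intro σ hσ J hJ
  have himage : (f⁻¹ * σ : V ≃ₗᵢ[ℝ] V) '' (Φ : Set V) = Φ := by
    have h1 : σ '' (Φ : Set V) = Φ := by
      apply subset_antisymm
      · rintro _ ⟨β, hβ, rfl⟩
        exact map_mem_of_mem_coxeterGroup S.root hσ β hβ
      · intro β hβ
        refine ⟨σ⁻¹ β, map_mem_of_mem_coxeterGroup S.root (inv_mem hσ) β hβ, ?_⟩
        simp [LinearIsometryEquiv.coe_inv]
    rw [LinearIsometryEquiv.coe_mul, Set.image_comp, h1, LinearIsometryEquiv.coe_inv]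
    conv_lhs => rw [← hf]
    rw [← Set.image_comp]
    simp
  obtain ⟨τ, hτ, π, hπ⟩ := exists_perm_of_image_eq S.root S.simple _ himage
  have hk : ∀ i, (τ * (f⁻¹ * σ)) (Δ i) = Δ (π i) := hπ
  have h1 := map_coPi S.root S.simple hk J
  have h2 := hx τ⁻¹ (inv_mem hτ) (J.map π.toEmbedding) (by
    intro h
    apply hJ
    rw [Finset.eq_univ_iff_forall] at h ⊢
    intro i
    simpa using h (π i))
  rw [level, offset_map S.root S.simple hinv hk, ← level, ← h1,
    ← LinearIsometryEquiv.inner_map_map f] at h2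
  simpa [LinearIsometryEquiv.coe_mul, LinearIsometryEquiv.coe_inv] using h2

theorem Setup.rootAut_le (S : Setup Φ Δ 𝒢 ε) (hnorm : IsNormalized Φ)
    (hinv : IsAutInvariant Φ 𝒢) :
    rootAut Φ ≤ isometryGroup (permutonestohedron Φ Δ 𝒢 ε) := by
  intro g hg
  obtain ⟨f, hfg, hf⟩ := exists_isometry_of_mem_rootAut S.root hnorm S.simple hg
  refine mem_isometryGroup_of_preserves (f := f) (fun x => ⟨S.map_mem_of_image_eq hinv hf, ?_⟩) hfg
  intro hx
  have hf' : (f⁻¹ : V ≃ₗᵢ[ℝ] V) '' (Φ : Set V) = Φ := by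
    rw [LinearIsometryEquiv.coe_inv]
    conv_lhs => rw [← hf]
    rw [← Set.image_comp]
    simp
  simpa [LinearIsometryEquiv.coe_inv] using S.map_mem_of_image_eq hinv hf' hx

theorem mem_rootAut_of_image_eq {f : V ≃ₗᵢ[ℝ] V} (hf : f '' (Φ : Set V) = Φ)
    {g : Equiv.Perm V} (hfg : ∀ x, f x = g x) : g ∈ rootAut Φ := by
  have h : (g : V → V) = f := funext fun x => (hfg x).symm
  refine ⟨?_, by rw [h]; exact hf⟩
  rw [h]
  exact ⟨map_add f, map_smul f⟩

/-! ### Facet normals are permuted by the symmetries -/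

theorem eventually_mem {N : Set V} (hN : N.Finite) {v y : V} (hv : ∀ q ∈ N, ⟪v, q⟫_ℝ ≤ 1)
    (hy : ∀ q ∈ N, ⟪v, q⟫_ℝ = 1 → ⟪y, q⟫_ℝ ≤ 0) :
    ∃ t : ℝ, 0 < t ∧ ∀ q ∈ N, ⟪v + t • y, q⟫_ℝ ≤ 1 := by
  have h : ∀ᶠ t : ℝ in nhdsWithin 0 (Set.Ioi 0), ∀ q ∈ N, ⟪v + t • y, q⟫_ℝ ≤ 1 := by
    rw [Filter.eventually_all_finite hN]
    intro q hq
    by_cases h1 : ⟪v, q⟫_ℝ = 1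
    · filter_upwards [self_mem_nhdsWithin] with t ht
      rw [inner_add_left, real_inner_smul_left, h1]
      have := mul_nonpos_of_nonneg_of_nonpos (le_of_lt ht) (hy q hq h1)
      linarith
    · have hlt : ⟪v, q⟫_ℝ < 1 := lt_of_le_of_ne (hv q hq) h1
      have hc : Continuous fun t : ℝ => ⟪v + t • y, q⟫_ℝ := by fun_prop
      have := (hc.tendsto 0).eventually_lt_const (u := 1) (by simpa using hlt)
      exact (this.filter_mono nhdsWithin_le_nhds).mono fun t ht => le_of_lt ht
  obtain ⟨t, ht, ht0⟩ := (h.and self_mem_nhdsWithin).exists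
  exact ⟨t, ht0, ht⟩

/-- If `p` is the only normal which is tight at some point, then its images under the symmetries
are normals. -/
theorem map_normal_mem {N : Set V} (hN : N.Finite) {g : V ≃ₗᵢ[ℝ] V}
    (hg : Preserves {x | ∀ q ∈ N, ⟪x, q⟫_ℝ ≤ 1} g) {p v : V} (hpN : p ∈ N) (hp : ⟪v, p⟫_ℝ = 1)
    (hv : ∀ q ∈ N, q ≠ p → ⟪v, q⟫_ℝ < 1) : g p ∈ N := by
  have hvP : ∀ q ∈ N, ⟪v, q⟫_ℝ ≤ 1 := fun q hq => by
    by_cases h : q = p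
    · rw [h, hp]
    · exact (hv q hq h).le
  have hgvP := (hg v).1 hvP
  have hp0 : p ≠ 0 := by
    rintro rfl
    rw [inner_zero_right] at hp
    exact zero_ne_one hp
  -- If no normal were tight at `g v`, one could move a little in the direction `g p`, so `v` in the
  -- direction `p`, which violates the inequality of `p`.
  obtain ⟨q, hqN, hq⟩ : ∃ q ∈ N, ⟪g v, q⟫_ℝ = 1 := by
    by_contra! hc
    obtain ⟨t, ht, h⟩ := eventually_mem hN (y := g p) hgvP fun q hq h => absurd h (hc q hq)
    have h1 := (hg (v + t • p)).2 (by rw [map_add, map_smul]; exact h) p hpN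
    rw [inner_add_left, hp, real_inner_smul_left, real_inner_self_eq_norm_sq] at h1
    have : 0 < t * ‖p‖ ^ 2 := by
      have := norm_pos_iff.2 hp0
      positivity
    linarith
  -- At `v` every direction in the half-space of `p` enters the polytope, so the half-space of `g p`
  -- is contained in that of `q`.
  have hcone : ∀ y, ⟪y, g p⟫_ℝ ≤ 0 → ⟪y, q⟫_ℝ ≤ 0 := by
    intro y hy
    obtain ⟨t, ht, h⟩ := eventually_mem hN (v := v) (y := g.symm y) hvP fun r hr h => by
      have hrp : r = p := by
        by_contra hne
        exact (hv r hr hne).ne h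
      rw [hrp, ← LinearIsometryEquiv.inner_map_map g, g.apply_symm_apply]
      exact hy
    have h1 := (hg _).1 h q hqN
    rw [map_add, map_smul, g.apply_symm_apply, inner_add_left, hq, real_inner_smul_left] at h1
    by_contra! hpos
    have := mul_pos ht hpos
    linarith
  have hgp : 0 < ‖g p‖ := norm_pos_iff.2 (by simpa using hp0)
  -- The component of `q` orthogonal to `g p` is itself a direction in the half-space, so it
  -- vanishes. The common value `1` at `g v` then gives `c = 1`.
  set c := ⟪q, g p⟫_ℝ / ‖g p‖ ^ 2 with hc
  have h1 : ⟪q - c • g p, g p⟫_ℝ = 0 := by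
    rw [inner_sub_left, real_inner_smul_left, real_inner_self_eq_norm_sq, hc]
    field_simp
    ring
  have h2 := hcone _ h1.le
  have h3 : ⟪q - c • g p, q - c • g p⟫_ℝ ≤ 0 := by
    rw [inner_sub_right (q - c • g p), real_inner_smul_right, h1]
    linarith
  have h4 : q - c • g p = 0 :=
    (inner_self_eq_zero (𝕜 := ℝ)).1 (le_antisymm h3 real_inner_self_nonneg)
  rw [sub_eq_zero] at h4
  rw [h4, real_inner_smul_right, LinearIsometryEquiv.inner_map_map, hp, mul_one] at hq
  rw [hq, one_smul] at h4
  rwa [← h4]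

theorem Setup.dominant_normal (S : Setup Φ Δ 𝒢 ε) {J : Finset (Fin n)} (hJ : J ≠ Finset.univ) :
    Dominant Δ (normal Φ Δ 𝒢 ε J) := fun i => by
  rw [normal, real_inner_smul_left]
  exact mul_nonneg (inv_nonneg.2 (S.level_pos hJ).le) (dominant_coPi S.root S.simple J i)

theorem Setup.inner_normal_eq_zero (S : Setup Φ Δ 𝒢 ε) {J : Finset (Fin n)}
    (hJ : J ≠ Finset.univ) {i : Fin n} : ⟪normal Φ Δ 𝒢 ε J, Δ i⟫_ℝ = 0 ↔ i ∈ J := by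
  rw [normal, real_inner_smul_left, mul_eq_zero, inv_eq_zero]
  constructor
  · rintro (h | h)
    · exact absurd h (S.level_pos hJ).ne'
    · by_contra hi
      exact (inner_coPi_of_notMem S.root S.simple hi).ne' h
  · exact fun h => Or.inr (inner_coPi_of_mem S.root S.simple h)

theorem Setup.normal_injOn (S : Setup Φ Δ 𝒢 ε) {J K : Finset (Fin n)} (hJ : J ≠ Finset.univ)
    (hK : K ≠ Finset.univ) (h : normal Φ Δ 𝒢 ε J = normal Φ Δ 𝒢 ε K) : J = K := by
  ext i
  rw [← S.inner_normal_eq_zero hJ, h, S.inner_normal_eq_zero hK]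

theorem Setup.regular_normal_empty (S : Setup Φ Δ 𝒢 ε) :
    Regular Δ (normal Φ Δ 𝒢 ε ∅) := fun i =>
  lt_of_le_of_ne (S.dominant_normal S.empty_ne_univ i) fun h => by
    have := (S.inner_normal_eq_zero S.empty_ne_univ).1 h.symm
    simp at this

theorem normal_empty : normal Φ Δ 𝒢 ε ∅ = (term ε n)⁻¹ • delta Φ Δ := by
  rw [normal, level_empty, coPi_empty]

theorem Setup.map_normal_eq (S : Setup Φ Δ 𝒢 ε) {σ : V ≃ₗᵢ[ℝ] V} (hσ : σ ∈ coxeterGroup Φ)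
    {J : Finset (Fin n)} (hJ : J ≠ Finset.univ) (h : Dominant Δ (σ (normal Φ Δ 𝒢 ε J))) :
    σ (normal Φ Δ 𝒢 ε J) = normal Φ Δ 𝒢 ε J :=
  map_eq_of_dominant S.root S.simple (S.dominant_normal hJ) hσ h

/-- A point at which exactly the normals attached to `∅` and `{i}` are tight. -/
theorem Setup.exists_tight (S : Setup Φ Δ 𝒢 ε) (hn : 2 ≤ n) (i : Fin n) :
    ∃ u : V, Regular Δ u ∧ ⟪u, normal Φ Δ 𝒢 ε ∅⟫_ℝ = 1 ∧ ⟪u, normal Φ Δ 𝒢 ε {i}⟫_ℝ = 1 ∧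
      ∀ q ∈ normals Φ Δ 𝒢 ε, q ≠ normal Φ Δ 𝒢 ε ∅ → q ≠ normal Φ Δ 𝒢 ε {i} → ⟪u, q⟫_ℝ < 1 := by
  obtain ⟨u, hu, hδ, hi, hJ⟩ := S.exists_point hn i
  have heq : ∀ J : Finset (Fin n), J ≠ Finset.univ →
      ⟪u, coPi Φ Δ J⟫_ℝ = level Δ 𝒢 ε J → ⟪u, normal Φ Δ 𝒢 ε J⟫_ℝ = 1 := by
    intro J hJ h
    rw [normal, real_inner_smul_right, h, inv_mul_cancel₀ (S.level_pos hJ).ne']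
  have h1 := heq ∅ S.empty_ne_univ (by rw [coPi_empty, level_empty, hδ])
  have h2 := heq {i} (singleton_ne_univ hn i) hi
  refine ⟨u, hu, h1, h2, ?_⟩
  rintro _ ⟨σ, hσ, J, hJu, rfl⟩ hq1 hq2
  have hle := inner_map_le S.root S.simple (S.dominant_normal hJu) hu.dominant hσ
  rw [real_inner_comm, real_inner_comm u (normal Φ Δ 𝒢 ε J)] at hle
  have hor : ⟪u, normal Φ Δ 𝒢 ε J⟫_ℝ < 1 ∨ ⟪u, normal Φ Δ 𝒢 ε J⟫_ℝ = 1 ∧ (J = ∅ ∨ J = {i}) := by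
    by_cases h3 : J = ∅
    · exact Or.inr ⟨h3 ▸ h1, Or.inl h3⟩
    by_cases h4 : J = {i}
    · exact Or.inr ⟨h4 ▸ h2, Or.inr h4⟩
    · left
      rw [normal, real_inner_smul_right, inv_mul_lt_iff₀ (S.level_pos hJu), mul_one]
      exact hJ J hJu h3 h4
  rcases hor with h3 | ⟨h3, h4⟩
  · exact hle.trans_lt h3
  · refine lt_of_le_of_ne (hle.trans h3.le) fun h5 => ?_
    -- An image under `σ` that is tight at the regular point `u` is a case of equality in
    -- `inner_map_le`, so `σ` fixes the normal.
    have h6 := map_eq_of_inner_eq S.root S.simple (S.dominant_normal hJu) hu hσ (by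
      rw [real_inner_comm, h5, real_inner_comm, h3])
    rw [h6] at hq1 hq2
    rcases h4 with rfl | rfl
    · exact hq1 rfl
    · exact hq2 rfl

theorem Setup.preserves_iff (S : Setup Φ Δ 𝒢 ε) {g : V ≃ₗᵢ[ℝ] V} :
    Preserves (permutonestohedron Φ Δ 𝒢 ε) g ↔
      Preserves {x | ∀ q ∈ normals Φ Δ 𝒢 ε, ⟪x, q⟫_ℝ ≤ 1} g := by
  have : permutonestohedron Φ Δ 𝒢 ε = {x | ∀ q ∈ normals Φ Δ 𝒢 ε, ⟪x, q⟫_ℝ ≤ 1} :=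
    Set.ext fun x => S.mem_iff_normals
  rw [this]

theorem normal_singleton_ne (S : Setup Φ Δ 𝒢 ε) (hn : 2 ≤ n) (i : Fin n) :
    normal Φ Δ 𝒢 ε {i} ≠ normal Φ Δ 𝒢 ε ∅ := fun h => by
  have := S.normal_injOn (singleton_ne_univ hn i) S.empty_ne_univ h
  simp at this

/-- At the midpoint of the points attached to two different indices only the common tight normal,
that of `∅`, remains tight. -/
theorem Setup.map_normal_empty_mem (S : Setup Φ Δ 𝒢 ε) (hn : 2 ≤ n) {g : V ≃ₗᵢ[ℝ] V}
    (hg : Preserves (permutonestohedron Φ Δ 𝒢 ε) g) :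
    g (normal Φ Δ 𝒢 ε ∅) ∈ normals Φ Δ 𝒢 ε := by
  obtain ⟨u, -, hu1, hu2, hu3⟩ := S.exists_tight hn ⟨0, by omega⟩
  obtain ⟨w, -, hw1, hw2, hw3⟩ := S.exists_tight hn ⟨1, by omega⟩
  refine map_normal_mem S.finite_normals (S.preserves_iff.1 hg) (v := (1 / 2 : ℝ) • (u + w))
    (normal_mem_normals S.empty_ne_univ) ?_ fun q hq hne => ?_
  · rw [real_inner_smul_left, inner_add_left, hu1, hw1]; norm_num
  · rw [real_inner_smul_left, inner_add_left]
    by_cases h0 : q = normal Φ Δ 𝒢 ε {⟨0, by omega⟩}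
    · have h1 : q ≠ normal Φ Δ 𝒢 ε {⟨1, by omega⟩} := by
        rw [h0]
        intro h
        have := S.normal_injOn (singleton_ne_univ hn _) (singleton_ne_univ hn _) h
        simp at this
      have h2 := hw3 q hq hne h1
      rw [← h0] at hu2
      linarith
    · have h2 := hu3 q hq hne h0
      by_cases h1 : q = normal Φ Δ 𝒢 ε {⟨1, by omega⟩}
      · rw [← h1] at hw2
        linarith
      · have h3 := hw3 q hq hne h1
        linarith

/-- The reflection in `Δ i` fixes the normal of `{i}` and moves that of `∅`. At the midpoint of the
tight point and its reflection only the former stays tight. -/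
theorem Setup.map_normal_singleton_mem (S : Setup Φ Δ 𝒢 ε) (hn : 2 ≤ n) {g : V ≃ₗᵢ[ℝ] V}
    (hg : Preserves (permutonestohedron Φ Δ 𝒢 ε) g) (i : Fin n) :
    g (normal Φ Δ 𝒢 ε {i}) ∈ normals Φ Δ 𝒢 ε := by
  obtain ⟨u, -, hu1, hu2, hu3⟩ := S.exists_tight hn i
  have hfix : refl (Δ i) (normal Φ Δ 𝒢 ε {i}) = normal Φ Δ 𝒢 ε {i} :=
    refl_eq_self ((S.inner_normal_eq_zero (singleton_ne_univ hn i)).2 (by simp))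
  have hmem : ∀ q ∈ normals Φ Δ 𝒢 ε, refl (Δ i) q ∈ normals Φ Δ 𝒢 ε := by
    rintro _ ⟨σ, hσ, J, hJ, rfl⟩
    exact ⟨refl (Δ i) * σ, mul_mem (refl_mem_coxeterGroup (S.simple.mem i)) hσ, J, hJ, rfl⟩
  have hne0 : refl (Δ i) (normal Φ Δ 𝒢 ε ∅) ≠ normal Φ Δ 𝒢 ε ∅ := fun h =>
    (S.regular_normal_empty i).ne' (inner_eq_zero_of_refl_eq_self h)
  refine map_normal_mem S.finite_normals (S.preserves_iff.1 hg)
    (v := (1 / 2 : ℝ) • (u + refl (Δ i) u))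
    (normal_mem_normals (singleton_ne_univ hn i)) ?_ fun q hq hne => ?_
  · rw [real_inner_smul_left, inner_add_left, inner_refl_left, hfix, hu2]; norm_num
  · rw [real_inner_smul_left, inner_add_left, inner_refl_left]
    have hne' : refl (Δ i) q ≠ normal Φ Δ 𝒢 ε {i} := fun h => hne (by
      rw [← refl_refl (Δ i) q, h, hfix])
    by_cases h0 : q = normal Φ Δ 𝒢 ε ∅
    · have h1 := hu3 _ (hmem q hq) (h0 ▸ hne0) hne'
      rw [← h0] at hu1
      linarith
    · have h1 := hu3 q hq h0 hne
      by_cases h2 : refl (Δ i) q = normal Φ Δ 𝒢 ε ∅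
      · rw [h2, hu1]; linarith
      · have h3 := hu3 _ (hmem q hq) h2 hne'
        linarith

end Symmetries

/-! ### Symmetries fixing `δ`, and exclusion of the exceptional ones. -/

section MainArgument

set_option linter.unusedSectionVars false

variable {V : Type*} [NormedAddCommGroup V] [InnerProductSpace ℝ V] [FiniteDimensional ℝ V]
variable {n : ℕ} {Φ : Finset V} {Δ : Module.Basis (Fin n) ℝ V} {𝒢 : Set (Submodule ℝ V)}
variable {ε : Fin n → ℝ}

/-! ### Symmetries fixing the normal vector `δ` -/

theorem Setup.delta_eq_smul (S : Setup Φ Δ 𝒢 ε) :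
    delta Φ Δ = term ε n • normal Φ Δ 𝒢 ε ∅ := by
  rw [normal_empty, smul_smul, mul_inv_cancel₀ S.term_pos.ne', one_smul]

theorem Setup.level_singleton_pos (S : Setup Φ Δ 𝒢 ε) (hn : 2 ≤ n) :
    0 < term ε n - term ε 1 := by
  have := S.term_one_lt (k := n) (by omega) le_rfl
  linarith

theorem Setup.normal_singleton (S : Setup Φ Δ 𝒢 ε) (i : Fin n) :
    normal Φ Δ 𝒢 ε {i} =
      (term ε n - term ε 1)⁻¹ • (delta Φ Δ - (1 / 2 : ℝ) • Δ i) := by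
  rw [normal, S.level_singleton, coPi, simplePi_singleton S.root S.simple]

/-- Because `δ - π_J` is a projection of `δ`, the level can be read off from metric data of the
normals. -/
theorem Setup.inner_normal_normal_empty (S : Setup Φ Δ 𝒢 ε) {J : Finset (Fin n)}
    (hJ : J ≠ Finset.univ) : ⟪normal Φ Δ 𝒢 ε J, normal Φ Δ 𝒢 ε ∅⟫_ℝ * term ε n =
      ‖normal Φ Δ 𝒢 ε J‖ ^ 2 * level Δ 𝒢 ε J := by
  have h1 := S.level_pos hJ
  have h2 := S.term_pos
  rw [normal_empty, normal, real_inner_smul_left, real_inner_smul_right,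
    inner_coPi_delta S.root S.simple, norm_smul, mul_pow, Real.norm_of_nonneg (inv_nonneg.2 h1.le)]
  field_simp

/-- Subtracting the inequality of `{j}` from the equality of `δ` leaves `⟪x, Δ j⟫ ≥ 2 * term ε 1`.
-/
theorem Setup.regular_of_tight (S : Setup Φ Δ 𝒢 ε) (hn : 2 ≤ n) {x : V}
    (hx : x ∈ permutonestohedron Φ Δ 𝒢 ε) (h : ⟪x, normal Φ Δ 𝒢 ε ∅⟫_ℝ = 1) :
    Regular Δ x := fun j => by
  have h1 := S.mem_permutonestohedron_iff.1 hx 1 (one_mem _) {j} (singleton_ne_univ hn j)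
  rw [LinearIsometryEquiv.coe_one, id, S.level_singleton, coPi,
    simplePi_singleton S.root S.simple, inner_sub_right, real_inner_smul_right, S.delta_eq_smul,
    real_inner_smul_right, h] at h1
  have := S.term_one_pos
  linarith

theorem Setup.mem_of_regular_tight (S : Setup Φ Δ 𝒢 ε) (hn : 2 ≤ n) (i : Fin n) :
    ∃ u ∈ permutonestohedron Φ Δ 𝒢 ε, ⟪u, normal Φ Δ 𝒢 ε ∅⟫_ℝ = 1 ∧
      ⟪u, normal Φ Δ 𝒢 ε {i}⟫_ℝ = 1 := by
  obtain ⟨u, -, h1, h2, h3⟩ := S.exists_tight hn i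
  refine ⟨u, S.mem_iff_normals.2 fun q hq => ?_, h1, h2⟩
  by_cases hq0 : q = normal Φ Δ 𝒢 ε ∅
  · rw [hq0, h1]
  by_cases hqi : q = normal Φ Δ 𝒢 ε {i}
  · rw [hqi, h2]
  · exact (h3 q hq hq0 hqi).le

/-- A symmetry fixing the direction of `δ` permutes the simple roots. -/
theorem Setup.map_simple (S : Setup Φ Δ 𝒢 ε) (hn : 2 ≤ n) {g : V ≃ₗᵢ[ℝ] V}
    (hg : Preserves (permutonestohedron Φ Δ 𝒢 ε) g)
    (h0 : g (normal Φ Δ 𝒢 ε ∅) = normal Φ Δ 𝒢 ε ∅) (i : Fin n) : ∃ j, g (Δ i) = Δ j := by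
  obtain ⟨σ, hσ, J, hJ, hgJ⟩ := S.map_normal_singleton_mem hn hg i
  have hi := singleton_ne_univ hn i
  -- If `J = ∅`, the image of the point on the facets of `∅` and `{i}` is regular and tight for both
  -- `normal ∅` and `σ (normal ∅)`. These then coincide, which contradicts injectivity of `g`.
  by_cases hJe : J = ∅
  · exfalso
    subst hJe
    obtain ⟨u, huP, hu1, hu2⟩ := S.mem_of_regular_tight hn i
    have h1 : ⟪g u, normal Φ Δ 𝒢 ε ∅⟫_ℝ = 1 := by
      rw [← h0, LinearIsometryEquiv.inner_map_map, hu1]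
    have h2 : ⟪g u, σ (normal Φ Δ 𝒢 ε ∅)⟫_ℝ = 1 := by
      rw [← hgJ, LinearIsometryEquiv.inner_map_map, hu2]
    have hreg := S.regular_of_tight hn ((hg u).1 huP) h1
    have h3 := map_eq_of_inner_eq S.root S.simple (S.dominant_normal S.empty_ne_univ) hreg hσ
      (by rw [real_inner_comm, h2, real_inner_comm, h1])
    rw [h3, ← h0] at hgJ
    exact normal_singleton_ne S hn i (g.injective hgJ)
  · have hne := Finset.nonempty_iff_ne_empty.2 hJe
    have hnorm : ‖normal Φ Δ 𝒢 ε J‖ = ‖normal Φ Δ 𝒢 ε {i}‖ := by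
      rw [← LinearIsometryEquiv.norm_map σ, ← hgJ, LinearIsometryEquiv.norm_map]
    have hinner : ⟪σ (normal Φ Δ 𝒢 ε J), normal Φ Δ 𝒢 ε ∅⟫_ℝ =
        ⟪normal Φ Δ 𝒢 ε {i}, normal Φ Δ 𝒢 ε ∅⟫_ℝ := by
      rw [← hgJ]
      conv_lhs => rw [← h0]
      rw [LinearIsometryEquiv.inner_map_map]
    have hle := inner_map_le S.root S.simple (S.dominant_normal hJ)
      (S.regular_normal_empty).dominant hσ
    have e1 := S.inner_normal_normal_empty hJ
    have e2 := S.inner_normal_normal_empty hi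
    rw [hnorm] at e1
    have ha := S.term_pos
    have hpos : 0 < ‖normal Φ Δ 𝒢 ε {i}‖ ^ 2 := by
      have : normal Φ Δ 𝒢 ε {i} ≠ 0 := smul_ne_zero (inv_ne_zero (S.level_pos hi).ne')
        (coPi_ne_zero S.root S.simple hi)
      have := norm_pos_iff.2 this
      positivity
    -- Moving to the dominant representative can only increase the pairing with `normal ∅`. As the
    -- norms agree, the level can only increase too, so the offset of `J` is at most `ε_1`.
    have hlev : level Δ 𝒢 ε {i} ≤ level Δ 𝒢 ε J := by
      refine le_of_mul_le_mul_left ?_ hpos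
      rw [← e1, ← e2, ← hinner]
      gcongr
    have hoff : offset Δ 𝒢 ε J ≤ term ε 1 := by
      rw [level, level, S.offset_singleton] at hlev
      linarith
    obtain ⟨j, rfl⟩ := S.offset_le hne hoff
    have hl : level Δ 𝒢 ε {j} = level Δ 𝒢 ε {i} := by
      rw [S.level_singleton, S.level_singleton]
    have h4 : ⟪σ (normal Φ Δ 𝒢 ε {j}), normal Φ Δ 𝒢 ε ∅⟫_ℝ =
        ⟪normal Φ Δ 𝒢 ε {j}, normal Φ Δ 𝒢 ε ∅⟫_ℝ := by
      apply mul_right_cancel₀ ha.ne'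
      rw [hinner, e1, e2, hl]
    have h5 := map_eq_of_inner_eq S.root S.simple (S.dominant_normal hJ)
      S.regular_normal_empty hσ h4
    refine ⟨j, ?_⟩
    have hδ : g (delta Φ Δ) = delta Φ Δ := by
      rw [S.delta_eq_smul, map_smul, h0]
    rw [h5, S.normal_singleton, S.normal_singleton, map_smul] at hgJ
    have h6 := smul_right_injective V (inv_ne_zero (S.level_singleton_pos hn).ne') hgJ
    rw [map_sub, map_smul, hδ] at h6
    exact smul_right_injective V (by norm_num : (1 / 2 : ℝ) ≠ 0) (sub_right_injective h6)

theorem Setup.image_eq (S : Setup Φ Δ 𝒢 ε) (hn : 2 ≤ n) {g : V ≃ₗᵢ[ℝ] V}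
    (hg : Preserves (permutonestohedron Φ Δ 𝒢 ε) g)
    (h0 : g (normal Φ Δ 𝒢 ε ∅) = normal Φ Δ 𝒢 ε ∅) : g '' (Φ : Set V) = Φ := by
  choose π hπ using S.map_simple hn hg h0
  exact image_eq_of_perm S.root S.simple g π hπ

/-- A symmetry which is not an automorphism of the root system yields one that maps the normal
`δ` to the normal attached to a nonempty set. -/
theorem Setup.exists_exceptional (S : Setup Φ Δ 𝒢 ε) (hn : 2 ≤ n) (hnorm : IsNormalized Φ)
    (hinv : IsAutInvariant Φ 𝒢)
    (h : rootAut Φ ≠ isometryGroup (permutonestohedron Φ Δ 𝒢 ε)) :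
    ∃ g : V ≃ₗᵢ[ℝ] V, Preserves (permutonestohedron Φ Δ 𝒢 ε) g ∧
      ∃ B : Finset (Fin n), B ≠ Finset.univ ∧ B ≠ ∅ ∧
        g (normal Φ Δ 𝒢 ε ∅) = normal Φ Δ 𝒢 ε B := by
  obtain ⟨g, hg, hg'⟩ := SetLike.exists_of_lt (lt_of_le_of_ne (S.rootAut_le hnorm hinv) h)
  obtain ⟨f, hfg, hf⟩ := S.exists_linearIsometry hg
  obtain ⟨σ, hσ, B, hB, hfB⟩ := S.map_normal_empty_mem hn hf
  have hpres := (S.preserves_of_coxeterGroup (inv_mem hσ)).mul hf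
  have happ : (σ⁻¹ * f) (normal Φ Δ 𝒢 ε ∅) = normal Φ Δ 𝒢 ε B := by
    simp [LinearIsometryEquiv.coe_mul, LinearIsometryEquiv.coe_inv, hfB]
  refine ⟨σ⁻¹ * f, hpres, B, hB, ?_, happ⟩
  rintro rfl
  have him := S.image_eq hn hpres happ
  refine hg' (mem_rootAut_of_image_eq ?_ hfg)
  apply Set.eq_of_subset_of_ncard_le
  · rintro _ ⟨β, hβ, rfl⟩
    have h1 : (σ⁻¹ * f) β ∈ (Φ : Set V) := by rw [← him]; exact ⟨β, hβ, rfl⟩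
    have h2 := map_mem_of_mem_coxeterGroup S.root hσ _ h1
    simpa [LinearIsometryEquiv.coe_mul, LinearIsometryEquiv.coe_inv] using h2
  · rw [Set.ncard_image_of_injective _ f.injective]
  · exact Φ.finite_toSet

/-! ### Exceptional symmetries do not exist in dimension at least three -/

theorem repr_simple_eq (i k : Fin n) :
    Δ.repr (Δ i) k = 0 ∨ Δ.repr (Δ i) k = 1 := by
  simp only [Module.Basis.repr_self, Finsupp.single_apply]
  split_ifs <;> simp

/-- A reflection permuting the basis is the reflection in a difference of basis vectors. -/
theorem exists_difference {β : V} (hβ : β ≠ 0) (h : ∀ i, ∃ j, refl β (Δ i) = Δ j) :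
    ∃ (p q : Fin n) (c : ℝ), 0 < c ∧ p ≠ q ∧ β = c • (Δ p - Δ q) ∧ 0 < ⟪Δ p, β⟫_ℝ ∧
      ⟪Δ q, β⟫_ℝ < 0 ∧ ‖Δ p‖ = ‖Δ q‖ ∧ ∀ i, i ≠ p → i ≠ q → ⟪Δ i, β⟫_ℝ = 0 := by
  choose ρ hρ using h
  have hβ0 : 0 < ‖β‖ := norm_pos_iff.2 hβ
  obtain ⟨p, q, c, hc, hpq⟩ : ∃ (p q : Fin n) (c : ℝ), 0 < c ∧ β = c • (Δ p - Δ q) := by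
    obtain ⟨i, hi⟩ : ∃ i, ⟪Δ i, β⟫_ℝ ≠ 0 := by
      by_contra! hc
      exact hβ (eq_zero_of_inner_simple (Δ := Δ) fun i => by rw [real_inner_comm, hc])
    have h1 := hρ i
    rw [refl_apply] at h1
    set d := 2 * ⟪Δ i, β⟫_ℝ / ‖β‖ ^ 2 with hd
    have hd0 : d ≠ 0 := by positivity
    have h2 : d • β = Δ i - Δ (ρ i) := by rw [← h1]; abel
    have h3 : β = d⁻¹ • (Δ i - Δ (ρ i)) := by rw [← h2, smul_smul, inv_mul_cancel₀ hd0, one_smul]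
    rcases lt_or_gt_of_ne hd0 with hneg | hpos
    · refine ⟨ρ i, i, -d⁻¹, by simpa using hneg, ?_⟩
      rw [h3]; module
    · exact ⟨i, ρ i, d⁻¹, by positivity, h3⟩
  have hne : p ≠ q := by
    rintro rfl
    rw [sub_self, smul_zero] at hpq
    exact hβ hpq
  have hcoord : ∀ i k, Δ.repr (Δ i) k - 2 * ⟪Δ i, β⟫_ℝ / ‖β‖ ^ 2 * Δ.repr β k = 0 ∨
      Δ.repr (Δ i) k - 2 * ⟪Δ i, β⟫_ℝ / ‖β‖ ^ 2 * Δ.repr β k = 1 := by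
    intro i k
    have h1 := hρ i
    rw [refl_apply] at h1
    have h2 := repr_simple_eq (Δ := Δ) (ρ i) k
    rw [← h1] at h2
    simpa using h2
  have hβp : Δ.repr β p = c := by rw [hpq]; simp [hne]
  have hβq : Δ.repr β q = -c := by rw [hpq]; simp [hne.symm]
  have hzero : ∀ i, 2 * ⟪Δ i, β⟫_ℝ / ‖β‖ ^ 2 * c = 0 → ⟪Δ i, β⟫_ℝ = 0 := by
    intro i h0
    rw [mul_eq_zero, div_eq_zero_iff] at h0
    rcases h0 with (h0 | h0) | h0
    · linarith
    · exact absurd h0 (by positivity)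
    · exact absurd h0 hc.ne'
  -- The two terms differ by `2`. The first and minus the second are coordinates of reflected basis
  -- vectors, hence `0` or `1`, so both equal `1`: the reflection swaps `Δ p` and `Δ q`.
  have hsum : 2 * ⟪Δ p, β⟫_ℝ / ‖β‖ ^ 2 * c - 2 * ⟪Δ q, β⟫_ℝ / ‖β‖ ^ 2 * c = 2 := by
    have h1 : ‖β‖ ^ 2 = c * (⟪Δ p, β⟫_ℝ - ⟪Δ q, β⟫_ℝ) := by
      rw [← inner_sub_left, ← real_inner_smul_left, ← hpq, real_inner_self_eq_norm_sq]
    have h2 : ‖β‖ ^ 2 ≠ 0 := by positivity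
    field_simp
    linarith
  have hp := hcoord p q
  have hq := hcoord q p
  rw [hβq, Module.Basis.repr_self, Finsupp.single_apply, if_neg hne] at hp
  rw [hβp, Module.Basis.repr_self, Finsupp.single_apply, if_neg hne.symm] at hq
  have hp1 : 2 * ⟪Δ p, β⟫_ℝ / ‖β‖ ^ 2 * c = 1 := by
    rcases hp with hp | hp <;> rcases hq with hq | hq <;> linarith
  have hq1 : 2 * ⟪Δ q, β⟫_ℝ / ‖β‖ ^ 2 * c = -1 := by linarith
  refine ⟨p, q, c, hc, hne, hpq, ?_, ?_, ?_, ?_⟩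
  · by_contra! hle
    have : 2 * ⟪Δ p, β⟫_ℝ / ‖β‖ ^ 2 * c ≤ 0 :=
      mul_nonpos_of_nonpos_of_nonneg (div_nonpos_of_nonpos_of_nonneg (by linarith) (by positivity))
        hc.le
    linarith
  · by_contra! hle
    have : 0 ≤ 2 * ⟪Δ q, β⟫_ℝ / ‖β‖ ^ 2 * c := by positivity
    linarith
  · have h1 : refl β (Δ p) = Δ q := by
      rw [refl_apply]
      nth_rewrite 3 [hpq]
      rw [smul_smul, hp1, one_smul]
      abel
    rw [← h1, LinearIsometryEquiv.norm_map]
  · intro i hip hiq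
    have h1 := hcoord i p
    have h2 := hcoord i q
    rw [hβp, Module.Basis.repr_self, Finsupp.single_apply, if_neg hip] at h1
    rw [hβq, Module.Basis.repr_self, Finsupp.single_apply, if_neg hiq] at h2
    apply hzero
    rcases h1 with h1 | h1 <;> rcases h2 with h2 | h2 <;> linarith

/-- The reflection in `g (Δ k)` is a symmetry and fixes `normal ∅`, because `Δ k` is orthogonal to
`normal B'`. So it permutes the simple roots and `exists_difference` applies. The pairing of `π_B`
with the resulting difference is negative, which places `q` in `B` and `p` outside. That `B` omits
only `p` follows by comparing coordinates of the image of `normal {k}`. -/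
theorem Setup.exists_simple_difference (S : Setup Φ Δ 𝒢 ε) (hn : 2 ≤ n) {g : V ≃ₗᵢ[ℝ] V}
    (hg : Preserves (permutonestohedron Φ Δ 𝒢 ε) g) {B B' : Finset (Fin n)}
    (hB : B ≠ Finset.univ) (hB' : B' ≠ Finset.univ)
    (h1 : g (normal Φ Δ 𝒢 ε ∅) = normal Φ Δ 𝒢 ε B)
    (h2 : g (normal Φ Δ 𝒢 ε B') = normal Φ Δ 𝒢 ε ∅) {k : Fin n} (hk : k ∈ B') :
    ∃ (p q : Fin n) (c : ℝ), 0 < c ∧ q ∈ B ∧ p ∉ B ∧ g (Δ k) = c • (Δ p - Δ q) ∧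
      0 < ⟪Δ p, g (Δ k)⟫_ℝ ∧ (∀ i, i ≠ p → i ≠ q → ⟪Δ i, g (Δ k)⟫_ℝ = 0) ∧
      ∀ i, i ∉ B → i = p := by
  set β := g (Δ k) with hβ
  have hβ0 : β ≠ 0 := fun h => Δ.ne_zero k (by simpa [hβ] using h)
  have horth : ⟪normal Φ Δ 𝒢 ε ∅, β⟫_ℝ = 0 := by
    rw [← h2, hβ, LinearIsometryEquiv.inner_map_map]
    exact (S.inner_normal_eq_zero hB').2 hk
  have hpres : Preserves (permutonestohedron Φ Δ 𝒢 ε) (refl β) := by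
    rw [hβ, ← conj_refl]
    exact (hg.mul (S.preserves_of_coxeterGroup (refl_mem_coxeterGroup (S.simple.mem k)))).mul hg.inv
  obtain ⟨p, q, c, hc, hpq, hβe, hpβ, hqβ, hnormpq, hoth⟩ :=
    exists_difference (Δ := Δ) hβ0 (S.map_simple hn hpres (refl_eq_self horth))
  have hδ : ⟪delta Φ Δ, β⟫_ℝ = 0 := by
    rw [S.delta_eq_smul, real_inner_smul_left, horth, mul_zero]
  have hBpos : 0 < ⟪normal Φ Δ 𝒢 ε B, β⟫_ℝ := by
    rw [← h1, hβ, LinearIsometryEquiv.inner_map_map]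
    exact S.regular_normal_empty k
  have hπneg : ⟪simplePi Φ Δ B, β⟫_ℝ < 0 := by
    rw [normal, real_inner_smul_left, coPi, inner_sub_left, hδ, zero_sub] at hBpos
    have := S.level_pos hB
    have h3 := (pos_iff_pos_of_mul_pos hBpos).1 (inv_pos.2 this)
    linarith
  have hsum : ⟪simplePi Φ Δ B, β⟫_ℝ = ∑ i ∈ B, coef Φ Δ B i * ⟪Δ i, β⟫_ℝ := by
    rw [real_inner_comm, inner_simplePi_eq_sum]
    exact Finset.sum_congr rfl fun i _ => by rw [real_inner_comm]
  have hqB : q ∈ B := by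
    by_contra hqB
    rw [hsum] at hπneg
    refine absurd hπneg (not_lt.2 (Finset.sum_nonneg fun i hi => ?_))
    refine mul_nonneg (coef_nonneg S.root S.simple _ _) ?_
    by_cases hip : i = p
    · rw [hip]; exact hpβ.le
    · rw [hoth i hip fun h => hqB (h ▸ hi)]
  -- With both indices in `B`, the equal lengths of `Δ p` and `Δ q` would make the pairing of `π_B`
  -- with `β` zero.
  have hpB : p ∉ B := by
    intro hpB
    rw [hβe, real_inner_smul_right, inner_sub_right, inner_simplePi S.root S.simple hpB,
      inner_simplePi S.root S.simple hqB, hnormpq, sub_self, mul_zero] at hπneg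
    exact lt_irrefl _ hπneg
  refine ⟨p, q, c, hc, hqB, hpB, hβe, hpβ, hoth, ?_⟩
  -- the image of the normal attached to `{k}` is dominant
  set y := g (normal Φ Δ 𝒢 ε {k}) with hy
  set b := term ε n - term ε 1 with hb
  have hb0 : 0 < b := S.level_singleton_pos hn
  have ha := S.term_pos
  have hye : y = b⁻¹ • (term ε n • normal Φ Δ 𝒢 ε B - (1 / 2 : ℝ) • β) := by
    rw [hy, S.normal_singleton, map_smul, map_sub, map_smul, S.delta_eq_smul, map_smul, h1]
  have hyin : ∀ i, ⟪y, Δ i⟫_ℝ =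
      b⁻¹ * (term ε n * ⟪normal Φ Δ 𝒢 ε B, Δ i⟫_ℝ - 1 / 2 * ⟪Δ i, β⟫_ℝ) := by
    intro i
    rw [hye, real_inner_smul_left, inner_sub_left, real_inner_smul_left, real_inner_smul_left,
      real_inner_comm β]
  have hyq : 0 < ⟪y, Δ q⟫_ℝ := by
    rw [hyin, (S.inner_normal_eq_zero hB).2 hqB, mul_zero, zero_sub]
    refine mul_pos (inv_pos.2 hb0) ?_
    linarith
  have hyp : 0 < ⟪y, Δ p⟫_ℝ := by
    have h3 : ⟪y, β⟫_ℝ = 0 := by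
      rw [hy, hβ, LinearIsometryEquiv.inner_map_map]
      exact (S.inner_normal_eq_zero (singleton_ne_univ hn k)).2 (by simp)
    rw [hβe, real_inner_smul_right, mul_eq_zero, inner_sub_right] at h3
    rcases h3 with h3 | h3
    · exact absurd h3 hc.ne'
    · linarith
  have hydom : Dominant Δ y := by
    intro i
    by_cases hip : i = p
    · rw [hip]; exact hyp.le
    by_cases hiq : i = q
    · rw [hiq]; exact hyq.le
    · rw [hyin, hoth i hip hiq, mul_zero, sub_zero]
      have := S.dominant_normal hB i
      positivity
  obtain ⟨σ, hσ, J, hJ, hyJ⟩ := S.map_normal_singleton_mem hn hg k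
  rw [← hy] at hyJ
  rw [S.map_normal_eq hσ hJ (hyJ ▸ hydom)] at hyJ
  have hJmem : ∀ i, 0 < ⟪y, Δ i⟫_ℝ → i ∉ J := by
    intro i hi hiJ
    rw [hyJ, (S.inner_normal_eq_zero hJ).2 hiJ] at hi
    exact lt_irrefl _ hi
  have hrepr : ∀ (K : Finset (Fin n)) (i : Fin n), i ∉ K →
      Δ.repr (normal Φ Δ 𝒢 ε K) i = (level Δ 𝒢 ε K)⁻¹ * coef Φ Δ Finset.univ i := by
    intro K i hi
    rw [normal, map_smul, Finsupp.smul_apply, repr_coPi, coef_eq_zero hi, sub_zero, smul_eq_mul]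
  have hyrepr : ∀ i, Δ.repr y i =
      b⁻¹ * (term ε n * Δ.repr (normal Φ Δ 𝒢 ε B) i - 1 / 2 * Δ.repr β i) := by
    intro i
    rw [hye]; simp
  -- Outside `J` the coordinates of `normal J` are proportional to those of `δ`, and likewise for
  -- `B`. But `y = normal J` differs from a multiple of `normal B` by a multiple of `β`, which is
  -- nonzero at `p` and zero at any other index outside `B`.
  intro i hiB
  by_contra hip
  have hiq : i ≠ q := fun h => hiB (h ▸ hqB)
  have hiJ : i ∉ J := hJmem i (by
    rw [hyin, hoth i hip hiq, mul_zero, sub_zero]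
    have h3 := S.dominant_normal hB i
    have h4 : ⟪normal Φ Δ 𝒢 ε B, Δ i⟫_ℝ ≠ 0 := fun h => hiB ((S.inner_normal_eq_zero hB).1 h)
    have h5 := lt_of_le_of_ne h3 h4.symm
    positivity)
  have e1 := hyrepr i
  have e2 := hyrepr p
  have hβi : Δ.repr β i = 0 := by
    rw [hβe]; simp [Ne.symm hip, Ne.symm hiq]
  have hβp : Δ.repr β p = c := by
    rw [hβe]; simp [hpq]
  rw [hyJ, hrepr J i hiJ, hrepr B i hiB, hβi, mul_zero, sub_zero] at e1
  rw [hyJ, hrepr J p (hJmem p hyp), hrepr B p hpB, hβp] at e2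
  have hi0 := coef_pos S.root S.simple (Finset.mem_univ i)
  have e3 : (level Δ 𝒢 ε J)⁻¹ = b⁻¹ * (term ε n * (level Δ 𝒢 ε B)⁻¹) := by
    apply mul_right_cancel₀ hi0.ne'
    rw [e1]; ring
  rw [e3] at e2
  have e4 : b⁻¹ * (1 / 2 * c) = 0 := by linear_combination e2
  have e5 : 0 < b⁻¹ * (1 / 2 * c) := by positivity
  exact e5.ne' e4

/-- Choose the exceptional symmetry whose `normal B` has the largest pairing with `normal ∅`. This
makes the preimage of `normal ∅` dominant, say `normal B'`. Applied to the inverse,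
`exists_simple_difference` shows that `B'` omits at most one index, so it has two elements because
`n ≥ 3`. Their images cannot form an obtuse angle. -/
theorem Setup.no_exceptional (S : Setup Φ Δ 𝒢 ε) (hn : 3 ≤ n) {g : V ≃ₗᵢ[ℝ] V}
    (hg : Preserves (permutonestohedron Φ Δ 𝒢 ε) g) {B : Finset (Fin n)}
    (hB : B ≠ Finset.univ) (hB0 : B ≠ ∅)
    (h : g (normal Φ Δ 𝒢 ε ∅) = normal Φ Δ 𝒢 ε B) : False := by
  have hn2 : 2 ≤ n := by omega
  have hfin : {B : Finset (Fin n) | B ≠ Finset.univ ∧ B ≠ ∅ ∧ ∃ g : V ≃ₗᵢ[ℝ] V,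
      Preserves (permutonestohedron Φ Δ 𝒢 ε) g ∧
        g (normal Φ Δ 𝒢 ε ∅) = normal Φ Δ 𝒢 ε B}.Finite := Set.toFinite _
  obtain ⟨B, ⟨hB, hB0, g, hg, h⟩, hmax⟩ := Set.exists_max_image _
    (fun B => ⟪normal Φ Δ 𝒢 ε B, normal Φ Δ 𝒢 ε ∅⟫_ℝ) hfin ⟨B, hB, hB0, g, hg, h⟩
  have hp0dom := S.regular_normal_empty.dominant
  have hdom : Dominant Δ (g⁻¹ (normal Φ Δ 𝒢 ε ∅)) := by
    intro k
    rw [← LinearIsometryEquiv.inner_map_map g]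
    rw [LinearIsometryEquiv.coe_inv, g.apply_symm_apply]
    by_contra! hneg
    have hpres := hg.mul (S.preserves_of_coxeterGroup (refl_mem_coxeterGroup (S.simple.mem k)))
    obtain ⟨σ, hσ, J, hJ, hz⟩ := S.map_normal_empty_mem hn2 hpres
    have hz' : (g * refl (Δ k)) (normal Φ Δ 𝒢 ε ∅) = normal Φ Δ 𝒢 ε B -
        (2 * ⟪normal Φ Δ 𝒢 ε ∅, Δ k⟫_ℝ / ‖Δ k‖ ^ 2) • g (Δ k) := by
      rw [LinearIsometryEquiv.coe_mul, Function.comp_apply, refl_apply, map_sub, map_smul, h]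
    have hcloser : ⟪normal Φ Δ 𝒢 ε B, normal Φ Δ 𝒢 ε ∅⟫_ℝ <
        ⟪σ (normal Φ Δ 𝒢 ε J), normal Φ Δ 𝒢 ε ∅⟫_ℝ := by
      rw [← hz, hz', inner_sub_left, real_inner_smul_left, real_inner_comm _ (g (Δ k))]
      have h3 := S.regular_normal_empty k
      have h4 := norm_simple_pos (Δ := Δ) k
      have h5 : 2 * ⟪normal Φ Δ 𝒢 ε ∅, Δ k⟫_ℝ / ‖Δ k‖ ^ 2 *
          ⟪normal Φ Δ 𝒢 ε ∅, g (Δ k)⟫_ℝ < 0 := mul_neg_of_pos_of_neg (by positivity) hneg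
      linarith
    have hpres' := (S.preserves_of_coxeterGroup (inv_mem hσ)).mul hpres
    have happ : (σ⁻¹ * (g * refl (Δ k))) (normal Φ Δ 𝒢 ε ∅) = normal Φ Δ 𝒢 ε J := by
      rw [LinearIsometryEquiv.coe_mul, Function.comp_apply, hz, LinearIsometryEquiv.coe_inv,
        σ.symm_apply_apply]
    -- If `J = ∅`, the modified symmetry permutes the simple roots, so `g (normal ∅)` lies in the
    -- Coxeter orbit of `normal ∅` and uniqueness of dominant vectors gives `B = ∅`. Otherwise `J`
    -- contradicts the maximality of `B`.
    by_cases hJ0 : J = ∅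
    · subst hJ0
      obtain ⟨l, hl⟩ := S.map_simple hn2 hpres' happ k
      set τ := σ⁻¹ * (g * refl (Δ k)) with hτ
      have hgτ : g = σ * (τ * refl (Δ k)) := by
        rw [hτ, mul_assoc, mul_assoc, refl_mul_self, mul_one, mul_inv_cancel_left]
      have h3 : g (normal Φ Δ 𝒢 ε ∅) = (σ * refl (Δ l)) (normal Φ Δ 𝒢 ε ∅) := by
        rw [hgτ, refl_mul_eq, hl, ← mul_assoc, LinearIsometryEquiv.coe_mul, Function.comp_apply,
          happ]
      rw [h] at h3
      have h4 := S.map_normal_eq (mul_mem hσ (refl_mem_coxeterGroup (S.simple.mem l)))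
        S.empty_ne_univ (h3 ▸ S.dominant_normal hB)
      rw [h4] at h3
      exact hB0 (S.normal_injOn hB S.empty_ne_univ h3)
    · have h3 := hmax J ⟨hJ, hJ0, _, hpres', happ⟩
      have h4 := inner_map_le S.root S.simple (S.dominant_normal hJ) hp0dom hσ
      linarith
  obtain ⟨σ, hσ, B', hB', hgB'⟩ := S.map_normal_empty_mem hn2 hg.inv
  rw [S.map_normal_eq hσ hB' (hgB' ▸ hdom)] at hgB'
  have hgB : g (normal Φ Δ 𝒢 ε B') = normal Φ Δ 𝒢 ε ∅ := by
    rw [← hgB', LinearIsometryEquiv.coe_inv, g.apply_symm_apply]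
  have hginv : g⁻¹ (normal Φ Δ 𝒢 ε B) = normal Φ Δ 𝒢 ε ∅ := by
    rw [← h, LinearIsometryEquiv.coe_inv, g.symm_apply_apply]
  obtain ⟨k₀, hk₀⟩ := Finset.nonempty_iff_ne_empty.2 hB0
  obtain ⟨p', -, -, -, -, -, -, -, -, hp'⟩ :=
    S.exists_simple_difference hn2 hg.inv hB' hB hgB' hginv hk₀
  have hcard : 1 < B'.card := by
    have h3 : B'ᶜ ⊆ {p'} := fun i hi => by
      rw [Finset.mem_compl] at hi
      rw [Finset.mem_singleton]
      exact hp' i hi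
    have h4 := Finset.card_le_card h3
    rw [Finset.card_compl, Fintype.card_fin, Finset.card_singleton] at h4
    omega
  obtain ⟨k, hk, l, hl, hkl⟩ := Finset.one_lt_card.1 hcard
  obtain ⟨p, q, c, hc, hqB, hpB, hgk, hpk, hoth, hcompl⟩ :=
    S.exists_simple_difference hn2 hg hB hB' h hgB hk
  obtain ⟨p₂, q₂, c₂, hc₂, hqB₂, hpB₂, hgl, -, -, -⟩ :=
    S.exists_simple_difference hn2 hg hB hB' h hgB hl
  rw [hcompl p₂ hpB₂] at hgl
  -- Equal `q` would make two simple roots proportional. Distinct ones give the images a positive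
  -- inner product.
  by_cases hq : q₂ = q
  · rw [hq] at hgl
    have h3 : g (c₂ • Δ k) = g (c • Δ l) := by
      rw [map_smul, map_smul, hgk, hgl, smul_smul, smul_smul, mul_comm]
    have h4 := congrArg (fun v => Δ.repr v k) (g.injective h3)
    simp [hkl.symm] at h4
    exact hc₂.ne' h4
  · have h3 : ⟪g (Δ l), g (Δ k)⟫_ℝ = c₂ * ⟪Δ p, g (Δ k)⟫_ℝ := by
      conv_lhs => rw [hgl]
      rw [real_inner_smul_left, inner_sub_left, hoth q₂ (fun e => hpB (e ▸ hqB₂)) hq, sub_zero]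
    rw [LinearIsometryEquiv.inner_map_map] at h3
    have h4 := S.simple.inner_nonpos S.root hkl.symm
    have h5 := mul_pos hc₂ hpk
    linarith

end MainArgument

/-! ### Counting exceptional and suitable lists. -/

section Counting

set_option linter.unusedSectionVars false

variable {V : Type*} [NormedAddCommGroup V] [InnerProductSpace ℝ V] [FiniteDimensional ℝ V]
variable {n : ℕ} {Φ : Finset V} {Δ : Module.Basis (Fin n) ℝ V} {𝒢 : Set (Submodule ℝ V)}
variable {ε : Fin n → ℝ}

/-! ### Finiteness of the exceptional lists -/

/-- On the line, every linear isometry preserves the root system. -/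
theorem image_eq_of_dim_one {Δ : Module.Basis (Fin 1) ℝ V} (hΦ : IsRootSystem Φ)
    (f : V ≃ₗᵢ[ℝ] V) : f '' (Φ : Set V) = Φ := by
  obtain ⟨r, hr⟩ : ∃ r : ℝ, f (Δ 0) = r • Δ 0 := by
    refine ⟨Δ.repr (f (Δ 0)) 0, ?_⟩
    conv_lhs => rw [← Δ.sum_repr (f (Δ 0))]
    simp
  have hfx : ∀ x, f x = r • x := fun x => by
    rw [← Δ.sum_repr x]
    simp [hr, smul_smul, mul_comm]
  have hr1 : |r| = 1 := by
    have h1 : ‖f (Δ 0)‖ = ‖Δ 0‖ := f.norm_map _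
    rw [hr, norm_smul, Real.norm_eq_abs] at h1
    exact mul_right_cancel₀ (norm_simple_pos (Δ := Δ) 0).ne' (by rw [h1, one_mul])
  apply Set.eq_of_subset_of_ncard_le
  · rintro _ ⟨β, hβ, rfl⟩
    rw [hfx]
    rcases (abs_eq zero_le_one).1 hr1 with h | h
    · rwa [h, one_smul]
    · rw [h, neg_smul, one_smul]
      exact hΦ.neg_mem hβ
  · rw [Set.ncard_image_of_injective _ f.injective]
  · exact Φ.finite_toSet

theorem Setup.rootAut_eq_of_dim_one (S : Setup Φ Δ 𝒢 ε) (hn : n = 1) (hnorm : IsNormalized Φ)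
    (hinv : IsAutInvariant Φ 𝒢) :
    rootAut Φ = isometryGroup (permutonestohedron Φ Δ 𝒢 ε) := by
  refine le_antisymm (S.rootAut_le hnorm hinv) fun g hg => ?_
  obtain ⟨f, hfg, -⟩ := S.exists_linearIsometry hg
  subst hn
  exact mem_rootAut_of_image_eq (image_eq_of_dim_one (Δ := Δ) S.root f) hfg

theorem eq_of_term_eq {ε' : Fin n → ℝ} (h : ∀ k, 1 ≤ k → k ≤ n → term ε k = term ε' k) :
    ε = ε' := by
  funext i
  have := h (i + 1) (by omega) (by omega)
  rwa [term_eq ⟨by omega, by omega⟩, term_eq ⟨by omega, by omega⟩] at this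

/-- In the plane, exceptional symmetries determine the first term of the list. -/
theorem Setup.term_one_eq (S : Setup Φ Δ 𝒢 ε) (hn : n = 2) {g : V ≃ₗᵢ[ℝ] V}
    {B : Finset (Fin n)} (hB : B ≠ Finset.univ) (hB0 : B ≠ ∅)
    (h : g (normal Φ Δ 𝒢 ε ∅) = normal Φ Δ 𝒢 ε B) :
    ∃ j, term ε 1 = term ε n - ‖coPi Φ Δ {j}‖ * term ε n / ‖delta Φ Δ‖ := by
  have h1 : B.card = 1 := by
    have h2 := Finset.card_pos.2 (Finset.nonempty_iff_ne_empty.2 hB0)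
    have h3 := (Finset.card_lt_iff_ne_univ B).2 hB
    rw [Fintype.card_fin] at h3
    omega
  obtain ⟨j, rfl⟩ := Finset.card_eq_one.1 h1
  refine ⟨j, ?_⟩
  have ha := S.term_pos
  have hb := S.level_pos hB
  have hδ : 0 < ‖delta Φ Δ‖ := by
    have := coPi_ne_zero S.root S.simple S.empty_ne_univ
    rw [coPi_empty] at this
    exact norm_pos_iff.2 this
  -- Since `g` preserves norms, `‖δ‖ / a = ‖coPi {j}‖ / (a - ε_1)`.
  have h2 : ‖normal Φ Δ 𝒢 ε ∅‖ = ‖normal Φ Δ 𝒢 ε {j}‖ := by rw [← h, g.norm_map]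
  rw [normal_empty, normal, norm_smul, norm_smul, Real.norm_of_nonneg (inv_pos.2 ha).le,
    Real.norm_of_nonneg (inv_pos.2 hb).le] at h2
  have h3 : level Δ 𝒢 ε {j} * ‖delta Φ Δ‖ = ‖coPi Φ Δ {j}‖ * term ε n := by
    field_simp at h2
    linarith
  have h4 : level Δ 𝒢 ε {j} = ‖coPi Φ Δ {j}‖ * term ε n / ‖delta Φ Δ‖ := by
    rw [eq_div_iff hδ.ne', h3]
  rw [S.level_singleton] at h4
  linarith

theorem finite_exceptional (hn : 1 ≤ n) (hΦ : IsRootSystem Φ) (hnorm : IsNormalized Φ)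
    (hΔ : IsSimpleBasis Φ Δ) (h𝒢 : IsBuildingSet Φ 𝒢) (htop : ⊤ ∈ 𝒢) (hinv : IsAutInvariant Φ 𝒢)
    (a : ℝ) : {ε : Fin n → ℝ | IsSuitable Φ Δ 𝒢 ε ∧ term ε n = a ∧
      rootAut Φ ≠ isometryGroup (permutonestohedron Φ Δ 𝒢 ε)}.Finite := by
  rcases (by omega : n = 1 ∨ n = 2 ∨ 3 ≤ n) with h1 | h2 | h3
  · refine Set.finite_empty.subset ?_
    rintro ε ⟨hε, -, hne⟩
    exact hne (Setup.rootAut_eq_of_dim_one ⟨hn, hΦ, hΔ, h𝒢, htop, hε⟩ h1 hnorm hinv)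
  -- In the plane the last term is fixed, so a list is determined by its first term, which takes at
  -- most one value for each simple root.
  · refine Set.Finite.of_finite_image (f := fun ε => term ε 1) ?_ ?_
    · refine (Set.finite_range fun j : Fin n =>
        a - ‖coPi Φ Δ {j}‖ * a / ‖delta Φ Δ‖).subset ?_
      rintro _ ⟨ε, ⟨hε, rfl, hne⟩, rfl⟩
      have S : Setup Φ Δ 𝒢 ε := ⟨hn, hΦ, hΔ, h𝒢, htop, hε⟩
      obtain ⟨g, -, B, hB, hB0, hgB⟩ := S.exists_exceptional h2.ge hnorm hinv hne
      obtain ⟨j, hj⟩ := S.term_one_eq h2 hB hB0 hgB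
      exact ⟨j, hj.symm⟩
    · rintro ε ⟨-, hε, -⟩ ε' ⟨-, hε', -⟩ heq
      refine eq_of_term_eq fun k hk1 hk2 => ?_
      rcases (by omega : k = 1 ∨ k = n) with rfl | rfl
      · exact heq
      · rw [hε, hε']
  · refine Set.finite_empty.subset ?_
    rintro ε ⟨hε, -, hne⟩
    have S : Setup Φ Δ 𝒢 ε := ⟨hn, hΦ, hΔ, h𝒢, htop, hε⟩
    obtain ⟨g, hg, B, hB, hB0, hgB⟩ := S.exists_exceptional (by omega) hnorm hinv hne
    exact S.no_exceptional h3 hg hB hB0 hgB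

/-! ### Geometric lists -/

theorem term_geometric {a θ : ℝ} {k : ℕ} (h1 : 1 ≤ k) (h2 : k ≤ n) :
    term (fun i : Fin n => a * θ ^ (n - 1 - i.1)) k = a * θ ^ (n - k) := by
  rw [term_eq ⟨h1, h2⟩, show n - 1 - (k - 1) = n - k by omega]

/-- The list is `ε_i = a θ ^ (n - i)`. Consecutive terms have quotient `1 / θ`, so suitability only
asks that `θ` be small compared with the finitely many ratios. The ratios do not depend on the list.
-/
theorem exists_isSuitable_geometric (Φ : Finset V) (Δ : Module.Basis (Fin n) ℝ V)
    (𝒢 : Set (Submodule ℝ V)) {a : ℝ} (ha : 0 < a) : ∃ b : ℝ, 0 < b ∧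
      ∀ θ ∈ Set.Ioo 0 b, IsSuitable Φ Δ 𝒢 fun i : Fin n => a * θ ^ (n - 1 - i.1) := by
  set R := 1 + ∑ i ∈ Finset.range (n + 1), ratio Φ Δ 𝒢 i (i - 1) with hR
  have hnonneg : ∀ i ∈ Finset.range (n + 1), 0 ≤ ratio Φ Δ 𝒢 i (i - 1) := fun i _ =>
    zero_le_one.trans (one_le_ratio _ _)
  have hR1 : 1 ≤ R := by
    have := Finset.sum_nonneg hnonneg
    linarith
  have hRi : ∀ i ≤ n, ratio Φ Δ 𝒢 i (i - 1) ≤ R := fun i hi => by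
    have := Finset.single_le_sum hnonneg (Finset.mem_range.2 (by omega : i < n + 1))
    linarith
  refine ⟨1 / (2 * R), by positivity, fun θ ⟨h0, h1⟩ => ?_⟩
  rw [lt_div_iff₀ (by positivity)] at h1
  have hθ1 : θ < 1 := by nlinarith
  refine ⟨fun i => by positivity, fun i j hij => ?_, fun i h2 hi => ?_⟩
  · have hij' : i.1 < j.1 := hij
    exact mul_lt_mul_of_pos_left (pow_lt_pow_right_of_lt_one₀ h0 hθ1 (by omega)) ha
  · rw [term_geometric (by omega) (by omega), term_geometric (by omega) hi,
      show n - (i - 1) = n - i + 1 by omega, pow_succ]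
    have h3 : 0 < a * θ ^ (n - i) := by positivity
    have h4 : 2 * ratio Φ Δ 𝒢 i (i - 1) * θ < 1 := by nlinarith [hRi i hi]
    calc 2 * ratio Φ Δ 𝒢 i (i - 1) * (a * (θ ^ (n - i) * θ))
        = (2 * ratio Φ Δ 𝒢 i (i - 1) * θ) * (a * θ ^ (n - i)) := by ring
      _ < 1 * (a * θ ^ (n - i)) := mul_lt_mul_of_pos_right h4 h3
      _ = a * θ ^ (n - i) := one_mul _

theorem infinite_suitable (hn : 2 ≤ n) (Φ : Finset V) (Δ : Module.Basis (Fin n) ℝ V)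
    (𝒢 : Set (Submodule ℝ V)) {a : ℝ} (ha : 0 < a) :
    {ε : Fin n → ℝ | IsSuitable Φ Δ 𝒢 ε ∧ term ε n = a}.Infinite := by
  obtain ⟨b, hb, h⟩ := exists_isSuitable_geometric Φ Δ 𝒢 ha
  refine Set.infinite_of_injOn_mapsTo (f := fun (θ : ℝ) (i : Fin n) => a * θ ^ (n - 1 - i.1))
    ?_ ?_ (Set.Ioo_infinite hb)
  · intro θ _ θ' _ heq
    have h1 := congrFun heq ⟨n - 2, by omega⟩
    simp only [show n - 1 - (n - 2) = 1 by omega, pow_one] at h1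
    exact mul_left_cancel₀ ha.ne' h1
  · intro θ hθ
    refine ⟨h θ hθ, ?_⟩
    rw [term_geometric (by omega) le_rfl, Nat.sub_self, pow_zero, mul_one]

theorem infinite_suitable_rootAut_eq (hn : 2 ≤ n) (hΦ : IsRootSystem Φ) (hnorm : IsNormalized Φ)
    (hΔ : IsSimpleBasis Φ Δ) (h𝒢 : IsBuildingSet Φ 𝒢) (htop : ⊤ ∈ 𝒢) (hinv : IsAutInvariant Φ 𝒢)
    {a : ℝ} (ha : 0 < a) : {ε : Fin n → ℝ | IsSuitable Φ Δ 𝒢 ε ∧ term ε n = a ∧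
      rootAut Φ = isometryGroup (permutonestohedron Φ Δ 𝒢 ε)}.Infinite := by
  refine ((infinite_suitable hn Φ Δ 𝒢 ha).sdiff
    (finite_exceptional (by omega) hΦ hnorm hΔ h𝒢 htop hinv a)).mono ?_
  rintro ε ⟨⟨h1, h2⟩, h3⟩
  exact ⟨h1, h2, by_contra fun h4 => h3 ⟨h1, h2, h4⟩⟩

theorem infinite_suitable_of_dim_one (hn : n = 1) (Φ : Finset V) (Δ : Module.Basis (Fin n) ℝ V)
    (𝒢 : Set (Submodule ℝ V)) : {ε : Fin n → ℝ | IsSuitable Φ Δ 𝒢 ε}.Infinite := by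
  subst hn
  refine Set.infinite_of_injOn_mapsTo (f := fun (a : ℝ) (_ : Fin 1) => a) ?_ ?_
    (Set.Ioi_infinite 0)
  · intro a _ b _ hab
    exact congrFun hab 0
  · intro a ha
    exact ⟨fun _ => ha, Subsingleton.strictMono _, fun i h1 h2 => by omega⟩

end Counting

end Permutonestohedron

theorem mainTheorem7 {V : Type*} [NormedAddCommGroup V] [InnerProductSpace ℝ V]
    [FiniteDimensional ℝ V] {n : ℕ} (hn : 1 ≤ n)
    (Φ : Finset V) (hΦ : Permutonestohedron.IsRootSystem Φ)
    (hnorm : Permutonestohedron.IsNormalized Φ)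
    (Δ : Module.Basis (Fin n) ℝ V) (hΔ : Permutonestohedron.IsSimpleBasis Φ Δ)
    (𝒢 : Set (Submodule ℝ V)) (h𝒢 : Permutonestohedron.IsBuildingSet Φ 𝒢) (htop : ⊤ ∈ 𝒢)
    (hinv : Permutonestohedron.IsAutInvariant Φ 𝒢) :
    -- for fixed `a`, all suitable lists ending in `a` but finitely many have the property
    (∀ a : ℝ, {ε : Fin n → ℝ | Permutonestohedron.IsSuitable Φ Δ 𝒢 ε ∧
        Permutonestohedron.term ε n = a ∧
        Permutonestohedron.rootAut Φ ≠ Permutonestohedron.isometryGroup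
          (Permutonestohedron.permutonestohedron Φ Δ 𝒢 ε)}.Finite) ∧
    -- infinitely many suitable lists have the property
    {ε : Fin n → ℝ | Permutonestohedron.IsSuitable Φ Δ 𝒢 ε ∧
        Permutonestohedron.rootAut Φ = Permutonestohedron.isometryGroup
          (Permutonestohedron.permutonestohedron Φ Δ 𝒢 ε)}.Infinite ∧
    -- and, in dimension at least two, already infinitely many with a given last term `a > 0`
    (2 ≤ n → ∀ a : ℝ, 0 < a →
      {ε : Fin n → ℝ | Permutonestohedron.IsSuitable Φ Δ 𝒢 ε ∧
        Permutonestohedron.term ε n = a ∧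
        Permutonestohedron.rootAut Φ = Permutonestohedron.isometryGroup
          (Permutonestohedron.permutonestohedron Φ Δ 𝒢 ε)}.Infinite) := by
  have hfin := Permutonestohedron.finite_exceptional hn hΦ hnorm hΔ h𝒢 htop hinv
  have hinf : 2 ≤ n → ∀ a : ℝ, 0 < a → _ := fun h2 _ ha =>
    Permutonestohedron.infinite_suitable_rootAut_eq h2 hΦ hnorm hΔ h𝒢 htop hinv ha
  refine ⟨hfin, ?_, hinf⟩
  -- For `n = 1` a fixed last term leaves a single list, so the infinitude comes from varying `a`.
  rcases (by omega : n = 1 ∨ 2 ≤ n) with h1 | h2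
  · exact (Permutonestohedron.infinite_suitable_of_dim_one h1 Φ Δ 𝒢).mono fun ε hε =>
      ⟨hε, Permutonestohedron.Setup.rootAut_eq_of_dim_one ⟨hn, hΦ, hΔ, h𝒢, htop, hε⟩
        h1 hnorm hinv⟩
  · exact (hinf h2 1 one_pos).mono fun ε hε => ⟨hε.1, hε.2.2⟩
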